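/- **Conventions.** A graph is a finite cell complex of dimension $\le 1$; it is a core graph if every vertex has valence $\ge 2$. A metric $\ell$ on a graph assigns a positive length to every edge so that the lengths sum to $1$; the graph is then regarded as a geodesic metric space. Let $R_n$ be the wedge of $n$ circles, and let $(\Gamma,f,\ell)$ and $(\Gamma',f',\ell')$ be core graphs with metrics and with markings, i.e. homotopy equivalences $f:R_n\to\Gamma$ and $f':R_n\to\Gamma'$. For a loop $\alpha$ in $\Gamma$, $\ell(\alpha)$ is the sum of the lengths of the edges crossed, with multiplicity, by the immersed loop freely homotopic to $\alpha$, and $\ell(\alpha)=0$ if $\alpha$ is nullhomotopic; $\ell'$ is defined likewise on loops in $\Gamma'$. A *difference of markings* is a continuous map $\phi:\Gamma\to\Gamma'$ with $\phi f\simeq f'$ that is linear on edges, i.e. each edge is mapped either to a point (slope $0$) or to an immersed path with constant speed (its slope). Let $\sigma(\phi)$ be the maximal slope of $\phi$ over the edges of $\Gamma$. The *tension graph* $\Delta_\phi\subseteq\Gamma$ is the union of the edges on which $\phi$ has slope $\sigma(\phi)$. A loop that runs through a closed edge path in $\Delta_\phi$ is *legal* if, at each vertex it passes, including its base point, the two directions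 $d,d'$ of the turn it takes satisfy $\phi_*(d)\ne\phi_*(d')$, where $\phi_*(d)$ is the direction at the image point in which $\phi$ maps $d$. **Proposition.** Let $\phi_0:\Gamma\to\Gamma'$ be a difference of markings. Then $$\inf\{\sigma(\phi)\mid \phi\simeq\phi_0:\Gamma\to\Gamma'\text{ is a difference of markings}\}=\sup_{\alpha}\frac{\ell'(\phi_0(\alpha))}{\ell(\alpha)},$$ where $\alpha$ ranges over the loops in $\Gamma$ that are not nullhomotopic. Both the infimum and the supremum are attained. Moreover, for every difference of markings $\phi\simeq\phi_0$ that attains the infimum, the supremum is attained by a legal loop in the tension graph $\Delta_\phi$. -/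

import Mathlib

open Topology

noncomputable section

namespace OuterSpace

universe u v

/-! ### Graphs as one-dimensional cell complexes -/

/-- A graph with vertex set `V` and edge set `E` (loops and multiple edges are allowed); the edge
`e` is a `1`-cell whose characteristic map `[0,1] → Γ` runs from `src e` to `tgt e`. -/
structure Multigraph (V : Type u) (E : Type v) where
  src : E → V
  tgt : E → V

namespace Multigraph

variable {V : Type u} {E : Type v}

/-- The gluing of the closed `1`-cells `{e} × [0,1]` to the vertices. -/
inductive Glue (Γ : Multigraph V E) : V ⊕ (E × unitInterval) → V ⊕ (E × unitInterval) → Prop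
  | src (e : E) : Glue Γ (Sum.inl (Γ.src e)) (Sum.inr (e, 0))
  | tgt (e : E) : Glue Γ (Sum.inl (Γ.tgt e)) (Sum.inr (e, 1))

/-- The underlying space of the graph (the cell complex itself). -/
def Realization (Γ : Multigraph V E) : Type (max u v) := Quot Γ.Glue

/-- A vertex, as a point of the graph. -/
def vertex (Γ : Multigraph V E) (x : V) : Γ.Realization := Quot.mk _ (Sum.inl x)

/-- The characteristic map of the edge `e`. -/
def edge (Γ : Multigraph V E) (e : E) (t : unitInterval) : Γ.Realization :=
  Quot.mk _ (Sum.inr (e, t))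

/-- The quotient topology of `V ⊔ (E × [0,1])`, with `V` and `E` discrete: a set is open iff
its preimage under every characteristic map is open in `[0,1]`. -/
instance (Γ : Multigraph V E) : TopologicalSpace Γ.Realization :=
  ⨆ e : E, TopologicalSpace.coinduced (Γ.edge e) inferInstance

/-- Oriented edges: `(e, true)` is `e` with its given orientation, `(e, false)` is `e` with the
opposite orientation. The directions at a vertex are the oriented edges issuing from it. -/
abbrev Dart (E : Type v) : Type v := E × Bool

/-- The initial vertex of an oriented edge. -/
def init (Γ : Multigraph V E) (d : Dart E) : V := if d.2 then Γ.src d.1 else Γ.tgt d.1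

/-- The same edge with the opposite orientation. -/
def rev (d : Dart E) : Dart E := (d.1, !d.2)

/-- The terminal vertex of an oriented edge. -/
def term (Γ : Multigraph V E) (d : Dart E) : V := Γ.init (rev d)

/-- The parametrization of an oriented edge by `[0,1]`. -/
def dart (Γ : Multigraph V E) (d : Dart E) (t : unitInterval) : Γ.Realization :=
  if d.2 then Γ.edge d.1 t else Γ.edge d.1 (unitInterval.symm t)

/-- The valence of a vertex (a loop at the vertex counts twice). -/
def valence (Γ : Multigraph V E) (x : V) : ℕ := Nat.card {d : Dart E // Γ.init d = x}

/-- Loops in `Γ`. -/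
abbrev Loop (Γ : Multigraph V E) : Type (max u v) := C(UnitAddCircle, Γ.Realization)

/-- A closed edge path `w 0, …, w m`, indexed cyclically (`i + 1` is taken modulo `m + 1`). -/
def IsClosedEdgePath (Γ : Multigraph V E) {m : ℕ} (w : Fin (m + 1) → Dart E) : Prop :=
  ∀ i, Γ.term (w i) = Γ.init (w (i + 1))

/-- The loop `α` runs through the oriented edges `w 0, …, w m` in this order, spending time
`1 / (m + 1)` on each. -/
def Traverses (Γ : Multigraph V E) (α : Γ.Loop) {m : ℕ} (w : Fin (m + 1) → Dart E) : Prop :=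
  ∀ (i : Fin (m + 1)) (t : unitInterval),
    α ((((i : ℕ) + (t : ℝ)) / (m + 1) : ℝ) : UnitAddCircle) = Γ.dart (w i) t

end Multigraph

/-- The rose with `n` petals. -/
def rose (n : ℕ) : Multigraph Unit (Fin n) where
  src _ := ()
  tgt _ := ()

/-! ### Metric graphs -/

/-- A graph with positive edge lengths of sum `1`. -/
structure MetricGraph (V : Type u) (E : Type v) [Fintype E] extends Multigraph V E where
  len : E → ℝ
  len_pos : ∀ e, 0 < len e
  sum_len : ∑ e, len e = 1

namespace MetricGraph

variable {V : Type u} {E : Type v} [Fintype E]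

/-- `G.Chain x y L`: one gets from `x` to `y` by a finite chain of segments, each inside
one closed edge, of total length `L`. -/
inductive Chain (G : MetricGraph V E) : G.Realization → G.Realization → ℝ → Prop
  | refl (x : G.Realization) : Chain G x x 0
  | step (e : E) (s t : unitInterval) {y : G.Realization} {L : ℝ} :
      Chain G (G.edge e t) y L →
      Chain G (G.edge e s) y (G.len e * |(s : ℝ) - (t : ℝ)| + L)

/-- The geodesic distance on the (connected) metric graph in which `e` has length `len e`. -/
def pathDist (G : MetricGraph V E) (x y : G.Realization) : ℝ := sInf {L | G.Chain x y L}

/-- The immersed loops: `α` runs through a closed edge path without backtracking (also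
cyclically). Up to reparametrization these are all locally injective loops in the graph.
Here `L` is the sum of the lengths of the edges crossed by `α`, with multiplicity. -/
def IsImmersedOfLength (G : MetricGraph V E) (α : G.Loop) (L : ℝ) : Prop :=
  ∃ (m : ℕ) (w : Fin (m + 1) → Multigraph.Dart E),
    G.IsClosedEdgePath w ∧ (∀ i, w (i + 1) ≠ Multigraph.rev (w i)) ∧
    G.Traverses α w ∧ L = ∑ i, G.len (w i).1

open Classical in
/-- `ℓ(α)`: zero if `α` is nullhomotopic, and otherwise the length of the immersed loop freely
homotopic to `α`. That loop is unique up to rotation and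
reparametrization, so the set below has exactly one element. -/
def loopLength (G : MetricGraph V E) (α : G.Loop) : ℝ :=
  if α.Nullhomotopic then 0
  else sInf {L | ∃ β : G.Loop, α.Homotopic β ∧ G.IsImmersedOfLength β L}

/-- The unit speed ray `[0, len d) → Γ` along the oriented edge `d`; its germ at `0` is the
direction at the initial vertex of `d` that `d` defines. -/
def ray (G : MetricGraph V E) (d : Multigraph.Dart E) (t : ℝ) : G.Realization :=
  G.dart d (Set.projIcc 0 1 zero_le_one (t / G.len d.1))

variable {V' : Type*} {E' : Type*} [Fintype E']
  {G : MetricGraph V E} {G' : MetricGraph V' E'}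

/-- `φ` is linear with slope `s` on the edge `e`: it is locally, at every point of the closed
edge, a similarity of ratio `s`. So `φ` is constant on `e` if `s = 0`, and maps `e` to an
immersed path at constant speed `s` if `s > 0`. -/
def HasSlope (φ : C(G.Realization, G'.Realization)) (e : E) (s : ℝ) : Prop :=
  ∀ t₀ : unitInterval, ∀ᶠ p : unitInterval × unitInterval in 𝓝 (t₀, t₀),
    G'.pathDist (φ (G.edge e p.1)) (φ (G.edge e p.2)) =
      s * (G.len e * |(p.1 : ℝ) - (p.2 : ℝ)|)

/-- `φ` is linear on edges. -/
def IsLinearOnEdges (φ : C(G.Realization, G'.Realization)) : Prop :=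
  ∀ e, ∃ s, HasSlope φ e s

open Classical in
/-- The slope of `φ` on the edge `e` (and `0` if `φ` is not linear on `e`). -/
def slope (φ : C(G.Realization, G'.Realization)) (e : E) : ℝ :=
  if h : ∃ s, HasSlope φ e s then h.choose else 0

theorem HasSlope.unique {φ : C(G.Realization, G'.Realization)} {e : E} {s s' : ℝ}
    (h : HasSlope φ e s) (h' : HasSlope φ e s') : s = s' := by
  have h1 := (h 0).and (h' 0)
  rw [nhds_prod_eq] at h1
  have h2 : ∀ᶠ t : unitInterval in 𝓝 0, s * (G.len e * t) = s' * (G.len e * t) := by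
    have h3 : Filter.Tendsto (fun t : unitInterval => (t, (0 : unitInterval))) (𝓝 0)
        (𝓝 0 ×ˢ 𝓝 0) := Filter.tendsto_id.prodMk tendsto_const_nhds
    filter_upwards [h3.eventually h1] with t ht
    have := ht.1.symm.trans ht.2
    simpa [abs_of_nonneg t.2.1] using this
  have h4 : Filter.Tendsto (fun n : ℕ => (⟨1 / ((n : ℝ) + 1), by positivity, by
      rw [div_le_one (by positivity)]; linarith [Nat.cast_nonneg (α := ℝ) n]⟩ : unitInterval))
      Filter.atTop (𝓝 0) := by
    rw [tendsto_subtype_rng]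
    exact tendsto_one_div_add_atTop_nhds_zero_nat
  obtain ⟨n, hn⟩ := (h4.eventually h2).exists
  have : 0 < G.len e * (1 / ((n : ℝ) + 1)) := mul_pos (G.len_pos e) (by positivity)
  exact mul_right_cancel₀ this.ne' hn

theorem HasSlope.slope_eq {φ : C(G.Realization, G'.Realization)} {e : E} {s : ℝ}
    (h : HasSlope φ e s) : slope φ e = s := by
  have h' : ∃ s, HasSlope φ e s := ⟨s, h⟩
  rw [slope, dif_pos h']
  exact h'.choose_spec.unique h

/-- `σ(φ)`, the maximal slope of `φ` (a maximum over the finite nonempty set of edges). -/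
def maxSlope (φ : C(G.Realization, G'.Realization)) : ℝ := ⨆ e, slope φ e

/-- The set of edges of the tension graph `Δ_φ`: those on which the slope is maximal. -/
def tensionEdges (φ : C(G.Realization, G'.Realization)) : Set E :=
  {e | slope φ e = maxSlope φ}

/-- The direction `φ_*(d)`, for an edge of nonzero slope: the germ at `0` of the image under `φ`
of the ray along `d`, reparametrized to have unit speed. -/
def pushDirection (φ : C(G.Realization, G'.Realization)) (d : Multigraph.Dart E) :
    Filter.Germ (𝓝[≥] (0 : ℝ)) G'.Realization :=
  ((fun t : ℝ => φ (G.ray d (t / slope φ d.1)) : ℝ → G'.Realization) :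
    Filter.Germ (𝓝[≥] (0 : ℝ)) G'.Realization)

/-- `α` is a legal loop in the tension graph of `φ`: it runs through a closed edge path in `Δ_φ`,
and at each (cyclically) consecutive pair of edges it takes a legal turn, i.e. `φ_*` separates
the two directions of the turn. -/
def IsLegalLoop (φ : C(G.Realization, G'.Realization)) (α : G.Loop) : Prop :=
  ∃ (m : ℕ) (w : Fin (m + 1) → Multigraph.Dart E),
    G.IsClosedEdgePath w ∧ (∀ i, (w i).1 ∈ tensionEdges φ) ∧
    (∀ i, pushDirection φ (Multigraph.rev (w i)) ≠ pushDirection φ (w (i + 1))) ∧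
    G.Traverses α w

end MetricGraph

/-! ### Marked metric graphs -/

/-- A triple `(Γ, f, ℓ)` representing a point of Outer space in rank `n`: a core graph (all
valences are at least `2`) with a marking `f : R_n → Γ` (a homotopy equivalence) and a metric. -/
structure MarkedGraph (n : ℕ) (V : Type u) (E : Type v) [Fintype E] extends
    MetricGraph V E where
  core : ∀ x : V, 2 ≤ toMultigraph.valence x
  marking : ContinuousMap.HomotopyEquiv (rose n).Realization toMultigraph.Realization

namespace MarkedGraph

variable {n : ℕ} {V : Type*} {E : Type*} {V' : Type*} {E' : Type*} [Fintype E] [Fintype E']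

/-- `φ : Γ → Γ'` is a difference of markings: `φ ∘ f ≃ f'`, and `φ` is linear on edges. -/
def IsDifferenceOfMarkings (G : MarkedGraph n V E) (G' : MarkedGraph n V' E')
    (φ : C(G.Realization, G'.Realization)) : Prop :=
  (φ.comp G.marking.toFun).Homotopic G'.marking.toFun ∧
    MetricGraph.IsLinearOnEdges (G := G.toMetricGraph) (G' := G'.toMetricGraph) φ

/-- The maximal slopes `σ(φ)` of all differences of markings `φ` homotopic to `φ₀`. -/
def slopeSet (G : MarkedGraph n V E) (G' : MarkedGraph n V' E')
    (φ₀ : C(G.Realization, G'.Realization)) : Set ℝ :=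
  {r | ∃ φ : C(G.Realization, G'.Realization), φ.Homotopic φ₀ ∧
    G.IsDifferenceOfMarkings G' φ ∧
    r = MetricGraph.maxSlope (G := G.toMetricGraph) (G' := G'.toMetricGraph) φ}

/-- The stretching factors `ℓ'(φ₀(α)) / ℓ(α)` of all loops `α` that are not nullhomotopic. -/
def stretchSet (G : MarkedGraph n V E) (G' : MarkedGraph n V' E')
    (φ₀ : C(G.Realization, G'.Realization)) : Set ℝ :=
  {r | ∃ α : G.Loop, ¬ α.Nullhomotopic ∧
    r = G'.loopLength (φ₀.comp α) / G.loopLength α}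

end MarkedGraph

end OuterSpace

end

/-! Both sides of the equation are computed in trees. The free group on the edges of a graph acts
freely on a covering of the graph, a forest with edge set `E × FreeGroup E`. A point of the forest
is described by the signed edges of the Cayley tree that lie between the base vertex and that point
(`dev`), and the weighted ℓ¹ distance `treeDist` of these descriptions satisfies the four point
condition (`isTreeDist`). It cannot tell components apart, but on each component it is a genuine
distance inducing the topology. A loop lifts to a path equivariant under some `g`, and the length of
an essential loop is the least displacement of `g` (`isLeast_loopLength`).

A map to `Γ'` is recorded by lifts `x v` of the images of the vertices and by deck transformations
`k e` that label the edges (`LiftData`). Pulling the edges tight gives a homotopic map with slopes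
`imageSlope`, and moving each `x v` inside its component does not change the homotopy class. So the
infimum of the slopes is the minimum of the sup norm of `imageSlope` over such `x`. It is attained
(`exists_isMin_norm_imageSlope`): up to deck transformations the points `x v` range over finitely
many closed edges, and a bound on the slopes leaves finitely many labels.

The supremum is at most the infimum because the displacement of a vertex along the image of a closed
path is at most the sum of the lengths of the images of its edges (`loopLength_comp_le`). For
equality, take among the optimal `x` one with the fewest tension edges. If a tension edge `d` ending
at `v` had no legal continuation, then all tension edges would leave `v` in the direction of the
reversed `d`; dragging the image of `v` a little that way would shorten all of them and produce
fewer tension edges (`exists_legalTurn`). So every oriented tension edge has a legal continuation,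
and following continuations in a finite set closes up to a legal cycle. Its image is locally
geodesic, hence runs along an axis, and is stretched by exactly the maximal slope `σ`. Here `σ > 0`,
since a core graph contains an essential loop and a difference of markings, being a homotopy
equivalence, does not kill it.

One such loop serves every optimal map `φ`. For it both inequalities in `ℓ'(φ(α)) ≤ Σ (image
lengths) ≤ σ ℓ(α)` are equalities. The second puts every edge of the loop in the tension graph; the
first puts the images of the vertices on an axis, so all turns are legal
(`isLegalLoop_of_loopLength_eq`). -/

open Topology

set_option linter.unusedSectionVars false

noncomputable section

namespace OuterSpace

universe u v

namespace Multigraph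

variable {V : Type u} {E : Type v} (Γ : Multigraph V E)

/-! ### The topology of a graph -/

theorem edge_zero (e : E) : Γ.edge e 0 = Γ.vertex (Γ.src e) :=
  (Quot.sound (Glue.src e)).symm

theorem edge_one (e : E) : Γ.edge e 1 = Γ.vertex (Γ.tgt e) :=
  (Quot.sound (Glue.tgt e)).symm

theorem continuous_edge (e : E) : Continuous (Γ.edge e) :=
  continuous_iff_coinduced_le.2 (le_iSup
    (fun e : E => TopologicalSpace.coinduced (Γ.edge e) inferInstance) e)

theorem isOpen_iff {U : Set Γ.Realization} : IsOpen U ↔ ∀ e, IsOpen (Γ.edge e ⁻¹' U) := by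
  rw [show IsOpen U ↔ _ from isOpen_iSup_iff]
  simp_rw [isOpen_coinduced]

variable {Γ}

theorem continuous_iff {Y : Type*} [TopologicalSpace Y] {f : Γ.Realization → Y} :
    Continuous f ↔ ∀ e, Continuous fun t => f (Γ.edge e t) := by
  rw [show Continuous f ↔ _ from continuous_iSup_dom]
  exact forall_congr' fun e => continuous_coinduced_dom

theorem realization_ind {p : Γ.Realization → Prop} (hv : ∀ x, p (Γ.vertex x))
    (he : ∀ e t, p (Γ.edge e t)) (x : Γ.Realization) : p x :=
  Quot.ind (fun | .inl x => hv x | .inr (e, t) => he e t) x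

/-- The map out of a graph that is given on vertices by `fv` and on edges by `fe`. -/
def lift {Y : Type*} (fv : V → Y) (fe : E → unitInterval → Y) (h0 : ∀ e, fv (Γ.src e) = fe e 0)
    (h1 : ∀ e, fv (Γ.tgt e) = fe e 1) : Γ.Realization → Y :=
  Quot.lift (Sum.elim fv fun p => fe p.1 p.2) (by
    rintro _ _ (⟨e⟩ | ⟨e⟩)
    exacts [h0 e, h1 e])

variable (Γ)

theorem dart_zero (d : Dart E) : Γ.dart d 0 = Γ.vertex (Γ.init d) := by
  rcases d with ⟨e, _ | _⟩ <;> simp [dart, init, edge_zero, edge_one]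

theorem dart_one (d : Dart E) : Γ.dart d 1 = Γ.vertex (Γ.term d) := by
  rcases d with ⟨e, _ | _⟩ <;> simp [dart, term, rev, init, edge_zero, edge_one]

theorem rev_rev (d : Dart E) : rev (rev d) = d := by simp [rev]

theorem rev_ne (d : Dart E) : rev d ≠ d := by
  rcases d with ⟨e, _ | _⟩ <;> simp [rev]

theorem term_rev (d : Dart E) : Γ.term (rev d) = Γ.init d := by simp [term, rev_rev]

theorem continuous_dart (d : Dart E) : Continuous (Γ.dart d) := by
  rcases d with ⟨e, _ | _⟩
  · exact (Γ.continuous_edge e).comp unitInterval.continuous_symm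
  · exact Γ.continuous_edge e

/-- Every vertex is the initial vertex of some oriented edge. -/
def NoIsolated : Prop := ∀ x, ∃ d, Γ.init d = x

variable {Γ}

/-- Maps and points are handled edge by edge throughout. This misses only isolated vertices, which a
core graph does not have. -/
theorem NoIsolated.exists_edge_eq (h : Γ.NoIsolated) (x : Γ.Realization) :
    ∃ e t, Γ.edge e t = x := by
  induction x using realization_ind with
  | hv x =>
    obtain ⟨⟨e, _ | _⟩, rfl⟩ := h x
    · exact ⟨e, 1, Γ.edge_one e⟩
    · exact ⟨e, 0, Γ.edge_zero e⟩
  | he e t => exact ⟨e, t, rfl⟩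

variable (Γ)

/-! ### The covering by a forest on which the free group on the edges acts -/

/-- The covering of `Γ` with deck group `FreeGroup E` in which lifting the edge `e` multiplies the
sheet by the generator `e`. -/
def cover : Multigraph (V × FreeGroup E) (E × FreeGroup E) where
  src p := (Γ.src p.1, p.2)
  tgt p := (Γ.tgt p.1, p.2 * FreeGroup.of p.1)

theorem cover_src (p : E × FreeGroup E) : Γ.cover.src p = (Γ.src p.1, p.2) := rfl

theorem cover_tgt (p : E × FreeGroup E) :
    Γ.cover.tgt p = (Γ.tgt p.1, p.2 * FreeGroup.of p.1) := rfl

/-- The covering space. -/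
abbrev Cover : Type (max u v) := Γ.cover.Realization

/-- The covering projection. -/
def proj : Γ.Cover → Γ.Realization :=
  lift (fun x => Γ.vertex x.1) (fun e t => Γ.edge e.1 t)
    (fun e => (Γ.edge_zero e.1).symm) (fun e => (Γ.edge_one e.1).symm)

@[simp] theorem proj_vertex (x : V × FreeGroup E) : Γ.proj (Γ.cover.vertex x) = Γ.vertex x.1 := rfl

@[simp] theorem proj_edge (e : E × FreeGroup E) (t : unitInterval) :
    Γ.proj (Γ.cover.edge e t) = Γ.edge e.1 t := rfl

instance : MulAction (FreeGroup E) Γ.Cover where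
  smul g := lift (fun x => Γ.cover.vertex (x.1, g * x.2)) (fun e t => Γ.cover.edge (e.1, g * e.2) t)
    (fun e => (Γ.cover.edge_zero (e.1, g * e.2)).symm)
    (fun e => ((Γ.cover.edge_one (e.1, g * e.2)).trans (by simp [cover, mul_assoc])).symm)
  one_smul x := by
    induction x using realization_ind with
    | hv x => exact congrArg Γ.cover.vertex (by simp)
    | he e t => exact congrArg (fun e => Γ.cover.edge e t) (by simp)
  mul_smul g h x := by
    induction x using realization_ind with
    | hv x => exact congrArg Γ.cover.vertex (by simp [mul_assoc])
    | he e t => exact congrArg (fun e => Γ.cover.edge e t) (by simp [mul_assoc])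

@[simp] theorem smul_vertex (g : FreeGroup E) (x : V × FreeGroup E) :
    g • Γ.cover.vertex x = Γ.cover.vertex (x.1, g * x.2) := rfl

@[simp] theorem smul_edge (g : FreeGroup E) (e : E × FreeGroup E) (t : unitInterval) :
    g • Γ.cover.edge e t = Γ.cover.edge (e.1, g * e.2) t := rfl

instance : ContinuousConstSMul (FreeGroup E) Γ.Cover where
  continuous_const_smul g := continuous_iff.2 fun e => Γ.cover.continuous_edge (e.1, g * e.2)

theorem continuous_proj : Continuous Γ.proj :=
  continuous_iff.2 fun e => Γ.continuous_edge e.1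

@[simp] theorem proj_smul (g : FreeGroup E) (x : Γ.Cover) : Γ.proj (g • x) = Γ.proj x := by
  induction x using realization_ind <;> rfl

/-- The open star of radius `r` around a vertex. -/
def star {V : Type u} {E : Type v} (Γ : Multigraph V E) (x : V) (r : unitInterval → Prop)
    (h0 : r 0) (h1 : ¬ r 1) : Set Γ.Realization :=
  {z | lift (Γ := Γ) (fun y => y = x)
    (fun e t => (r t ∧ Γ.src e = x) ∨ (r (unitInterval.symm t) ∧ Γ.tgt e = x))
    (fun e => by simp [h0, h1]) (fun e => by simp [h0, h1]) z}

theorem mem_star_vertex {V : Type u} {E : Type v} {Γ : Multigraph V E} {x : V}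
    {r : unitInterval → Prop} {h0 : r 0} {h1 : ¬ r 1} {y : V} :
    Γ.vertex y ∈ Γ.star x r h0 h1 ↔ y = x := Iff.rfl

theorem mem_star_edge {V : Type u} {E : Type v} {Γ : Multigraph V E} {x : V}
    {r : unitInterval → Prop} {h0 : r 0} {h1 : ¬ r 1} {e : E} {t : unitInterval} :
    Γ.edge e t ∈ Γ.star x r h0 h1 ↔
      (r t ∧ Γ.src e = x) ∨ (r (unitInterval.symm t) ∧ Γ.tgt e = x) := Iff.rfl

theorem isOpen_star {V : Type u} {E : Type v} {Γ : Multigraph V E} {x : V}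
    {r : unitInterval → Prop} {h0 : r 0} {h1 : ¬ r 1} (hr : IsOpen {t | r t}) :
    IsOpen (Γ.star x r h0 h1) := by
  refine Γ.isOpen_iff.2 fun e => ?_
  simp only [Set.preimage, mem_star_edge, Set.ofPred_or, Set.ofPred_and]
  exact (hr.inter isOpen_const).union
    ((hr.preimage unitInterval.continuous_symm).inter isOpen_const)

/-- The open edge `e`. -/
def openEdge {V : Type u} {E : Type v} (Γ : Multigraph V E) (e : E) : Set Γ.Realization :=
  {z | lift (Γ := Γ) (fun _ => False) (fun e' t => e' = e ∧ 0 < t ∧ t < 1)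
    (fun e => by simp) (fun e => by simp) z}

theorem mem_openEdge {V : Type u} {E : Type v} {Γ : Multigraph V E} {e e' : E}
    {t : unitInterval} : Γ.edge e' t ∈ Γ.openEdge e ↔ e' = e ∧ 0 < t ∧ t < 1 := Iff.rfl

theorem isOpen_openEdge {V : Type u} {E : Type v} {Γ : Multigraph V E} {e : E} :
    IsOpen (Γ.openEdge e) := by
  refine Γ.isOpen_iff.2 fun e' => ?_
  simp only [Set.preimage, mem_openEdge, Set.ofPred_and]
  exact isOpen_const.inter (isOpen_Ioi.inter isOpen_Iio)

/-- The orbit of the lifts of a point. -/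
def orbitOfPoint : Γ.Realization → MulAction.orbitRel.Quotient (FreeGroup E) Γ.Cover :=
  lift (fun x => Quotient.mk _ (Γ.cover.vertex (x, 1)))
    (fun e t => Quotient.mk _ (Γ.cover.edge (e, 1) t))
    (fun e => by rw [edge_zero]; rfl)
    (fun e => by
      rw [edge_one]
      refine Quotient.sound ((MulAction.orbitRel_apply (G := FreeGroup E)).2
        ⟨(FreeGroup.of e)⁻¹, ?_⟩)
      simp [cover_tgt])

/-- The orbit of a point can be recovered from its projection, so the fibres of `proj` are single
orbits. -/
theorem orbitOfPoint_proj (x : Γ.Cover) : Γ.orbitOfPoint (Γ.proj x) = Quotient.mk _ x := by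
  induction x using realization_ind with
  | hv x => exact Quotient.sound ((MulAction.orbitRel_apply (G := FreeGroup E)).2
        ⟨x.2⁻¹, by simp⟩)
  | he e t => exact Quotient.sound ((MulAction.orbitRel_apply (G := FreeGroup E)).2
        ⟨e.2⁻¹, by simp⟩)

theorem isQuotientCoveringMap_proj (hΓ : Γ.NoIsolated) :
    IsQuotientCoveringMap Γ.proj (FreeGroup E) where
  toContinuousConstSMul := inferInstance
  toIsQuotientMap := by
    refine ((isQuotientMap_iff _).2 ⟨isCoinducing_iff.2 fun U =>
      ⟨fun h => Γ.isOpen_iff.2 fun e => Γ.cover.isOpen_iff.1 h (e, 1),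
        fun h => h.preimage Γ.continuous_proj⟩, fun x => ?_⟩)
    obtain ⟨e, t, rfl⟩ := hΓ.exists_edge_eq x
    exact ⟨Γ.cover.edge (e, 1) t, rfl⟩
  apply_eq_iff_mem_orbit {x y} := by
    refine ⟨fun h => ?_, ?_⟩
    · rw [← MulAction.orbitRel_apply]
      exact Quotient.exact (by rw [← Γ.orbitOfPoint_proj x, h, Γ.orbitOfPoint_proj y])
    · rintro ⟨g, rfl⟩
      exact Γ.proj_smul g y
  disjoint x := by
    have key (v : V × FreeGroup E) : ∃ U ∈ 𝓝 (Γ.cover.vertex v), ∀ g : FreeGroup E,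
        ((g • ·) '' U ∩ U).Nonempty → g = 1 := by
      -- With radius `1/2` no point of an edge is near both of its ends, so a translate meeting the
      -- star must identify starts with starts or ends with ends, which determines the sheet.
      refine ⟨Γ.cover.star v (fun t => (t : ℝ) < 1 / 2) (by norm_num) (by norm_num),
        (isOpen_star (isOpen_lt continuous_subtype_val continuous_const)).mem_nhds
          (mem_star_vertex.2 rfl), ?_⟩
      rintro g ⟨_, ⟨z, hz, rfl⟩, hz'⟩
      induction z using realization_ind with
      | hv z =>
        simp only [smul_vertex, mem_star_vertex] at hz hz'
        subst hz
        simpa using congrArg Prod.snd hz'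
      | he e t =>
        simp only [smul_edge, mem_star_edge, unitInterval.coe_symm_eq] at hz hz'
        rcases hz with ⟨h1, h2⟩ | ⟨h1, h2⟩ <;> rcases hz' with ⟨h3, h4⟩ | ⟨h3, h4⟩
        · simpa [cover] using congrArg Prod.snd (h4.trans h2.symm)
        · linarith
        · linarith
        · simpa [cover, mul_assoc] using congrArg Prod.snd (h4.trans h2.symm)
    induction x using realization_ind with
    | hv v => exact key v
    | he e t =>
      rcases eq_or_ne t 0 with rfl | h0
      · rw [edge_zero]
        exact key _
      rcases eq_or_ne t 1 with rfl | h1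
      · rw [edge_one]
        exact key _
      refine ⟨Γ.cover.openEdge e, isOpen_openEdge.mem_nhds (mem_openEdge.2
        ⟨rfl, unitInterval.pos_iff_ne_zero.2 h0, unitInterval.lt_one_iff_ne_one.2 h1⟩), ?_⟩
      rintro g ⟨_, ⟨z, hz, rfl⟩, hz'⟩
      induction z using realization_ind with
      | hv z => exact hz.elim
      | he e' t =>
        simp only [smul_edge, mem_openEdge] at hz hz'
        simpa using congrArg Prod.snd (hz'.1.trans hz.1.symm)

end Multigraph

namespace Multigraph

variable {V : Type u} {E : Type v}

/-! ### The Fox cocycle of the free group on the edges -/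

/-- The generator of the free group, or its inverse, that corresponds to an oriented edge. -/
abbrev letter (d : Dart E) : FreeGroup E := FreeGroup.mk [d]

theorem letter_true (e : E) : letter (e, true) = FreeGroup.of e := rfl

theorem letter_false (e : E) : letter (e, false) = (FreeGroup.of e)⁻¹ := rfl

theorem letter_rev (d : Dart E) : letter (rev d) = (letter d)⁻¹ := by
  rcases d with ⟨e, _ | _⟩
  · simp [rev, letter_false, letter_true]
  · rfl

/-- The edge of the Cayley tree that is crossed by the letter `d` read at `h`. -/
def foxIndex (h : FreeGroup E) (d : Dart E) : E × FreeGroup E :=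
  if d.2 then (d.1, h) else (d.1, h * letter d)

theorem foxIndex_rev (h : FreeGroup E) (d : Dart E) :
    foxIndex (h * letter d) (rev d) = foxIndex h d := by
  rcases d with ⟨e, _ | _⟩
  · simp [foxIndex, rev]
  · change (e, h * letter (e, true) * letter (rev (e, true))) = (e, h)
    rw [letter_rev, mul_inv_cancel_right]

theorem foxIndex_mul (k h : FreeGroup E) (d : Dart E) :
    foxIndex (k * h) d = ((foxIndex h d).1, k * (foxIndex h d).2) := by
  rcases d with ⟨e, _ | _⟩ <;> simp [foxIndex, mul_assoc]

/-- The sign of a letter. -/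
def dartSign (d : Dart E) : ℝ := if d.2 then 1 else -1

theorem dartSign_eq_or (d : Dart E) : dartSign d = 1 ∨ dartSign d = -1 := by
  rcases d with ⟨e, _ | _⟩ <;> simp [dartSign]

theorem dartSign_ne_zero (d : Dart E) : dartSign d ≠ 0 := by
  rcases dartSign_eq_or d with h | h <;> simp [h]

theorem dartSign_rev (d : Dart E) : dartSign (rev d) = - dartSign d := by
  rcases d with ⟨e, _ | _⟩ <;> simp [dartSign, rev]

/-- The signed number of times that the path in the Cayley tree which reads a word from `h`
crosses each edge. -/
def foxWord : FreeGroup E → List (Dart E) → (E × FreeGroup E →₀ ℝ)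
  | _, [] => 0
  | h, d :: L => Finsupp.single (foxIndex h d) (dartSign d) + foxWord (h * letter d) L

theorem foxWord_append (h : FreeGroup E) (L L' : List (Dart E)) :
    foxWord h (L ++ L') = foxWord h L + foxWord (h * FreeGroup.mk L) L' := by
  induction L generalizing h with
  | nil => simp [foxWord, ← FreeGroup.one_eq_mk]
  | cons d L ih =>
    rw [List.cons_append, foxWord, ih, foxWord, add_assoc, mul_assoc, FreeGroup.mul_mk]
    rfl

theorem foxWord_cancel (h : FreeGroup E) (d : Dart E) (L : List (Dart E)) :
    foxWord h (d :: rev d :: L) = foxWord h L := by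
  simp only [foxWord, foxIndex_rev, dartSign_rev, letter_rev, mul_inv_cancel_right,
    ← add_assoc, ← Finsupp.single_add, add_neg_cancel, Finsupp.single_zero, zero_add]

theorem foxWord_step (h : FreeGroup E) {L L' : List (Dart E)} (hs : FreeGroup.Red.Step L L') :
    foxWord h L = foxWord h L' := by
  obtain ⟨⟩ := hs
  rw [foxWord_append, foxWord_append]
  congr 1
  exact foxWord_cancel _ _ _

/-- The Fox cocycle. -/
def fox (g : FreeGroup E) : E × FreeGroup E →₀ ℝ :=
  Quot.lift (foxWord 1) (fun _ _ => foxWord_step 1) g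

theorem fox_mk (L : List (Dart E)) : fox (FreeGroup.mk L) = foxWord 1 L := rfl

/-- Left translation of finitely supported functions. -/
def shift (k : FreeGroup E) : (E × FreeGroup E →₀ ℝ) →+ (E × FreeGroup E →₀ ℝ) :=
  Finsupp.mapDomain.addMonoidHom fun i => (i.1, k * i.2)

theorem shift_single (k : FreeGroup E) (i : E × FreeGroup E) (c : ℝ) :
    shift k (Finsupp.single i c) = Finsupp.single (i.1, k * i.2) c :=
  Finsupp.mapDomain_single

theorem foxWord_mul (k h : FreeGroup E) (L : List (Dart E)) :
    foxWord (k * h) L = shift k (foxWord h L) := by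
  induction L generalizing h with
  | nil => simp [foxWord]
  | cons d L ih => rw [foxWord, foxWord, map_add, shift_single, foxIndex_mul, mul_assoc, ih]

theorem fox_mul (k g : FreeGroup E) : fox (k * g) = fox k + shift k (fox g) := by
  induction k using Quot.ind with | _ K
  induction g using Quot.ind with | _ L
  change fox (FreeGroup.mk K * FreeGroup.mk L) =
    fox (FreeGroup.mk K) + shift (FreeGroup.mk K) (fox (FreeGroup.mk L))
  rw [FreeGroup.mul_mk, fox_mk, fox_mk, fox_mk, foxWord_append, one_mul, ← foxWord_mul, mul_one]

theorem fox_one : fox (1 : FreeGroup E) = 0 := rfl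

theorem fox_mul_letter (g : FreeGroup E) (d : Dart E) :
    fox (g * letter d) = fox g + Finsupp.single (foxIndex g d) (dartSign d) := by
  rw [fox_mul, fox_mk, foxWord, foxWord, add_zero, shift_single]
  have := foxIndex_mul g 1 d
  rw [mul_one] at this
  rw [this]

/-- Vertices have integral coordinates. This discreteness lets small distances in the Cayley tree
identify the edge that a point lies on. -/
theorem fox_int (g : FreeGroup E) (i : E × FreeGroup E) : ∃ n : ℤ, fox g i = n := by
  have aux : ∀ (L : List (Dart E)) h, ∃ n : ℤ, foxWord h L i = n := by
    intro L
    induction L with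
    | nil => exact fun h => ⟨0, by simp [foxWord]⟩
    | cons d L ih =>
      intro h
      obtain ⟨n, hn⟩ := ih (h * letter d)
      classical
      rw [foxWord, Finsupp.add_apply, hn, Finsupp.single_apply]
      split_ifs
      · rcases dartSign_eq_or d with hd | hd
        · exact ⟨1 + n, by rw [hd]; push_cast; ring⟩
        · exact ⟨-1 + n, by rw [hd]; push_cast; ring⟩
      · exact ⟨n, by simp⟩
  induction g using Quot.ind with | _ L
  exact aux L 1

/-! ### Coordinates of the points of the covering forest -/

variable (Γ : Multigraph V E)

/-- The developing map of the covering forest into the space of finitely supported functions on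
the edges of the Cayley tree. -/
def dev : Γ.Cover → (E × FreeGroup E →₀ ℝ) :=
  lift (fun x => fox x.2) (fun e t => fox e.2 + Finsupp.single e (t : ℝ))
    (fun e => by simp [cover_src]) (fun e => by
      rw [cover_tgt, ← letter_true, fox_mul_letter]
      simp [foxIndex, dartSign])

theorem dev_vertex (x : V × FreeGroup E) : Γ.dev (Γ.cover.vertex x) = fox x.2 := rfl

theorem dev_edge (e : E × FreeGroup E) (t : unitInterval) :
    Γ.dev (Γ.cover.edge e t) = fox e.2 + Finsupp.single e (t : ℝ) := rfl

/-- The deck group acts on the coordinates by affine maps whose linear part permutes the edges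
within their orbits, hence by isometries of the weighted ℓ¹ norm. -/
theorem dev_smul (g : FreeGroup E) (x : Γ.Cover) :
    Γ.dev (g • x) = fox g + shift g (Γ.dev x) := by
  induction x using realization_ind with
  | hv x => rw [smul_vertex, dev_vertex, dev_vertex, fox_mul]
  | he e t => rw [smul_edge, dev_edge, dev_edge, map_add, shift_single, fox_mul, add_assoc]

/-! ### Reduced words and the order of the Cayley tree -/

theorem isReduced_pair_iff {a b : Dart E} : (a.1 = b.1 → a.2 = b.2) ↔ b ≠ rev a := by
  rcases a with ⟨a, i⟩
  rcases b with ⟨b, j⟩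
  simp only [rev, ne_eq, Prod.mk.injEq, not_and]
  cases i <;> cases j <;> simp [eq_comm]

variable [DecidableEq E]

theorem eq_of_mk_eq {L L' : List (Dart E)} (h : FreeGroup.IsReduced L)
    (h' : FreeGroup.IsReduced L') (heq : FreeGroup.mk L = FreeGroup.mk L') : L = L' := by
  rw [← h.reduce_eq, ← h'.reduce_eq, ← FreeGroup.toWord_mk, heq, FreeGroup.toWord_mk]

/-- In a tree an edge is the last edge of only one reduced path from the base vertex. Two paths
crossing it in opposite directions are excluded because one of them would end in a letter followed
by its inverse. -/
theorem foxIndex_inj {L L' : List (Dart E)} {d d' : Dart E}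
    (h : FreeGroup.IsReduced (L ++ [d])) (h' : FreeGroup.IsReduced (L' ++ [d']))
    (heq : foxIndex (FreeGroup.mk L) d = foxIndex (FreeGroup.mk L') d') : L = L' ∧ d = d' := by
  have hL := h.infix (List.prefix_append L [d]).isInfix
  have hL' := h'.infix (List.prefix_append L' [d']).isInfix
  have aux : ∀ {L L' : List (Dart E)} {e : E}, FreeGroup.IsReduced L →
      FreeGroup.IsReduced (L' ++ [(e, false)]) → FreeGroup.IsReduced (L ++ [(e, true)]) →
      FreeGroup.mk L = FreeGroup.mk L' * letter (e, false) → False := by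
    intro L L' e h1 h2 h3 h4
    rw [FreeGroup.mul_mk] at h4
    rw [eq_of_mk_eq h1 h2 h4, List.append_assoc] at h3
    have := h3.infix (List.suffix_append L' _).isInfix
    simp [FreeGroup.IsReduced] at this
  rcases d with ⟨e, b⟩
  rcases d' with ⟨e', b'⟩
  obtain rfl : e = e' := by
    have := congrArg Prod.fst heq
    cases b <;> cases b' <;> simpa [foxIndex] using this
  have heq' := congrArg Prod.snd heq
  cases b <;> cases b' <;>
    simp only [foxIndex, if_true, Bool.false_eq_true, if_false, mul_left_inj] at heq'
  · exact ⟨eq_of_mk_eq hL hL' heq', rfl⟩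
  · exact (aux hL' h h' heq'.symm).elim
  · exact (aux hL h' h heq').elim
  · exact ⟨eq_of_mk_eq hL hL' heq', rfl⟩

/-- The function `f` on the edges of the Cayley tree is the indicator of a segment that starts at
the base vertex and runs along the reduced word `W`, possibly not to the end of its last edge. -/
structure IsSegment (W : List (Dart E)) (f : E × FreeGroup E →₀ ℝ) : Prop where
  reduced : FreeGroup.IsReduced W
  exists_of_ne : ∀ i, f i ≠ 0 → ∃ L d L', W = L ++ d :: L' ∧ foxIndex (FreeGroup.mk L) d = i
  nonneg : ∀ L d L', W = L ++ d :: L' → 0 ≤ dartSign d * f (foxIndex (FreeGroup.mk L) d)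
  eq_one : ∀ L d L', W = L ++ d :: L' → L' ≠ [] →
    dartSign d * f (foxIndex (FreeGroup.mk L) d) = 1

theorem foxWord_exists_of_ne {W : List (Dart E)} {i : E × FreeGroup E} {h : FreeGroup E}
    (hi : foxWord h W i ≠ 0) :
    ∃ L d L', W = L ++ d :: L' ∧ foxIndex (h * FreeGroup.mk L) d = i := by
  induction W generalizing h with
  | nil => simp [foxWord] at hi
  | cons d W ih =>
    by_cases hd : foxIndex h d = i
    · exact ⟨[], d, W, rfl, by simpa [← FreeGroup.one_eq_mk] using hd⟩
    · rw [foxWord, Finsupp.add_apply, Finsupp.single_apply, if_neg hd, zero_add] at hi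
      obtain ⟨L, d', L', rfl, h2⟩ := ih hi
      refine ⟨d :: L, d', L', rfl, ?_⟩
      rw [← h2, mul_assoc, FreeGroup.mul_mk]
      rfl

theorem isReduced_prefix {L L' : List (Dart E)} {d : Dart E}
    (h : FreeGroup.IsReduced (L ++ d :: L')) : FreeGroup.IsReduced (L ++ [d]) :=
  h.infix ⟨[], L', by simp⟩

/-- A reduced path crosses each of its edges exactly once: by `foxIndex_inj`, a second crossing
would come from a prefix of the same length. -/
theorem foxWord_apply_foxIndex {L L' : List (Dart E)} {d : Dart E}
    (h : FreeGroup.IsReduced (L ++ d :: L')) :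
    foxWord 1 (L ++ d :: L') (foxIndex (FreeGroup.mk L) d) = dartSign d := by
  have h1 : foxWord 1 L (foxIndex (FreeGroup.mk L) d) = 0 := by
    by_contra hne
    obtain ⟨M, d', M', h1, h2⟩ := foxWord_exists_of_ne hne
    rw [one_mul] at h2
    rw [h1, List.append_assoc] at h
    have h3 := (foxIndex_inj (isReduced_prefix h) (isReduced_prefix (by simpa [h1] using h)) h2).1
    rw [h1] at h3
    simpa using congrArg List.length h3
  have h2 : foxWord (FreeGroup.mk L * letter d) L' (foxIndex (FreeGroup.mk L) d) = 0 := by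
    by_contra hne
    obtain ⟨M, d', M', h1, h2⟩ := foxWord_exists_of_ne hne
    rw [FreeGroup.mul_mk, FreeGroup.mul_mk] at h2
    have h3 := (foxIndex_inj (isReduced_prefix (L' := M') (by simpa [h1] using h))
      (isReduced_prefix h) h2).1
    simpa using congrArg List.length h3
  rw [foxWord_append, foxWord, one_mul, Finsupp.add_apply, Finsupp.add_apply, h1, h2,
    Finsupp.single_eq_same, zero_add, add_zero]

theorem dartSign_mul_self (d : Dart E) : dartSign d * dartSign d = 1 := by
  rcases dartSign_eq_or d with h | h <;> simp [h]

theorem isSegment_concat {L : List (Dart E)} {d : Dart E} (h : FreeGroup.IsReduced (L ++ [d]))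
    {c : ℝ} (h0 : 0 ≤ c) :
    IsSegment (L ++ [d]) (foxWord 1 L +
      Finsupp.single (foxIndex (FreeGroup.mk L) d) (c * dartSign d)) := by
  set f := foxWord 1 L + Finsupp.single (foxIndex (FreeGroup.mk L) d) (c * dartSign d) with hf
  have hlast : f (foxIndex (FreeGroup.mk L) d) = c * dartSign d := by
    have := foxWord_apply_foxIndex h
    rw [foxWord_append, foxWord, foxWord, one_mul, add_zero, Finsupp.add_apply,
      Finsupp.single_eq_same, add_eq_right] at this
    rw [hf, Finsupp.add_apply, this, Finsupp.single_eq_same, zero_add]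
  have key : ∀ L₀ d₀ L₁, L ++ [d] = L₀ ++ d₀ :: L₁ → (L₁ = [] ∧
      dartSign d₀ * f (foxIndex (FreeGroup.mk L₀) d₀) = c) ∨
      dartSign d₀ * f (foxIndex (FreeGroup.mk L₀) d₀) = 1 := by
    intro L₀ d₀ L₁ heq
    rcases L₁.eq_nil_or_concat with rfl | ⟨L₂, d₁, rfl⟩
    · obtain ⟨rfl, h2⟩ := List.append_inj' heq rfl
      obtain rfl : d = d₀ := by simpa using h2
      exact .inl ⟨rfl, by rw [hlast, mul_left_comm, dartSign_mul_self, mul_one]⟩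
    · right
      rw [List.concat_eq_append, ← List.cons_append, ← List.append_assoc] at heq
      obtain ⟨rfl, h2⟩ := List.append_inj' heq rfl
      obtain rfl : d = d₁ := by simpa using h2
      have hne : foxIndex (FreeGroup.mk (L₀ ++ d₀ :: L₂)) d ≠ foxIndex (FreeGroup.mk L₀) d₀ := by
        intro hi
        have h3 := (foxIndex_inj h (isReduced_prefix (L' := L₂ ++ [d]) (by simpa using h)) hi).1
        simpa using congrArg List.length h3
      rw [hf, Finsupp.add_apply, foxWord_apply_foxIndex (h.infix ⟨[], [d], by simp⟩),
        Finsupp.single_apply, if_neg hne, add_zero, dartSign_mul_self]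
  refine ⟨h, fun i hi => ?_, fun L₀ d₀ L₁ heq => ?_, fun L₀ d₀ L₁ heq hne => ?_⟩
  · by_cases hd : foxIndex (FreeGroup.mk L) d = i
    · exact ⟨L, d, [], rfl, hd⟩
    · rw [hf, Finsupp.add_apply, Finsupp.single_apply, if_neg hd, add_zero] at hi
      obtain ⟨M, d', M', h1, h2⟩ := foxWord_exists_of_ne hi
      rw [one_mul] at h2
      exact ⟨M, d', M' ++ [d], by simp [h1], h2⟩
  · rcases key L₀ d₀ L₁ heq with h | h <;> linarith
  · rcases key L₀ d₀ L₁ heq with h | h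
    · exact (hne h.1).elim
    · exact h

theorem isSegment_foxWord {W : List (Dart E)} (h : FreeGroup.IsReduced W) :
    IsSegment W (foxWord 1 W) := by
  rcases W.eq_nil_or_concat with rfl | ⟨L, d, rfl⟩
  · exact ⟨h, by simp [foxWord], by simp, by simp⟩
  · rw [List.concat_eq_append] at h ⊢
    have := isSegment_concat h zero_le_one
    rwa [one_mul, show foxWord 1 L + Finsupp.single (foxIndex (FreeGroup.mk L) d) (dartSign d) =
      foxWord 1 (L ++ [d]) by rw [foxWord_append, foxWord, foxWord, one_mul, add_zero]] at this

theorem fox_eq_foxWord (g : FreeGroup E) : fox g = foxWord 1 g.toWord := by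
  rw [← fox_mk, FreeGroup.mk_toWord]

/-- An edge at `g` either prolongs the geodesic from the base vertex to `g` or is its last edge,
read backwards. -/
theorem isReduced_concat_or (g : FreeGroup E) (d : Dart E) :
    FreeGroup.IsReduced (g.toWord ++ [d]) ∨
      ∃ L, g.toWord = L ++ [rev d] ∧ (g * letter d).toWord = L := by
  have hg : FreeGroup.IsReduced g.toWord := FreeGroup.isReduced_toWord
  rcases g.toWord.eq_nil_or_concat with h | ⟨L, d', h⟩
  · exact .inl (by simp [h])
  · rw [List.concat_eq_append] at h
    by_cases hd : d' = rev d
    · subst hd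
      refine .inr ⟨L, h, ?_⟩
      have : g * letter d = FreeGroup.mk L := by
        rw [← FreeGroup.mk_toWord (x := g), h, ← FreeGroup.mul_mk, mul_assoc,
          show FreeGroup.mk [rev d] = (letter d)⁻¹ from letter_rev d, inv_mul_cancel, mul_one]
      rw [this, FreeGroup.toWord_mk, FreeGroup.IsReduced.reduce_eq]
      rw [h] at hg
      exact hg.infix ⟨[], [rev d], by simp⟩
    · left
      rw [h] at hg ⊢
      refine FreeGroup.IsReduced.append_overlap hg (L₃ := [d]) ?_ (by simp)
      simp only [List.singleton_append, FreeGroup.isReduced_cons_cons, FreeGroup.IsReduced.singleton,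
        and_true, isReduced_pair_iff]
      rintro rfl
      exact hd (rev_rev d').symm

theorem exists_isSegment_dev (x : Γ.Cover) : ∃ W, IsSegment W (Γ.dev x) := by
  induction x using realization_ind with
  | hv x =>
    rw [dev_vertex, fox_eq_foxWord]
    exact ⟨_, isSegment_foxWord FreeGroup.isReduced_toWord⟩
  | he e t =>
    obtain ⟨e, g⟩ := e
    rw [dev_edge]
    have hs : dartSign (e, true) = 1 := rfl
    rcases isReduced_concat_or g (e, true) with h | ⟨L, h, h'⟩
    · have := isSegment_concat h t.2.1
      rw [FreeGroup.mk_toWord, ← fox_eq_foxWord, hs, mul_one] at this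
      exact ⟨_, this⟩
    · have hr : FreeGroup.IsReduced (L ++ [rev (e, true)]) := h ▸ FreeGroup.isReduced_toWord
      -- The edge points towards the base vertex here, so the part of it between the base vertex and
      -- the point at time `t` has proportion `1 - t`.
      have := isSegment_concat hr (c := 1 - t) (by linarith [t.2.2])
      rw [← h', ← fox_eq_foxWord, FreeGroup.mk_toWord, foxIndex_rev, dartSign_rev,
        fox_mul_letter, hs, add_assoc, ← Finsupp.single_add] at this
      refine ⟨(g * letter (e, true)).toWord ++ [rev (e, true)], ?_⟩
      convert! this using 3
      simp

theorem IsSegment.foxIndex_of_ne {W W' L L' : List (Dart E)} {d : Dart E}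
    {f f' : E × FreeGroup E →₀ ℝ} (h : IsSegment W f) (hW : W = L ++ d :: L')
    (h' : IsSegment W' f') (hi : f' (foxIndex (FreeGroup.mk L) d) ≠ 0) :
    ∃ L'', W' = L ++ d :: L'' := by
  obtain ⟨M, d', M', h1, h2⟩ := h'.exists_of_ne _ hi
  obtain ⟨rfl, rfl⟩ := foxIndex_inj (isReduced_prefix (h1 ▸ h'.reduced))
    (isReduced_prefix (hW ▸ h.reduced)) h2
  exact ⟨M', h1⟩

/-- All reduced paths from the base vertex that cross a given edge of the tree cross it away from
the base vertex, so their coordinates there agree in sign. -/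
theorem IsSegment.exists_sign {W₁ W₂ W₃ : List (Dart E)} {f₁ f₂ f₃ : E × FreeGroup E →₀ ℝ}
    (h₁ : IsSegment W₁ f₁) (h₂ : IsSegment W₂ f₂) (h₃ : IsSegment W₃ f₃) (i : E × FreeGroup E) :
    ∃ s : ℝ, (s = 1 ∨ s = -1) ∧ 0 ≤ s * f₁ i ∧ 0 ≤ s * f₂ i ∧ 0 ≤ s * f₃ i := by
  have key : ∀ {W W' : List (Dart E)} {f f' : E × FreeGroup E →₀ ℝ}, IsSegment W f →
      IsSegment W' f' → ∀ L d L', W = L ++ d :: L' → 0 ≤ dartSign d *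
        f' (foxIndex (FreeGroup.mk L) d) := by
    intro W W' f f' h h' L d L' hW
    by_cases hi : f' (foxIndex (FreeGroup.mk L) d) = 0
    · simp [hi]
    · obtain ⟨L'', h''⟩ := h.foxIndex_of_ne hW h' hi
      exact h'.nonneg _ _ _ h''
  by_cases hi₁ : f₁ i = 0
  · by_cases hi₂ : f₂ i = 0
    · by_cases hi₃ : f₃ i = 0
      · exact ⟨1, by simp [hi₁, hi₂, hi₃]⟩
      · obtain ⟨L, d, L', hW, rfl⟩ := h₃.exists_of_ne i hi₃
        exact ⟨dartSign d, dartSign_eq_or d, key h₃ h₁ _ _ _ hW, key h₃ h₂ _ _ _ hW,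
          key h₃ h₃ _ _ _ hW⟩
    · obtain ⟨L, d, L', hW, rfl⟩ := h₂.exists_of_ne i hi₂
      exact ⟨dartSign d, dartSign_eq_or d, key h₂ h₁ _ _ _ hW, key h₂ h₂ _ _ _ hW,
        key h₂ h₃ _ _ _ hW⟩
  · obtain ⟨L, d, L', hW, rfl⟩ := h₁.exists_of_ne i hi₁
    exact ⟨dartSign d, dartSign_eq_or d, key h₁ h₁ _ _ _ hW, key h₁ h₂ _ _ _ hW,
      key h₁ h₃ _ _ _ hW⟩

theorem IsSegment.abs_eq_one {W L L' : List (Dart E)} {d : Dart E} {f : E × FreeGroup E →₀ ℝ}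
    (h : IsSegment W f) (hW : W = L ++ d :: L') (hne : L' ≠ []) :
    |f (foxIndex (FreeGroup.mk L) d)| = 1 := by
  have h1 := h.eq_one _ _ _ hW hne
  rcases dartSign_eq_or d with hd | hd <;> rw [hd] at h1
  · rw [one_mul] at h1
    rw [h1, abs_one]
  · rw [neg_one_mul] at h1
    rw [← abs_neg, h1, abs_one]

theorem exists_eq_append_of_length_lt {α : Type*} {L M L' M' : List α} {a b : α}
    (h : L ++ a :: L' = M ++ b :: M') (hlt : L.length < M.length) : ∃ K, M = L ++ a :: K := by
  rcases List.append_eq_append_iff.1 h with ⟨K, h1, h2⟩ | ⟨K, h1, h2⟩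
  · rcases K with _ | ⟨c, K⟩
    · simp [h1] at hlt
    · obtain ⟨rfl, -⟩ : a = c ∧ _ := by simpa using h2
      exact ⟨K, h1⟩
  · simp [h1] at hlt

/-- The overlaps of the second segment with the first and with the third are both initial pieces of
the second segment, so one contains the other. This is where the tree structure enters the four
point condition. -/
theorem IsSegment.comparable {W₁ W₂ W₃ : List (Dart E)} {f₁ f₂ f₃ : E × FreeGroup E →₀ ℝ}
    (h₁ : IsSegment W₁ f₁) (h₂ : IsSegment W₂ f₂) (h₃ : IsSegment W₃ f₃) :
    (∀ i, min |f₁ i| |f₂ i| ≤ min |f₂ i| |f₃ i|) ∨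
      ∀ i, min |f₂ i| |f₃ i| ≤ min |f₁ i| |f₂ i| := by
  have key : ∀ {W W' L M L' M' : List (Dart E)} {d d' : Dart E} {f f' : E × FreeGroup E →₀ ℝ},
      IsSegment W f → IsSegment W' f' → W = L ++ d :: L' → W = M ++ d' :: M' →
      f' (foxIndex (FreeGroup.mk M) d') ≠ 0 → L.length < M.length →
      |f (foxIndex (FreeGroup.mk L) d)| = 1 ∧ |f' (foxIndex (FreeGroup.mk L) d)| = 1 := by
    intro W W' L M L' M' d d' f f' h h' hL hM hne hlt
    obtain ⟨K, rfl⟩ := exists_eq_append_of_length_lt (hL.symm.trans hM) hlt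
    obtain ⟨K', hK'⟩ := h.foxIndex_of_ne hM h' hne
    exact ⟨h.abs_eq_one (L' := K ++ d' :: M') (by simp [hM]) (by simp),
      h'.abs_eq_one (L' := K ++ d' :: K') (by simp [hK']) (by simp)⟩
  by_contra! hcon
  obtain ⟨⟨i, hi⟩, ⟨j, hj⟩⟩ := hcon
  have pos : ∀ {a b : ℝ} {x y : ℝ}, min |x| |y| < min a b → a ≠ 0 ∧ b ≠ 0 := by
    intro a b x y h
    have := (le_min (abs_nonneg x) (abs_nonneg y)).trans_lt h
    exact ⟨(this.trans_le (min_le_left _ _)).ne', (this.trans_le (min_le_right _ _)).ne'⟩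
  obtain ⟨hi1, hi2⟩ := pos hi
  obtain ⟨hj2, hj3⟩ := pos hj
  rw [abs_ne_zero] at hi1 hi2 hj2 hj3
  obtain ⟨L, d, L', hL, rfl⟩ := h₂.exists_of_ne i hi2
  obtain ⟨M, d', M', hM, rfl⟩ := h₂.exists_of_ne j hj2
  rcases lt_trichotomy L.length M.length with hlt | heq | hlt
  · obtain ⟨k1, k2⟩ := key h₂ h₃ hL hM hj3 hlt
    rw [k1, k2, min_self] at hi
    exact absurd (hi.trans_le (min_le_right _ _)) (lt_irrefl _)
  · obtain ⟨rfl, h2⟩ := List.append_inj (hL.symm.trans hM) heq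
    obtain ⟨rfl, -⟩ : d = d' ∧ _ := by simpa using h2
    exact lt_asymm hi hj
  · obtain ⟨k1, k2⟩ := key h₂ h₁ hM hL hi1 hlt
    rw [k1, k2, min_self] at hj
    exact absurd (hj.trans_le (min_le_left _ _)) (lt_irrefl _)

end Multigraph

namespace Multigraph

variable {V : Type u} {E : Type v} (Γ : Multigraph V E)

/-! ### Edge paths -/

/-- The word `L` is an edge path from `x` to `y`. -/
def IsWalk : V → List (Dart E) → V → Prop
  | x, [], y => x = y
  | x, d :: L, y => Γ.init d = x ∧ IsWalk (Γ.term d) L y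

variable {Γ}

theorem isWalk_append {x y : V} {L L' : List (Dart E)} :
    Γ.IsWalk x (L ++ L') y ↔ ∃ z, Γ.IsWalk x L z ∧ Γ.IsWalk z L' y := by
  induction L generalizing x with
  | nil => simp [IsWalk]
  | cons d L ih => simp [IsWalk, ih, and_assoc]

theorem IsWalk.of_red {x y : V} {L L' : List (Dart E)} (h : Γ.IsWalk x L y)
    (hr : FreeGroup.Red L L') : Γ.IsWalk x L' y := by
  induction hr with
  | refl => exact h
  | tail _ hs ih =>
    obtain ⟨⟩ := hs
    rename_i L₁ L₂ e b _
    obtain ⟨z, h1, h2⟩ := isWalk_append.1 ih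
    refine isWalk_append.2 ⟨z, h1, ?_⟩
    obtain ⟨h3, h4, h5⟩ := h2
    rw [← h3]
    rwa [show ((e, !b) : Dart E) = rev (e, b) from rfl, term_rev] at h5

theorem NoIsolated.cover (h : Γ.NoIsolated) : Γ.cover.NoIsolated := by
  intro x
  obtain ⟨⟨e, _ | _⟩, hd⟩ := h x.1
  · exact ⟨((e, x.2 * (FreeGroup.of e)⁻¹), false), Prod.ext hd (by simp [init, cover_tgt])⟩
  · exact ⟨((e, x.2), true), Prod.ext hd rfl⟩

instance : PathConnectedSpace unitInterval :=
  isPathConnected_iff_pathConnectedSpace.1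
    ((convex_Icc (0 : ℝ) 1).isPathConnected ⟨0, unitInterval.zero_mem⟩)

theorem joined_edge (e : E) (s t : unitInterval) : Joined (Γ.edge e s) (Γ.edge e t) :=
  (PathConnectedSpace.joined s t).map (Γ.continuous_edge e)

variable [DecidableEq E]

theorem IsWalk.toWord_mk {x y : V} {L : List (Dart E)} (h : Γ.IsWalk x L y) :
    Γ.IsWalk x (FreeGroup.mk L).toWord y := by
  rw [FreeGroup.toWord_mk]
  exact h.of_red FreeGroup.reduce.red

theorem IsWalk.toWord_mul_letter {x : V} {g : FreeGroup E} {d : Dart E}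
    (h : Γ.IsWalk x g.toWord (Γ.init d)) : Γ.IsWalk x (g * letter d).toWord (Γ.term d) := by
  have : Γ.IsWalk x (g.toWord ++ [d]) (Γ.term d) := isWalk_append.2 ⟨_, h, rfl, rfl⟩
  have := this.toWord_mk
  rwa [← FreeGroup.mul_mk, FreeGroup.mk_toWord] at this

theorem isWalk_toWord_mul_letter {x : V} {g : FreeGroup E} {d : Dart E} :
    Γ.IsWalk x (g * letter d).toWord (Γ.term d) ↔ Γ.IsWalk x g.toWord (Γ.init d) := by
  refine ⟨fun h => ?_, IsWalk.toWord_mul_letter⟩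
  have := IsWalk.toWord_mul_letter (d := rev d) h
  rwa [letter_rev, mul_inv_cancel_right, term_rev] at this

/-- The property is constant along every edge, so it defines a clopen set, which contains the whole
component of `x`. In particular a component has at most one vertex in each sheet, although
`treeDist` only sees sheets. -/
theorem isWalk_of_joined {x : V × FreeGroup E} {z : Γ.Cover} (h : Joined (Γ.cover.vertex x) z) :
    lift (Γ := Γ.cover) (fun y => Γ.IsWalk x.1 (x.2⁻¹ * y.2).toWord y.1)
      (fun e _ => Γ.IsWalk x.1 (x.2⁻¹ * e.2).toWord (Γ.src e.1)) (fun _ => rfl) (fun e => by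
        rw [cover_tgt, ← letter_true, ← mul_assoc]
        exact propext (isWalk_toWord_mul_letter (d := (e.1, true)))) z := by
  set S : Set Γ.Cover := {z | lift (Γ := Γ.cover)
      (fun y => Γ.IsWalk x.1 (x.2⁻¹ * y.2).toWord y.1)
      (fun e _ => Γ.IsWalk x.1 (x.2⁻¹ * e.2).toWord (Γ.src e.1)) (fun _ => rfl) (fun e => by
        rw [cover_tgt, ← letter_true, ← mul_assoc]
        exact propext (isWalk_toWord_mul_letter (d := (e.1, true)))) z} with hS
  have hpre : ∀ e, Γ.cover.edge e ⁻¹' S =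
      {_t | Γ.IsWalk x.1 (x.2⁻¹ * e.2).toWord (Γ.src e.1)} := fun e => rfl
  have hclopen : IsClopen S := by
    refine ⟨⟨Γ.cover.isOpen_iff.2 fun e => ?_⟩, Γ.cover.isOpen_iff.2 fun e => ?_⟩
    · rw [Set.preimage_compl, hpre]
      exact (isClosed_const (p := Γ.IsWalk x.1 (x.2⁻¹ * e.2).toWord (Γ.src e.1))).isOpen_compl
    · rw [hpre]
      exact isOpen_const
  have hx : Γ.cover.vertex x ∈ S := by
    change Γ.IsWalk x.1 (x.2⁻¹ * x.2).toWord x.1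
    rw [inv_mul_cancel, FreeGroup.toWord_one]
    rfl
  exact hclopen.connectedComponent_subset hx (pathComponent_subset_component _ h)

theorem isWalk_of_joined_vertex {x y : V × FreeGroup E}
    (h : Joined (Γ.cover.vertex x) (Γ.cover.vertex y)) :
    Γ.IsWalk x.1 (x.2⁻¹ * y.2).toWord y.1 :=
  isWalk_of_joined h

theorem isWalk_of_joined_edge {x : V × FreeGroup E} {e : E × FreeGroup E} {t : unitInterval}
    (h : Joined (Γ.cover.vertex x) (Γ.cover.edge e t)) :
    Γ.IsWalk x.1 (x.2⁻¹ * e.2).toWord (Γ.src e.1) :=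
  isWalk_of_joined h

end Multigraph

/-- A symmetric function satisfying the triangle inequality and the four point condition. -/
structure IsTreeDist {X : Type*} (d : X → X → ℝ) : Prop where
  self : ∀ x, d x x = 0
  comm : ∀ x y, d x y = d y x
  triangle : ∀ x y z, d x z ≤ d x y + d y z
  four_point : ∀ x y z w, d x y + d z w ≤ max (d x z + d y w) (d x w + d y z)

namespace MetricGraph

open Multigraph

variable {V : Type u} {E : Type v} [Fintype E] (G : MetricGraph V E)

/-! ### The tree distance on the covering forest -/

/-- The `ℓ¹` norm on functions on the edges of the Cayley tree, weighted by edge lengths. -/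
def weightedNorm (f : E × FreeGroup E →₀ ℝ) : ℝ := f.sum fun i c => G.len i.1 * |c|

theorem weightedNorm_eq_sum {f : E × FreeGroup E →₀ ℝ} {s : Finset (E × FreeGroup E)}
    (hs : f.support ⊆ s) : G.weightedNorm f = ∑ i ∈ s, G.len i.1 * |f i| :=
  Finsupp.sum_of_support_subset _ hs _ (by simp)

theorem weightedNorm_nonneg (f : E × FreeGroup E →₀ ℝ) : 0 ≤ G.weightedNorm f :=
  Finset.sum_nonneg fun i _ => mul_nonneg (G.len_pos i.1).le (abs_nonneg _)

theorem weightedNorm_zero : G.weightedNorm 0 = 0 := by simp [weightedNorm]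

theorem weightedNorm_neg (f : E × FreeGroup E →₀ ℝ) : G.weightedNorm (-f) = G.weightedNorm f := by
  simp [weightedNorm, Finsupp.sum_neg_index]

theorem weightedNorm_add_le (f f' : E × FreeGroup E →₀ ℝ) :
    G.weightedNorm (f + f') ≤ G.weightedNorm f + G.weightedNorm f' := by
  classical
  rw [G.weightedNorm_eq_sum Finsupp.support_add,
    G.weightedNorm_eq_sum (Finset.subset_union_left (s₂ := f'.support)),
    G.weightedNorm_eq_sum (Finset.subset_union_right (s₁ := f.support)), ← Finset.sum_add_distrib]
  refine Finset.sum_le_sum fun i _ => ?_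
  rw [← mul_add]
  exact mul_le_mul_of_nonneg_left (abs_add_le _ _) (G.len_pos i.1).le

theorem weightedNorm_single (i : E × FreeGroup E) (c : ℝ) :
    G.weightedNorm (Finsupp.single i c) = G.len i.1 * |c| := by
  rw [weightedNorm, Finsupp.sum_single_index (by simp)]

theorem le_weightedNorm (f : E × FreeGroup E →₀ ℝ) (i : E × FreeGroup E) :
    G.len i.1 * |f i| ≤ G.weightedNorm f := by
  classical
  rw [G.weightedNorm_eq_sum (Finset.subset_insert i f.support)]
  exact Finset.single_le_sum (f := fun i => G.len i.1 * |f i|)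
    (fun i _ => mul_nonneg (G.len_pos i.1).le (abs_nonneg _)) (Finset.mem_insert_self _ _)

theorem weightedNorm_shift (k : FreeGroup E) (f : E × FreeGroup E →₀ ℝ) :
    G.weightedNorm (shift k f) = G.weightedNorm f := by
  refine Finsupp.sum_mapDomain_index_inj
    (h := fun (i : E × FreeGroup E) c => G.len i.1 * |c|) fun i j h => ?_
  simpa [Prod.ext_iff] using h

/-- The distance of two points of the covering forest, measured in the Cayley tree. -/
def treeDist (x y : G.Cover) : ℝ := G.weightedNorm (G.dev x - G.dev y)

theorem treeDist_smul (g : FreeGroup E) (x y : G.Cover) :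
    G.treeDist (g • x) (g • y) = G.treeDist x y := by
  rw [treeDist, dev_smul, dev_smul, add_sub_add_left_eq_sub, ← map_sub, weightedNorm_shift]
  rfl

theorem treeDist_edge (e : E × FreeGroup E) (s t : unitInterval) :
    G.treeDist (G.cover.edge e s) (G.cover.edge e t) = G.len e.1 * |(s : ℝ) - t| := by
  rw [treeDist, dev_edge, dev_edge, add_sub_add_left_eq_sub, ← Finsupp.single_sub,
    weightedNorm_single]

/-- For numbers of equal sign, `|x| + |y| - |x - y|` is twice the smaller absolute value. This is
the Gromov product in one coordinate. -/
theorem isSegment_min_le {x y z s : ℝ} (hs : s = 1 ∨ s = -1) (hx : 0 ≤ s * x) (hy : 0 ≤ s * y)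
    (hz : 0 ≤ s * z) (h : min |x| |y| ≤ min |y| |z|) : |x| + |y| - |x - y| ≤ |x| + |z| - |x - z| := by
  have key : ∀ {x y z : ℝ}, 0 ≤ x → 0 ≤ y → 0 ≤ z → min |x| |y| ≤ min |y| |z| →
      |x| + |y| - |x - y| ≤ |x| + |z| - |x - z| := by
    intro x y z hx hy hz h
    rw [abs_of_nonneg hx, abs_of_nonneg hy, abs_of_nonneg hz] at *
    rcases le_total x y with h1 | h1 <;> rcases le_total x z with h2 | h2 <;>
      rcases le_total y z with h3 | h3 <;> simp only [min_def] at h <;> split_ifs at h <;>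
      simp only [abs_of_nonneg, abs_of_nonpos, sub_nonneg, sub_nonpos, h1, h2] <;>
      linarith
  rcases hs with rfl | rfl
  · simp only [one_mul] at hx hy hz
    exact key hx hy hz h
  · simp only [neg_one_mul] at hx hy hz
    have := key hx hy hz (by simpa using h)
    simpa [abs_sub_comm, ← sub_eq_neg_add] using this

/-- The function `r` plays the role of the distance to a base point that need not belong to `X`; the
four point condition is then Gromov's inequality for products based there. -/
theorem isTreeDist_of_gromov {X : Type*} {d : X → X → ℝ} (self : ∀ x, d x x = 0)
    (comm : ∀ x y, d x y = d y x) (triangle : ∀ x y z, d x z ≤ d x y + d y z) (r : X → ℝ)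
    (h : ∀ x y z, min (r x + r y - d x y) (r y + r z - d y z) ≤ r x + r z - d x z) :
    IsTreeDist d := by
  refine ⟨self, comm, triangle, fun x y z w => ?_⟩
  have h1 := h x z y
  have h2 := h x w y
  have h3 := h z x w
  have h4 := h z y w
  simp only [comm z x, comm z y, comm w y] at h1 h2 h3 h4
  rw [le_max_iff]
  rw [min_le_iff] at h1 h2 h3 h4
  by_contra! hcon
  obtain ⟨c1, c2⟩ := hcon
  rcases h1 with h1 | h1 <;> rcases h2 with h2 | h2 <;> rcases h3 with h3 | h3 <;>
    rcases h4 with h4 | h4 <;> linarith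

theorem isTreeDist : IsTreeDist G.treeDist := by
  classical
  refine isTreeDist_of_gromov (fun x => ?_) (fun x y => ?_) (fun x y z => ?_)
    (fun x => G.weightedNorm (G.dev x)) fun x y z => ?_
  · rw [treeDist, sub_self, weightedNorm_zero]
  · rw [treeDist, treeDist, ← weightedNorm_neg, neg_sub]
  · rw [treeDist, treeDist, treeDist, ← sub_add_sub_cancel (G.dev x) (G.dev y) (G.dev z)]
    exact G.weightedNorm_add_le _ _
  -- The overlap hypothesis holds in all coordinates at once, so the inequality for single
  -- coordinates can be summed with weights.
  · have key : ∀ {x y z : G.Cover}, (∀ i, min |G.dev x i| |G.dev y i| ≤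
        min |G.dev y i| |G.dev z i|) → G.weightedNorm (G.dev x) + G.weightedNorm (G.dev y) -
        G.treeDist x y ≤ G.weightedNorm (G.dev x) + G.weightedNorm (G.dev z) - G.treeDist x z := by
      intro x y z h
      obtain ⟨W₁, h₁⟩ := exists_isSegment_dev G.toMultigraph x
      obtain ⟨W₂, h₂⟩ := exists_isSegment_dev G.toMultigraph y
      obtain ⟨W₃, h₃⟩ := exists_isSegment_dev G.toMultigraph z
      set s := (G.dev x).support ∪ ((G.dev y).support ∪ (G.dev z).support) with hs
      have hx : (G.dev x).support ⊆ s := Finset.subset_union_left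
      have hy : (G.dev y).support ⊆ s :=
        Finset.subset_union_left.trans Finset.subset_union_right
      have hz : (G.dev z).support ⊆ s :=
        Finset.subset_union_right.trans Finset.subset_union_right
      have hxy := Finsupp.support_sub.trans (Finset.union_subset hx hy)
      have hxz := Finsupp.support_sub.trans (Finset.union_subset hx hz)
      rw [treeDist, treeDist, G.weightedNorm_eq_sum hx, G.weightedNorm_eq_sum hy,
        G.weightedNorm_eq_sum hz, G.weightedNorm_eq_sum hxy, G.weightedNorm_eq_sum hxz,
        ← Finset.sum_add_distrib, ← Finset.sum_add_distrib, ← Finset.sum_sub_distrib,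
        ← Finset.sum_sub_distrib]
      refine Finset.sum_le_sum fun i _ => ?_
      rw [← mul_add, ← mul_add, ← mul_sub, ← mul_sub]
      obtain ⟨s, hs, s1, s2, s3⟩ := h₁.exists_sign h₂ h₃ i
      exact mul_le_mul_of_nonneg_left (isSegment_min_le hs s1 s2 s3 (h i)) (G.len_pos i.1).le
    obtain ⟨W₁, h₁⟩ := exists_isSegment_dev G.toMultigraph x
    obtain ⟨W₂, h₂⟩ := exists_isSegment_dev G.toMultigraph y
    obtain ⟨W₃, h₃⟩ := exists_isSegment_dev G.toMultigraph z
    have comm : ∀ x y : G.Cover, G.treeDist x y = G.treeDist y x := fun x y => by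
      rw [treeDist, treeDist, ← weightedNorm_neg, neg_sub]
    rcases h₁.comparable h₂ h₃ with h | h
    · exact (min_le_left _ _).trans (key h)
    · refine (min_le_right _ _).trans ?_
      have := key (x := z) (y := y) (z := x) (fun i => by
        rw [min_comm |G.dev z i|, min_comm |G.dev y i| |G.dev x i|]
        exact h i)
      rw [comm y z, comm x z]
      linarith

theorem exists_len_lower_bound : ∃ m > 0, ∀ e, m ≤ G.len e := by
  obtain ⟨m, hm⟩ := Finite.exists_le (fun e => (G.len e)⁻¹)
  refine ⟨(max m 1)⁻¹, by positivity, fun e => ?_⟩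
  rw [inv_le_comm₀ (by positivity) (G.len_pos e)]
  exact (hm e).trans (le_max_left _ _)

theorem fox_eq_zero {g : FreeGroup E} (h : fox g = 0) : g = 1 := by
  classical
  rw [← FreeGroup.toWord_eq_nil_iff]
  by_contra hne
  obtain ⟨d, L, hL⟩ := List.exists_cons_of_ne_nil hne
  have hred : FreeGroup.IsReduced ([] ++ d :: L) := hL ▸ FreeGroup.isReduced_toWord
  have := foxWord_apply_foxIndex hred
  rw [List.nil_append, ← hL, ← fox_eq_foxWord, h] at this
  exact dartSign_ne_zero d this.symm

theorem exists_nhds_zero {X : Type*} [TopologicalSpace X] {f : unitInterval → X}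
    (hf : Continuous f) {U : Set X} (hU : U ∈ 𝓝 (f 0)) :
    ∃ η > 0, ∀ t : unitInterval, (t : ℝ) < η → f t ∈ U := by
  obtain ⟨η, h0, h⟩ := Metric.mem_nhds_iff.1 (hf.continuousAt.preimage_mem_nhds hU)
  refine ⟨η, h0, fun t ht => h ?_⟩
  rw [Metric.mem_ball, Subtype.dist_eq, Real.dist_eq]
  simpa [abs_of_nonneg t.2.1] using ht

/-- The finitely many edges at `v` allow one radius for all of them. A point within it has all
coordinates small; by integrality it lies on an edge that starts or ends in sheet `1`, and being in
the component of `v`, on an edge at `v` itself. -/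
theorem exists_nhds_vertex_one (hG : G.NoIsolated) (v : V) {U : Set G.Cover}
    (hU : U ∈ 𝓝 (G.cover.vertex (v, 1))) : ∃ r > 0, ∀ y, Joined (G.cover.vertex (v, 1)) y →
      G.treeDist (G.cover.vertex (v, 1)) y < r → y ∈ U := by
  classical
  have hsrc : ∀ e, ∃ η > 0, G.src e = v → ∀ t : unitInterval, (t : ℝ) < η →
      G.cover.edge (e, 1) t ∈ U := by
    intro e
    by_cases he : G.src e = v
    · obtain ⟨η, h0, h⟩ := exists_nhds_zero (G.cover.continuous_edge (e, 1)) (U := U)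
        (by rw [edge_zero, cover_src, he]; exact hU)
      exact ⟨η, h0, fun _ => h⟩
    · exact ⟨1, one_pos, fun h => (he h).elim⟩
  have htgt : ∀ e, ∃ η > 0, G.tgt e = v → ∀ t : unitInterval, 1 - (t : ℝ) < η →
      G.cover.edge (e, (FreeGroup.of e)⁻¹) t ∈ U := by
    intro e
    by_cases he : G.tgt e = v
    · obtain ⟨η, h0, h⟩ := exists_nhds_zero ((G.cover.continuous_edge
        (e, (FreeGroup.of e)⁻¹)).comp unitInterval.continuous_symm) (U := U)
        (by simpa [edge_one, cover_tgt, he] using hU)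
      refine ⟨η, h0, fun _ t ht => ?_⟩
      have := h (unitInterval.symm t) (by simpa using ht)
      simpa using this
    · exact ⟨1, one_pos, fun h => (he h).elim⟩
  choose η₀ hη₀ h₀ using hsrc
  choose η₁ hη₁ h₁ using htgt
  obtain ⟨m, hm, hlen⟩ := G.exists_len_lower_bound
  obtain ⟨B, hB⟩ := Finite.exists_le (fun e => max (η₀ e)⁻¹ (η₁ e)⁻¹)
  set η := (max B 2)⁻¹ with hη
  have hηpos : 0 < η := by positivity
  have hη2 : η ≤ 1 / 2 := by
    rw [hη, inv_le_comm₀ (by positivity) (by norm_num)]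
    norm_num
  have hη₀' : ∀ e, η ≤ η₀ e := fun e => by
    rw [hη, inv_le_comm₀ (by positivity) (hη₀ e)]
    exact (le_max_left _ _).trans ((hB e).trans (le_max_left _ _))
  have hη₁' : ∀ e, η ≤ η₁ e := fun e => by
    rw [hη, inv_le_comm₀ (by positivity) (hη₁ e)]
    exact (le_max_right _ _).trans ((hB e).trans (le_max_left _ _))
  refine ⟨m * η, by positivity, fun y hy hd => ?_⟩
  obtain ⟨⟨e, g⟩, t, rfl⟩ := hG.cover.exists_edge_eq y
  have hcoord : ∀ i : E × FreeGroup E, |G.dev (G.cover.edge (e, g) t) i| < η := by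
    intro i
    have h1 := G.le_weightedNorm (G.dev (G.cover.vertex (v, 1)) - G.dev (G.cover.edge (e, g) t)) i
    rw [dev_vertex, fox_one, zero_sub, Finsupp.neg_apply, abs_neg] at h1
    rw [treeDist, dev_vertex, fox_one, zero_sub] at hd
    have h2 : m * |G.dev (G.cover.edge (e, g) t) i| < m * η :=
      (mul_le_mul_of_nonneg_right (hlen i.1) (abs_nonneg _)).trans_lt (h1.trans_lt hd)
    exact lt_of_mul_lt_mul_left h2 hm.le
  simp only [dev_edge, Finsupp.add_apply] at hcoord
  have hoff : ∀ i, i ≠ (e, g) → fox g i = 0 := by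
    intro i hi
    obtain ⟨n, hn⟩ := fox_int g i
    have := hcoord i
    rw [Finsupp.single_apply, if_neg hi.symm, add_zero, hn, ← Int.cast_abs] at this
    have h1 : |n| < 1 := by
      have : ((|n| : ℤ) : ℝ) < 1 := by linarith
      exact_mod_cast this
    rw [hn, Int.abs_lt_one_iff.1 h1, Int.cast_zero]
  obtain ⟨n, hn⟩ := fox_int g (e, g)
  have hlast := hcoord (e, g)
  rw [Finsupp.single_eq_same, hn, abs_lt] at hlast
  -- The coordinate `n + t` is less than `1/2` in absolute value: `n = 0` means that the edge starts
  -- in sheet `1`, and `n = -1` that it ends there.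
  have hn' : n = 0 ∨ n = -1 := by
    have h1 : ((-2 : ℤ) : ℝ) < n := by push_cast; linarith [t.2.2]
    have h2 : (n : ℝ) < ((1 : ℤ) : ℝ) := by push_cast; linarith [t.2.1]
    have h1 := Int.cast_lt.1 h1
    have h2 := Int.cast_lt.1 h2
    omega
  rcases hn' with rfl | rfl
  · have hg : g = 1 := fox_eq_zero (by
      ext i
      by_cases hi : i = (e, g)
      · rw [hi, hn, Int.cast_zero, Finsupp.zero_apply]
      · exact hoff i hi)
    subst hg
    -- The distance has only determined the sheet; joinedness determines the vertex in it, by the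
    -- empty walk.
    have hw : v = G.src e := by
      have := isWalk_of_joined_edge hy
      simpa [IsWalk] using this
    exact h₀ e hw.symm t (by push_cast at hlast; linarith [hη₀' e])
  · have hg : g * letter (e, true) = 1 := fox_eq_zero (by
      rw [fox_mul_letter]
      ext i
      by_cases hi : i = (e, g)
      · rw [hi, Finsupp.add_apply, hn]
        simp [foxIndex, dartSign]
      · have hne : foxIndex g (e, true) ≠ i := fun h => hi h.symm
        rw [Finsupp.add_apply, hoff i hi, Finsupp.single_apply, if_neg hne, add_zero,
          Finsupp.zero_apply])
    have hy' := hy.trans (joined_edge (e, g) t 1)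
    rw [edge_one, cover_tgt, ← letter_true, hg] at hy'
    have hw : v = G.tgt e := by
      have := isWalk_of_joined_vertex hy'
      simpa [IsWalk] using this
    obtain rfl : g = (FreeGroup.of e)⁻¹ := eq_inv_of_mul_eq_one_left hg
    exact h₁ e hw.symm t (by push_cast at hlast; linarith [hη₁' e])

/-- The topology of a component of the covering forest is not finer than that of the tree
distance. -/
theorem exists_forall_mem_of_treeDist_lt (hG : G.NoIsolated) (x : G.Cover) {U : Set G.Cover}
    (hU : U ∈ 𝓝 x) : ∃ r > 0, ∀ y, Joined x y → G.treeDist x y < r → y ∈ U := by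
  have key : ∀ v : V × FreeGroup E, U ∈ 𝓝 (G.cover.vertex v) →
      ∃ r > 0, ∀ y, Joined (G.cover.vertex v) y → G.treeDist (G.cover.vertex v) y < r → y ∈ U := by
    rintro ⟨v, h⟩ hU
    have hv : h • G.cover.vertex (v, 1) = G.cover.vertex (v, h) := by simp
    obtain ⟨r, hr, H⟩ := G.exists_nhds_vertex_one hG v (U := (h • ·) ⁻¹' U)
      ((continuous_const_smul h).continuousAt.preimage_mem_nhds (by rwa [hv]))
    refine ⟨r, hr, fun y hy hd => ?_⟩
    have := H (h⁻¹ • y) (by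
      have := hy.map (continuous_const_smul h⁻¹)
      rwa [← hv, inv_smul_smul] at this) (by
      rwa [← G.treeDist_smul h, hv, smul_inv_smul])
    simpa using this
  induction x using realization_ind with
  | hv v => exact key v hU
  | he e t =>
    rcases eq_or_ne t 0 with rfl | h0
    · rw [edge_zero] at hU ⊢
      exact key _ hU
    rcases eq_or_ne t 1 with rfl | h1
    · rw [edge_one] at hU ⊢
      exact key _ hU
    have ht0 : (0 : ℝ) < t := unitInterval.pos_iff_ne_zero.2 h0
    have ht1 : (t : ℝ) < 1 := unitInterval.lt_one_iff_ne_one.2 h1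
    obtain ⟨η, hη, H⟩ := Metric.mem_nhds_iff.1
      ((G.cover.continuous_edge e).continuousAt.preimage_mem_nhds hU)
    have hm : 0 < min (min (t : ℝ) (1 - t)) η := lt_min (lt_min ht0 (by linarith)) hη
    -- On any other edge the coordinate at `e` is an integer, so it differs from that of the given
    -- point by at least the distance of `t` to the nearest integer.
    have hint : ∀ n : ℤ, min (t : ℝ) (1 - t) ≤ |(t : ℝ) + n| := by
      intro n
      rcases le_or_gt 0 n with hn | hn
      · have : (0 : ℝ) ≤ n := by exact_mod_cast hn
        exact (min_le_left _ _).trans ((by linarith : (t : ℝ) ≤ t + n).trans (le_abs_self _))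
      · have : (n : ℝ) ≤ -1 := by exact_mod_cast Int.le_sub_one_of_lt hn
        exact (min_le_right _ _).trans
          ((by linarith : (1 - t : ℝ) ≤ -(t + n)).trans (neg_le_abs _))
    refine ⟨G.len e.1 * min (min (t : ℝ) (1 - t)) η, mul_pos (G.len_pos _) hm, fun y _ hd => ?_⟩
    obtain ⟨e', t', rfl⟩ := hG.cover.exists_edge_eq y
    by_cases hne : e' = e
    · subst hne
      rw [treeDist_edge] at hd
      refine H ?_
      rw [Metric.mem_ball, dist_comm, Subtype.dist_eq, Real.dist_eq]
      exact (lt_of_mul_lt_mul_left hd (G.len_pos _).le).trans_le (min_le_right _ _)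
    · refine absurd (hd.trans_le ?_) (lt_irrefl _)
      refine le_trans ?_ (G.le_weightedNorm _ e)
      refine mul_le_mul_of_nonneg_left ((min_le_left _ _).trans ?_) (G.len_pos _).le
      classical
      obtain ⟨n, hn⟩ := fox_int e.2 e
      obtain ⟨k, hk⟩ := fox_int e'.2 e
      rw [dev_edge, dev_edge, Finsupp.sub_apply, Finsupp.add_apply, Finsupp.add_apply,
        Finsupp.single_eq_same, Finsupp.single_apply, if_neg hne, add_zero, hn, hk]
      refine (hint (n - k)).trans_eq (congrArg _ ?_)
      push_cast
      ring

/-! ### Continuity of the tree distance -/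

theorem treeDist_nonneg (x y : G.Cover) : 0 ≤ G.treeDist x y := G.weightedNorm_nonneg _

theorem abs_treeDist_sub_le (x x' y y' : G.Cover) :
    |G.treeDist x y - G.treeDist x' y'| ≤ G.treeDist x x' + G.treeDist y y' := by
  have h := G.isTreeDist
  have h1 := h.triangle x x' y
  have h2 := h.triangle x' y' y
  have h3 := h.triangle x' x y'
  have h4 := h.triangle x y y'
  rw [h.comm y' y] at h2
  rw [h.comm x' x] at h3
  rw [abs_le]
  constructor <;> linarith

/-- Working edge by edge gives continuity in one variable only, as a product of realizations need
not carry the product cell structure; the triangle inequality upgrades it to joint continuity. -/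
theorem continuous_treeDist : Continuous fun p : G.Cover × G.Cover => G.treeDist p.1 p.2 := by
  have h1 : ∀ x, Continuous (G.treeDist x) := fun x => by
    refine continuous_iff.2 fun e => ?_
    refine (LipschitzWith.of_dist_le_mul (K := ⟨G.len e.1, (G.len_pos _).le⟩)
      fun s t => ?_).continuous
    rw [Real.dist_eq]
    refine (G.abs_treeDist_sub_le _ _ _ _).trans ?_
    rw [G.isTreeDist.self, zero_add, treeDist_edge, Subtype.dist_eq, Real.dist_eq]
    rfl
  rw [continuous_iff_continuousAt]
  rintro ⟨x, y⟩
  rw [ContinuousAt, tendsto_iff_dist_tendsto_zero]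
  have h2 : Filter.Tendsto (fun p : G.Cover × G.Cover => G.treeDist x p.1 + G.treeDist y p.2)
      (𝓝 (x, y)) (𝓝 0) := by
    have := ((h1 x).comp continuous_fst).add ((h1 y).comp continuous_snd)
    have := this.tendsto (x, y)
    simp only [Pi.add_apply, Function.comp_apply, G.isTreeDist.self, add_zero] at this
    exact this
  refine squeeze_zero (fun _ => dist_nonneg) (fun p => ?_) h2
  rw [dist_comm, Real.dist_eq]
  exact G.abs_treeDist_sub_le _ _ _ _

/-- Points at distance zero in one component lie in each other's small neighbourhoods, hence on a
common edge, where the distance is a positive multiple of the difference of parameters. -/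
theorem eq_of_treeDist_eq_zero (hG : G.NoIsolated) {x y : G.Cover} (h : Joined x y)
    (hd : G.treeDist x y = 0) : x = y := by
  have key : ∀ v : V × FreeGroup E, Joined (G.cover.vertex v) y →
      G.treeDist (G.cover.vertex v) y = 0 → G.cover.vertex v = y := by
    intro v h hd
    obtain ⟨r, hr, H⟩ := G.exists_forall_mem_of_treeDist_lt hG (G.cover.vertex v)
      ((isOpen_star (h0 := by norm_num) (h1 := by norm_num)
        (isOpen_lt continuous_subtype_val (continuous_const (y := (1 / 2 : ℝ))))).mem_nhds
          (mem_star_vertex.2 rfl))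
    have hy := H y h (hd ▸ hr)
    obtain ⟨e, t, rfl⟩ := hG.cover.exists_edge_eq y
    rcases mem_star_edge.1 hy with ⟨-, rfl⟩ | ⟨-, rfl⟩
    · rw [← edge_zero, treeDist_edge, mul_eq_zero, abs_eq_zero, sub_eq_zero] at hd
      rw [← edge_zero, Subtype.ext (hd.resolve_left (G.len_pos _).ne')]
    · rw [← edge_one, treeDist_edge, mul_eq_zero, abs_eq_zero, sub_eq_zero] at hd
      rw [← edge_one, Subtype.ext (hd.resolve_left (G.len_pos _).ne')]
  induction x using realization_ind with
  | hv v => exact key v h hd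
  | he e t =>
    rcases eq_or_ne t 0 with rfl | h0
    · rw [edge_zero] at h hd ⊢
      exact key _ h hd
    rcases eq_or_ne t 1 with rfl | h1
    · rw [edge_one] at h hd ⊢
      exact key _ h hd
    obtain ⟨r, hr, H⟩ := G.exists_forall_mem_of_treeDist_lt hG (G.cover.edge e t)
      (isOpen_openEdge.mem_nhds (mem_openEdge.2
        ⟨rfl, unitInterval.pos_iff_ne_zero.2 h0, unitInterval.lt_one_iff_ne_one.2 h1⟩))
    have hy := H y h (hd ▸ hr)
    obtain ⟨e', t', rfl⟩ := hG.cover.exists_edge_eq y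
    obtain ⟨rfl, -⟩ := mem_openEdge.1 hy
    rw [treeDist_edge, mul_eq_zero, abs_eq_zero, sub_eq_zero] at hd
    rw [Subtype.ext (hd.resolve_left (G.len_pos _).ne')]

/-- A map into the covering forest is continuous if it moves points little in the tree distance
and inside the components. -/
theorem continuousAt_of_treeDist (hG : G.NoIsolated) {Z : Type*} [TopologicalSpace Z]
    {f : Z → G.Cover} {z : Z} (hj : ∀ᶠ w in 𝓝 z, Joined (f z) (f w))
    (h : Filter.Tendsto (fun w => G.treeDist (f z) (f w)) (𝓝 z) (𝓝 0)) : ContinuousAt f z := by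
  intro U hU
  obtain ⟨r, hr, H⟩ := G.exists_forall_mem_of_treeDist_lt hG _ hU
  rw [Filter.mem_map]
  filter_upwards [hj, h.eventually (gt_mem_nhds hr)] with w h1 h2 using H (f w) h1 h2

attribute [irreducible] treeDist

end MetricGraph

/-! ### Spaces satisfying the four point condition -/

namespace IsTreeDist

variable {X : Type*} {d : X → X → ℝ} (h : IsTreeDist d)

include h

theorem nonneg (x y : X) : 0 ≤ d x y := by
  have := h.triangle x y x
  rw [h.self, h.comm y x] at this
  linarith

theorem gromov (o a b c : X) :
    min (d o a + d o b - d a b) (d o b + d o c - d b c) ≤ d o a + d o c - d a c := by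
  have := h.four_point a c o b
  rw [h.comm a o, h.comm c b, h.comm c o] at this
  rw [min_le_iff]
  rcases le_max_iff.1 this with h | h
  · right; linarith
  · left; linarith

/-- Two geodesics in a tree that overlap in a segment of positive length form a geodesic together.
All passages from local to global geodesics rest on this. -/
theorem extend {a b c e : X} (h1 : d a c = d a b + d b c) (h2 : d b e = d b c + d c e)
    (hpos : 0 < d b c) : d a e = d a c + d c e := by
  refine le_antisymm (h.triangle a c e) ?_
  have := h.four_point a c b e
  rw [h.comm c b, h2, h1] at this
  rcases le_max_iff.1 this with h | h <;> linarith

theorem sum_of_turns {x : ℕ → X} (hpos : ∀ i, 0 < d (x i) (x (i + 1)))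
    (hturn : ∀ i, d (x i) (x (i + 2)) = d (x i) (x (i + 1)) + d (x (i + 1)) (x (i + 2)))
    (n : ℕ) : d (x 0) (x n) = ∑ j ∈ Finset.range n, d (x j) (x (j + 1)) := by
  have key : ∀ n, d (x 0) (x (n + 1)) = d (x 0) (x n) + d (x n) (x (n + 1)) := by
    intro n
    induction n with
    | zero => simp [h.self]
    | succ n ih => exact h.extend ih (hturn n) (hpos n)
  induction n with
  | zero => rw [h.self, Finset.sum_range_zero]
  | succ n ih => rw [key, ih, Finset.sum_range_succ]

theorem le_sum (x : ℕ → X) (i n : ℕ) :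
    d (x i) (x (i + n)) ≤ ∑ j ∈ Finset.range n, d (x (i + j)) (x (i + j + 1)) := by
  induction n with
  | zero => rw [add_zero, h.self, Finset.sum_range_zero]
  | succ n ih =>
    rw [Finset.sum_range_succ]
    exact (h.triangle _ _ _).trans (add_le_add_left ih _)

/-- Any loss at one turn would be a loss in the total length, by the triangle inequality on the
pieces before and after it. -/
theorem turn_of_eq_sum {x : ℕ → X} {n : ℕ}
    (heq : d (x 0) (x n) = ∑ j ∈ Finset.range n, d (x j) (x (j + 1))) {i : ℕ} (hi : i + 2 ≤ n) :
    d (x i) (x (i + 2)) = d (x i) (x (i + 1)) + d (x (i + 1)) (x (i + 2)) := by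
  refine le_antisymm (h.triangle _ _ _) ?_
  obtain ⟨k, rfl⟩ := Nat.exists_eq_add_of_le hi
  have h1 := h.le_sum x 0 i
  have h2 := h.le_sum x (i + 2) k
  have h3 := h.triangle (x 0) (x i) (x (i + 2 + k))
  have h4 := h.triangle (x i) (x (i + 2)) (x (i + 2 + k))
  rw [Finset.sum_range_add, Finset.sum_range_add, Finset.sum_range_succ, Finset.sum_range_one] at heq
  simp only [zero_add, add_zero] at h1 heq
  have h5 : i + 1 + 1 = i + 2 := rfl
  rw [h5] at heq
  linarith

theorem geodesic_of_local {γ : unitInterval → X} {c : ℝ} (hc : 0 ≤ c)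
    (hloc : ∀ t₀, ∀ᶠ p : unitInterval × unitInterval in 𝓝 (t₀, t₀),
      d (γ p.1) (γ p.2) = c * |(p.1 : ℝ) - p.2|) (s t : unitInterval) :
    d (γ s) (γ t) = c * |(s : ℝ) - t| := by
  have hU : {p : unitInterval × unitInterval | d (γ p.1) (γ p.2) = c * |(p.1 : ℝ) - p.2|} ∈
      uniformity unitInterval := by
    rw [← nhdsSet_diagonal_eq_uniformity, mem_nhdsSet_iff_forall]
    rintro ⟨x, y⟩ hxy
    obtain rfl : x = y := hxy
    exact hloc x
  obtain ⟨δ, hδ, hH⟩ := Metric.mem_uniformity_dist.1 hU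
  have H : ∀ s t : unitInterval, (s : ℝ) ≤ t → (t : ℝ) - s < δ → d (γ s) (γ t) = c * (t - s) := by
    intro s t h1 h2
    have h3 : |(s : ℝ) - t| = t - s := by rw [abs_sub_comm, abs_of_nonneg (by linarith)]
    have := @hH s t (by rwa [Subtype.dist_eq, Real.dist_eq, h3])
    rwa [← h3]
  have key : ∀ n : ℕ, ∀ s t : unitInterval, (s : ℝ) ≤ t → (t : ℝ) - s ≤ n * (δ / 3) →
      d (γ s) (γ t) = c * (t - s) := by
    intro n
    induction n with
    | zero =>
      intro s t h1 h2
      exact H s t h1 (by push_cast at h2; linarith)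
    | succ n ih =>
      intro s t h1 h2
      by_cases hs : (t : ℝ) - s < 2 * δ / 3
      · exact H s t h1 (by linarith)
      push Not at hs
      push_cast at h2
      -- The last two thirds of a window of width `δ` are used: the geodesics from `s` to `e` and
      -- from `b` to `t` overlap in the segment from `b` to `e`, of parameter length `δ / 3`.
      let b : unitInterval := ⟨t - 2 * δ / 3, by linarith [s.2.1], by linarith [t.2.2]⟩
      let e : unitInterval := ⟨t - δ / 3, by linarith [s.2.1], by linarith [t.2.2]⟩
      have hb : (b : ℝ) = t - 2 * δ / 3 := rfl
      have he : (e : ℝ) = t - δ / 3 := rfl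
      have h3 := ih s e (by linarith) (by linarith)
      have h4 := ih s b (by linarith) (by linarith)
      have h5 := H b e (by linarith) (by linarith)
      have h6 := H e t (by linarith) (by linarith)
      have h7 := H b t (by linarith) (by linarith)
      -- At speed zero the overlap has length zero and `extend` does not apply, but then the
      -- triangle inequality suffices.
      rcases hc.eq_or_lt with rfl | hc
      · have := h.triangle (γ s) (γ e) (γ t)
        have := h.nonneg (γ s) (γ t)
        linarith
      · rw [h.extend (b := γ b) (c := γ e) (by rw [h3, h4, h5]; ring) (by rw [h5, h6, h7]; ring)
          (by rw [h5]; exact mul_pos hc (by linarith)), h3, h6]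
        ring
  obtain ⟨n, hn⟩ := exists_nat_gt (1 / (δ / 3))
  rw [div_lt_iff₀ (by positivity)] at hn
  rcases le_total (s : ℝ) t with hst | hst
  · rw [abs_sub_comm, abs_of_nonneg (by linarith)]
    exact key n s t hst (by linarith [s.2.1, t.2.2])
  · rw [h.comm, abs_of_nonneg (by linarith)]
    exact key n t s hst (by linarith [t.2.1, s.2.2])

/-- A point whose orbit under an isometry runs along a geodesic is moved a minimal distance. -/
theorem le_displacement {T : X → X} (hT : ∀ x y, d (T x) (T y) = d x y) {x : X}
    (hx : d x (T (T x)) = 2 * d x (T x)) (y : X) : d x (T x) ≤ d y (T y) := by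
  rcases (h.nonneg x (T x)).eq_or_lt with h0 | hpos
  · rw [← h0]
    exact h.nonneg _ _
  have hiter : ∀ n a b, d (T^[n] a) (T^[n] b) = d a b := by
    intro n
    induction n with
    | zero => simp
    | succ n ih => intro a b; rw [Function.iterate_succ_apply', Function.iterate_succ_apply', hT, ih]
  have hs : ∀ (z : X) n, d (T^[n] z) (T^[n + 1] z) = d z (T z) := by
    intro z n
    rw [Function.iterate_succ_apply, hiter]
  -- The orbit of `x` moves linearly at rate `d x (T x)`, that of `y` at rate at most `d y (T y)`,
  -- and the two stay at constant distance; for large `n` this compares the rates.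
  have h1 : ∀ n : ℕ, d x (T^[n] x) = n * d x (T x) := by
    intro n
    have := h.sum_of_turns (x := fun n => T^[n] x) (fun i => by rwa [hs]) (fun i => by
      rw [show d (T^[i + 1] x) (T^[i + 2] x) = _ from hs x (i + 1), hs,
        show T^[i + 2] x = T^[i] (T (T x)) from rfl, hiter, hx, two_mul]) n
    simp only [Function.iterate_zero, id] at this
    rw [this, Finset.sum_congr rfl fun j _ => hs x j]
    simp
  have h2 : ∀ n : ℕ, d y (T^[n] y) ≤ n * d y (T y) := by
    intro n
    have := h.le_sum (fun n => T^[n] y) 0 n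
    simp only [zero_add, Function.iterate_zero, id] at this
    rw [Finset.sum_congr rfl fun j _ => hs y j] at this
    simpa using this
  by_contra! hcon
  obtain ⟨n, hn⟩ := exists_nat_gt (2 * d x y / (d x (T x) - d y (T y)))
  rw [div_lt_iff₀ (by linarith)] at hn
  have h3 := h.triangle x y (T^[n] x)
  have h4 := h.triangle y (T^[n] y) (T^[n] x)
  rw [hiter, h.comm y x] at h4
  have := h1 n
  have := h2 n
  linarith

/-- A point that is moved a minimal distance by an isometry lies on an axis. -/
theorem axis_of_le_displacement {T : X → X} (hT : ∀ x y, d (T x) (T y) = d x y) {x : X}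
    (hmin : ∀ y, d x (T x) ≤ d y (T y))
    (hgeod : ∀ s, 0 ≤ s → s ≤ d x (T x) → ∃ y, d x y = s ∧ d y (T x) = d x (T x) - s) :
    d x (T (T x)) = 2 * d x (T x) := by
  set D := d x (T x) with hD
  have hTD : d (T x) (T (T x)) = D := hT _ _
  by_contra hne
  have hlt : d x (T (T x)) < 2 * D :=
    lt_of_le_of_ne (by linarith [h.triangle x (T x) (T (T x))]) hne
  have hDpos : 0 < D := by linarith [h.nonneg x (T (T x))]
  -- If the path from `x` through `T x` to `T (T x)` turned back at `T x`, its two halves would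
  -- share an initial piece of length `D - d x (T (T x)) / 2`. The point `y` at distance `ε` before
  -- `T x`, well inside that piece, also lies on the second half and is moved by less than `D`.
  set ε := min (D - d x (T (T x)) / 2) D / 2 with hε
  have hε0 : 0 < ε := by
    have : 0 < min (D - d x (T (T x)) / 2) D := lt_min (by linarith) hDpos
    linarith
  have hε1 : 2 * ε ≤ D - d x (T (T x)) / 2 := by
    have := min_le_left (D - d x (T (T x)) / 2) D
    linarith
  have hε2 : 2 * ε ≤ D := by
    have := min_le_right (D - d x (T (T x)) / 2) D
    linarith
  obtain ⟨y, hy1, hy2⟩ := hgeod (D - ε) (by linarith) (by linarith)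
  have hy3 : d (T x) (T y) = D - ε := by rw [hT, hy1]
  have hy4 : d (T y) (T (T x)) = ε := by rw [hT, hy2]; ring
  have g1 := h.gromov (T x) y x (T (T x))
  have g2 := h.gromov (T x) y (T (T x)) (T y)
  rw [h.comm y x, hy1, h.comm (T x) y, hy2, h.comm (T x) x, ← hD, hTD] at g1
  rw [h.comm (T (T x)) (T y), hy4, h.comm (T x) y, hy2, hTD, hy3] at g2
  have := hmin y
  rcases min_le_iff.1 g1 with g1 | g1 <;> rcases min_le_iff.1 g2 with g2 | g2 <;> linarith

/-- Moving from `a` by `ε` towards `b₀` also gains `ε` towards every `b` whose geodesic from `a`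
shares that first piece. It is used to shorten several edges simultaneously. -/
theorem le_sub_of_gromov {a b b₀ z : X} {ε : ℝ} (hz : d a z = ε) (hz' : d z b₀ = d a b₀ - ε)
    (hb : 2 * ε ≤ d a b + d a b₀ - d b b₀) : d z b ≤ d a b - ε := by
  have := h.gromov a z b₀ b
  rw [hz, hz', h.comm b₀ b] at this
  rcases min_le_iff.1 this with h | h <;> linarith

end IsTreeDist

namespace MetricGraph

open Multigraph

variable {V : Type u} {E : Type v} [Fintype E] (G : MetricGraph V E)

/-! ### Geodesics in the covering forest -/

theorem exists_between {x y : G.Cover} (hxy : Joined x y) {s : ℝ} (h0 : 0 ≤ s)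
    (hs : s ≤ G.treeDist x y) :
    ∃ z, Joined x z ∧ G.treeDist x z = s ∧ G.treeDist z y = G.treeDist x y - s := by
  have hT := G.isTreeDist
  rcases h0.eq_or_lt with rfl | h0
  · exact ⟨x, .refl x, hT.self x, by rw [sub_zero]⟩
  obtain ⟨γ⟩ := hxy
  -- This is twice the Gromov product at `x` of `γ t` and `y`, the position of the projection of `γ
  -- t` to the geodesic; it runs from `0` to `2 * G.treeDist x y`.
  set f : unitInterval → ℝ := fun t => G.treeDist x (γ t) + G.treeDist x y - G.treeDist (γ t) y
  have hc1 : Continuous fun t => G.treeDist x (γ t) :=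
    G.continuous_treeDist.comp (continuous_const.prodMk γ.continuous)
  have hf : Continuous f := (hc1.add continuous_const).sub
    (G.continuous_treeDist.comp (γ.continuous.prodMk continuous_const))
  by_contra! hcon
  have hcon' : ∀ t, f t = 2 * s → s < G.treeDist x (γ t) := by
    intro t ht
    have h1 : s ≤ G.treeDist x (γ t) := by
      have := hT.triangle x (γ t) y
      simp only [f] at ht
      linarith
    refine lt_of_le_of_ne h1 fun heq => ?_
    have hj : Joined x (γ t) := by
      have := (PathConnectedSpace.joined 0 t).map γ.continuous
      rwa [γ.source] at this
    refine hcon (γ t) hj heq.symm ?_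
    simp only [f] at ht
    linarith
  -- If the wanted point were not on `γ`, then wherever `f` takes the value `2 * s` the path is on a
  -- side branch. Nearby points project no earlier, so the superlevel set is open as well as closed,
  -- contradicting connectedness.
  have hB : IsClopen {t | 2 * s ≤ f t} := by
    refine ⟨isClosed_le continuous_const hf, isOpen_iff_mem_nhds.2 fun t ht => ?_⟩
    rcases (show 2 * s ≤ f t from ht).eq_or_lt with heq | hlt
    · have h1 := hcon' t heq.symm
      have hc2 : Continuous fun t' => G.treeDist (γ t) (γ t') :=
        G.continuous_treeDist.comp (continuous_const.prodMk γ.continuous)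
      have h2 : ∀ᶠ t' in 𝓝 t, G.treeDist (γ t) (γ t') < G.treeDist x (γ t) - s :=
        hc2.continuousAt.eventually (gt_mem_nhds (by simp only [hT.self]; linarith))
      filter_upwards [h2] with t' ht'
      have g := hT.gromov x (γ t') (γ t) y
      rw [hT.comm (γ t') (γ t)] at g
      have h3 := hT.triangle x (γ t') (γ t)
      rw [hT.comm (γ t') (γ t)] at h3
      have h4 : G.treeDist x (γ t) + G.treeDist x y - G.treeDist (γ t) y = 2 * s := heq.symm
      rw [h4] at g
      change 2 * s ≤ G.treeDist x (γ t') + G.treeDist x y - G.treeDist (γ t') y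
      refine le_trans (le_min ?_ le_rfl) g
      linarith
    · exact Filter.mem_of_superset (hf.continuousAt.eventually (lt_mem_nhds hlt))
        fun t' ht' => (show 2 * s < f t' from ht').le
  rcases isClopen_iff.1 hB with h | h
  · have : (1 : unitInterval) ∈ {t | 2 * s ≤ f t} := by
      simp only [Set.mem_ofPred_eq, f, γ.target, hT.self]
      linarith
    rw [h] at this
    exact this
  · have : (0 : unitInterval) ∈ {t | 2 * s ≤ f t} := h ▸ Set.mem_univ _
    simp only [Set.mem_ofPred_eq, f, γ.source, hT.self] at this
    linarith

theorem eq_of_between (hG : G.NoIsolated) {x y z z' : G.Cover} (hz : Joined x z)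
    (hz' : Joined x z') (h : G.treeDist x z = G.treeDist x z')
    (h1 : G.treeDist x z + G.treeDist z y = G.treeDist x y)
    (h2 : G.treeDist x z' + G.treeDist z' y = G.treeDist x y) : z = z' := by
  have hT := G.isTreeDist
  refine G.eq_of_treeDist_eq_zero hG (hz.symm.trans hz') (le_antisymm ?_ (hT.nonneg _ _))
  have := hT.four_point z z' x y
  rw [hT.comm z x, hT.comm z' x] at this
  rcases le_max_iff.1 this with h | h <;> linarith

theorem exists_geodesicPoint (x y : G.Cover) (t : unitInterval) : ∃ z, Joined x y →
    Joined x z ∧ G.treeDist x z = t * G.treeDist x y ∧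
      G.treeDist z y = (1 - t) * G.treeDist x y := by
  by_cases hxy : Joined x y
  · have h0 := G.treeDist_nonneg x y
    obtain ⟨z, h1, h2, h3⟩ := G.exists_between hxy (s := t * G.treeDist x y)
      (mul_nonneg t.2.1 h0) (mul_le_of_le_one_left h0 t.2.2)
    exact ⟨z, fun _ => ⟨h1, h2, by rw [h3]; ring⟩⟩
  · exact ⟨x, fun h => (hxy h).elim⟩

/-- The point that divides the geodesic from `x` to `y` in the ratio `t : 1 - t`. -/
def geodesicPoint (x y : G.Cover) (t : unitInterval) : G.Cover :=
  (G.exists_geodesicPoint x y t).choose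

variable {G} {x y : G.Cover}

theorem joined_geodesicPoint (h : Joined x y) (t : unitInterval) :
    Joined x (G.geodesicPoint x y t) :=
  ((G.exists_geodesicPoint x y t).choose_spec h).1

theorem treeDist_left_geodesicPoint (h : Joined x y) (t : unitInterval) :
    G.treeDist x (G.geodesicPoint x y t) = t * G.treeDist x y :=
  ((G.exists_geodesicPoint x y t).choose_spec h).2.1

theorem treeDist_geodesicPoint_right (h : Joined x y) (t : unitInterval) :
    G.treeDist (G.geodesicPoint x y t) y = (1 - t) * G.treeDist x y :=
  ((G.exists_geodesicPoint x y t).choose_spec h).2.2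

theorem geodesicPoint_zero (hG : G.NoIsolated) (h : Joined x y) : G.geodesicPoint x y 0 = x :=
  (G.eq_of_treeDist_eq_zero hG (joined_geodesicPoint h 0)
    (by rw [treeDist_left_geodesicPoint h]; simp)).symm

theorem geodesicPoint_one (hG : G.NoIsolated) (h : Joined x y) : G.geodesicPoint x y 1 = y :=
  G.eq_of_treeDist_eq_zero hG ((joined_geodesicPoint h 1).symm.trans h)
    (by rw [treeDist_geodesicPoint_right h]; simp)

theorem joined_smul (g : FreeGroup E) (h : Joined x y) : Joined (g • x) (g • y) :=
  h.map (continuous_const_smul g)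

theorem smul_geodesicPoint (hG : G.NoIsolated) (g : FreeGroup E) (h : Joined x y)
    (t : unitInterval) : G.geodesicPoint (g • x) (g • y) t = g • G.geodesicPoint x y t := by
  have h' := joined_smul g h
  have e1 := treeDist_left_geodesicPoint h t
  have e2 := treeDist_geodesicPoint_right h t
  have e3 := treeDist_left_geodesicPoint h' t
  have e4 := treeDist_geodesicPoint_right h' t
  rw [treeDist_smul] at e3 e4
  refine G.eq_of_between hG (y := g • y) (joined_geodesicPoint h' t)
    (joined_smul g (joined_geodesicPoint h t)) ?_ ?_ ?_ <;> simp only [treeDist_smul] <;> linarith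

/-- The right side tends to zero as endpoints and parameters converge, so geodesics depend
continuously on all their data; the same bound also gives one half of the constant speed formula. -/
theorem treeDist_geodesicPoint_le {x' y' : G.Cover} (h : Joined x y) (h' : Joined x' y')
    (t t' : unitInterval) :
    G.treeDist (G.geodesicPoint x y t) (G.geodesicPoint x' y' t') ≤
      max (t * G.treeDist x y + (1 - t') * G.treeDist x' y' + G.treeDist y y' - G.treeDist x y)
        ((1 - t) * G.treeDist x y + t' * G.treeDist x' y' + G.treeDist x x' - G.treeDist x y) := by
  have hT := G.isTreeDist
  have e1 := treeDist_left_geodesicPoint h t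
  have e2 := treeDist_geodesicPoint_right h t
  have e3 := treeDist_left_geodesicPoint h' t'
  have e4 := treeDist_geodesicPoint_right h' t'
  have := hT.four_point (G.geodesicPoint x y t) (G.geodesicPoint x' y' t') x y
  have h1 := hT.triangle (G.geodesicPoint x' y' t') y' y
  have h2 := hT.triangle x x' (G.geodesicPoint x' y' t')
  rw [hT.comm _ x, hT.comm _ x, e1, e2] at this
  rw [hT.comm y' y] at h1
  rw [le_max_iff] at *
  rcases this with h | h
  · left; linarith
  · right; linarith

theorem continuous_geodesicPoint (hG : G.NoIsolated) {Z : Type*} [TopologicalSpace Z]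
    [PathConnectedSpace Z] {f f' : Z → G.Cover} {τ : Z → unitInterval} (hf : Continuous f)
    (hf' : Continuous f') (hτ : Continuous τ) (hj : ∀ z, Joined (f z) (f' z)) :
    Continuous fun z => G.geodesicPoint (f z) (f' z) (τ z) := by
  refine continuous_iff_continuousAt.2 fun z => G.continuousAt_of_treeDist hG
    (.of_forall fun w => (joined_geodesicPoint (hj z) _).symm.trans
      (((PathConnectedSpace.joined z w).map hf).trans (joined_geodesicPoint (hj w) _))) ?_
  have c1 : Continuous fun w => G.treeDist (f w) (f' w) :=
    G.continuous_treeDist.comp (hf.prodMk hf')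
  have c2 : Continuous fun w => G.treeDist (f z) (f w) :=
    G.continuous_treeDist.comp (continuous_const.prodMk hf)
  have c3 : Continuous fun w => G.treeDist (f' z) (f' w) :=
    G.continuous_treeDist.comp (continuous_const.prodMk hf')
  have c4 : Continuous fun w => ((τ w : unitInterval) : ℝ) := continuous_subtype_val.comp hτ
  set D := G.treeDist (f z) (f' z) with hD
  have hc : Continuous fun w =>
      max (τ z * D + (1 - τ w) * G.treeDist (f w) (f' w) + G.treeDist (f' z) (f' w) - D)
        ((1 - τ z) * D + τ w * G.treeDist (f w) (f' w) + G.treeDist (f z) (f w) - D) := by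
    fun_prop
  have hlim := hc.tendsto z
  have h0 : max (τ z * D + (1 - τ z) * G.treeDist (f z) (f' z) + G.treeDist (f' z) (f' z) - D)
        ((1 - τ z) * D + τ z * G.treeDist (f z) (f' z) + G.treeDist (f z) (f z) - D) = 0 := by
    rw [G.isTreeDist.self, G.isTreeDist.self, ← hD]
    ring_nf
    exact max_self _
  rw [h0] at hlim
  exact squeeze_zero (fun w => G.treeDist_nonneg _ _)
    (fun w => treeDist_geodesicPoint_le (hj z) (hj w) _ _) hlim

theorem treeDist_geodesicPoint (h : Joined x y) (s t : unitInterval) :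
    G.treeDist (G.geodesicPoint x y s) (G.geodesicPoint x y t) =
      |(s : ℝ) - t| * G.treeDist x y := by
  have hT := G.isTreeDist
  have e1 := treeDist_left_geodesicPoint h s
  have e2 := treeDist_geodesicPoint_right h s
  have e3 := treeDist_left_geodesicPoint h t
  have e4 := treeDist_geodesicPoint_right h t
  have h0 := G.treeDist_nonneg x y
  refine le_antisymm ?_ ?_
  · refine (treeDist_geodesicPoint_le h h s t).trans ?_
    rw [hT.self, hT.self]
    refine max_le ?_ ?_
    · have := mul_le_mul_of_nonneg_right (le_abs_self ((s : ℝ) - t)) h0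
      linarith
    · have := mul_le_mul_of_nonneg_right (neg_le_abs ((s : ℝ) - t)) h0
      linarith
  · have h1 := hT.triangle x (G.geodesicPoint x y s) (G.geodesicPoint x y t)
    have h2 := hT.triangle x (G.geodesicPoint x y t) (G.geodesicPoint x y s)
    rw [hT.comm (G.geodesicPoint x y t) (G.geodesicPoint x y s)] at h2
    rcases abs_cases ((s : ℝ) - t) with ⟨h3, -⟩ | ⟨h3, -⟩ <;> rw [h3] <;> linarith

end MetricGraph

namespace Multigraph

variable {V : Type u} {E : Type v} {Γ : Multigraph V E}

theorem exists_smul_eq_of_proj_eq (hΓ : Γ.NoIsolated) {x y : Γ.Cover} (h : Γ.proj x = Γ.proj y) :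
    ∃ g : FreeGroup E, x = g • y := by
  obtain ⟨g, hg⟩ := (Γ.isQuotientCoveringMap_proj hΓ).apply_eq_iff_mem_orbit.1 h
  exact ⟨g, hg.symm⟩

end Multigraph

namespace MetricGraph

open Multigraph

variable {V : Type u} {E : Type v} [Fintype E] {G : MetricGraph V E}

/-! ### The path metric and the tree distance -/

theorem Chain.nonneg {x y : G.Realization} {L : ℝ} (h : G.Chain x y L) : 0 ≤ L := by
  induction h with
  | refl => exact le_rfl
  | step e s t _ ih => exact add_nonneg (mul_nonneg (G.len_pos e).le (abs_nonneg _)) ih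

theorem Chain.edge (e : E) (s t : unitInterval) :
    G.Chain (G.edge e s) (G.edge e t) (G.len e * |(s : ℝ) - t|) := by
  simpa using Chain.step e s t (Chain.refl (G.edge e t))

/-- Each segment lifts inside one edge with the same length, so a chain bounds the tree distance
from `x` to some lift of its end, though not to a prescribed one. -/
theorem Chain.exists_lift (hG : G.NoIsolated) {a b : G.Realization} {L : ℝ} (h : G.Chain a b L)
    (x : G.Cover) (hx : G.proj x = a) :
    ∃ y, G.proj y = b ∧ Joined x y ∧ G.treeDist x y ≤ L := by
  induction h generalizing x with
  | refl => exact ⟨x, hx, .refl x, (G.isTreeDist.self x).le⟩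
  | step e s t _ ih =>
    obtain ⟨g, rfl⟩ := exists_smul_eq_of_proj_eq hG (y := G.cover.edge (e, 1) s) hx
    obtain ⟨y, h1, h2, h3⟩ := ih (G.cover.edge (e, g) t) rfl
    rw [smul_edge, mul_one]
    refine ⟨y, h1, (joined_edge _ _ _).trans h2,
      (G.isTreeDist.triangle _ (G.cover.edge (e, g) t) _).trans ?_⟩
    rw [treeDist_edge]
    exact add_le_add_right h3 _

theorem exists_le_treeDist_smul (hG : G.NoIsolated) (x : G.Cover) :
    ∃ r > 0, ∀ g : FreeGroup E, Joined x (g • x) → G.treeDist x (g • x) < r → g = 1 := by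
  obtain ⟨U, hU, H⟩ := (G.isQuotientCoveringMap_proj hG).disjoint x
  obtain ⟨r, hr, H'⟩ := G.exists_forall_mem_of_treeDist_lt hG x hU
  exact ⟨r, hr, fun g h1 h2 => H g ⟨g • x, ⟨x, mem_of_mem_nhds hU, rfl⟩, H' _ h1 h2⟩⟩

theorem eventually_joined (x : G.Cover) : ∀ᶠ y in 𝓝 x, Joined x y := by
  refine IsOpen.mem_nhds (s := pathComponent x) (G.cover.isOpen_iff.2 fun e => ?_)
    (mem_pathComponent_self x)
  by_cases h : Joined x (G.cover.edge e 0)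
  · have : G.cover.edge e ⁻¹' pathComponent x = Set.univ :=
      Set.eq_univ_of_forall fun t => h.trans (joined_edge e 0 t)
    rw [this]
    exact isOpen_univ
  · have : G.cover.edge e ⁻¹' pathComponent x = ∅ :=
      Set.eq_empty_of_forall_notMem fun t ht => h ((show Joined x _ from ht).trans
        (joined_edge e t 0))
    rw [this]
    exact isOpen_empty

theorem continuous_treeDist_left (x : G.Cover) : Continuous (G.treeDist x) :=
  G.continuous_treeDist.comp (continuous_const.prodMk continuous_id)

theorem eventually_treeDist_lt (x : G.Cover) {r : ℝ} (hr : 0 < r) :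
    ∀ᶠ y in 𝓝 x, G.treeDist x y < r :=
  (continuous_treeDist_left x).continuousAt.eventually
    (gt_mem_nhds (by rwa [G.isTreeDist.self]))

theorem eventually_le_of_chain (hG : G.NoIsolated) (x : G.Cover) :
    ∀ᶠ p : G.Cover × G.Cover in 𝓝 (x, x), ∀ L, G.Chain (G.proj p.1) (G.proj p.2) L →
      G.treeDist p.1 p.2 ≤ L := by
  obtain ⟨r, hr, H⟩ := exists_le_treeDist_smul hG x
  -- If a chain lifts to a path ending at a nontrivial translate, its length is at least `r - r / 4
  -- - r / 4`, which already exceeds the distance of the two given points.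
  have hn : ∀ᶠ y in 𝓝 x, Joined x y ∧ G.treeDist x y < r / 4 :=
    (eventually_joined x).and (eventually_treeDist_lt x (by positivity))
  rw [nhds_prod_eq]
  filter_upwards [hn.prod_mk hn] with ⟨y, z⟩ h L hL
  obtain ⟨⟨hy, hy'⟩, hz, hz'⟩ := h
  dsimp only at hy hy' hz hz' hL ⊢
  have hT := G.isTreeDist
  obtain ⟨z', h1, h2, h3⟩ := hL.exists_lift hG y rfl
  obtain ⟨g, rfl⟩ := exists_smul_eq_of_proj_eq hG h1
  have hgz : G.treeDist (g • x) (g • z) = G.treeDist x z := G.treeDist_smul _ _ _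
  by_cases hg : g = 1
  · subst hg
    rwa [one_smul] at h3
  · have h4 : r ≤ G.treeDist x (g • x) := by
      by_contra! hlt
      exact hg (H g (hy.trans (h2.trans (joined_smul g hz).symm)) hlt)
    have h5 := hT.triangle x y (g • x)
    have h6 := hT.triangle y (g • z) (g • x)
    have h7 := hT.triangle y x z
    rw [hT.comm (g • z)] at h6
    rw [hT.comm y x] at h7
    linarith

theorem weightedNorm_single_sub_single {i j : E × FreeGroup E} (hij : i ≠ j) (a b : ℝ) :
    G.weightedNorm (Finsupp.single i a - Finsupp.single j b) =
      G.len i.1 * |a| + G.len j.1 * |b| := by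
  classical
  have hs : (Finsupp.single i a - Finsupp.single j b).support ⊆ {i, j} :=
    Finsupp.support_sub.trans (Finset.union_subset
      (Finsupp.support_single_subset.trans (by simp))
      (Finsupp.support_single_subset.trans (by simp)))
  rw [G.weightedNorm_eq_sum hs, Finset.sum_pair hij]
  simp [hij, hij.symm]

theorem eventually_chain (hG : G.NoIsolated) (x : G.Cover) :
    ∀ᶠ p : G.Cover × G.Cover in 𝓝 (x, x),
      G.Chain (G.proj p.1) (G.proj p.2) (G.treeDist p.1 p.2) := by
  have hedge : ∀ e s t, G.Chain (G.proj (G.cover.edge e s)) (G.proj (G.cover.edge e t))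
      (G.treeDist (G.cover.edge e s) (G.cover.edge e t)) := fun e s t => by
    rw [treeDist_edge]
    exact Chain.edge e.1 s t
  have key : ∀ v : V × FreeGroup E, ∀ᶠ p : G.Cover × G.Cover in
      𝓝 (G.cover.vertex v, G.cover.vertex v),
      G.Chain (G.proj p.1) (G.proj p.2) (G.treeDist p.1 p.2) := by
    intro v
    have hstar : ∀ᶠ y in 𝓝 (G.cover.vertex v), ∃ i t t₀, y = G.cover.edge i t ∧
        G.cover.vertex v = G.cover.edge i t₀ := by
      filter_upwards [(isOpen_star (h0 := by norm_num) (h1 := by norm_num)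
        (isOpen_lt continuous_subtype_val (continuous_const (y := (1 / 2 : ℝ))))).mem_nhds
          (mem_star_vertex.2 (rfl : v = v))] with y hy
      obtain ⟨e, t, rfl⟩ := hG.cover.exists_edge_eq y
      rcases mem_star_edge.1 hy with ⟨-, rfl⟩ | ⟨-, rfl⟩
      · exact ⟨e, t, 0, rfl, (edge_zero _ _).symm⟩
      · exact ⟨e, t, 1, rfl, (edge_one _ _).symm⟩
    rw [nhds_prod_eq]
    filter_upwards [hstar.prod_mk hstar] with ⟨y, z⟩ h
    obtain ⟨⟨i, s, s₀, rfl, hs⟩, j, t, t₀, rfl, ht⟩ := h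
    dsimp only
    by_cases hij : i = j
    · subst hij
      exact hedge _ _ _
    -- Points on different edges of the star are connected through the vertex; their coordinates
    -- relative to the vertex are supported on different edges, so the ℓ¹ distance is also the sum
    -- of the two pieces.
    · have h1 := Chain.step (G := G) i.1 s s₀ (y := G.edge j.1 t) (L := G.len j.1 * |(t₀ : ℝ) - t|) (by
        have := Chain.edge (G := G) j.1 t₀ t
        rwa [← proj_edge, ← ht, hs] at this)
      have h2 : G.treeDist (G.cover.edge i s) (G.cover.edge j t) =
          G.len i.1 * |(s : ℝ) - s₀| + G.len j.1 * |(t₀ : ℝ) - t| := by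
        rw [abs_sub_comm (t₀ : ℝ), ← weightedNorm_single_sub_single hij, treeDist, dev_edge,
          dev_edge]
        have h3 := congrArg G.dev (hs.symm.trans ht)
        rw [dev_edge, dev_edge] at h3
        rw [Finsupp.single_sub, Finsupp.single_sub]
        congr 1
        rw [eq_sub_of_add_eq h3]
        abel
      rw [h2]
      exact h1
  induction x using realization_ind with
  | hv v => exact key v
  | he e t =>
    rcases eq_or_ne t 0 with rfl | h0
    · rw [edge_zero]
      exact key _
    rcases eq_or_ne t 1 with rfl | h1
    · rw [edge_one]
      exact key _
    have hopen : ∀ᶠ y in 𝓝 (G.cover.edge e t), ∃ s, y = G.cover.edge e s := by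
      filter_upwards [isOpen_openEdge.mem_nhds (mem_openEdge.2
        ⟨rfl, unitInterval.pos_iff_ne_zero.2 h0, unitInterval.lt_one_iff_ne_one.2 h1⟩)] with y hy
      obtain ⟨e', s, rfl⟩ := hG.cover.exists_edge_eq y
      obtain ⟨rfl, -⟩ := mem_openEdge.1 hy
      exact ⟨s, rfl⟩
    rw [nhds_prod_eq]
    filter_upwards [hopen.prod_mk hopen] with ⟨y, z⟩ h
    obtain ⟨⟨s, rfl⟩, s', rfl⟩ := h
    exact hedge _ _ _

/-- The covering projection is locally isometric. -/
theorem eventually_pathDist_proj (hG : G.NoIsolated) (x : G.Cover) :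
    ∀ᶠ p : G.Cover × G.Cover in 𝓝 (x, x),
      G.pathDist (G.proj p.1) (G.proj p.2) = G.treeDist p.1 p.2 := by
  filter_upwards [eventually_le_of_chain hG x, eventually_chain hG x] with p h1 h2
  exact le_antisymm (csInf_le ⟨0, fun L hL => Chain.nonneg hL⟩ h2) (le_csInf ⟨_, h2⟩ h1)

variable {V' : Type*} {E' : Type*} [Fintype E'] {G' : MetricGraph V' E'}

/-- The projection is a local isometry, so the local definition of slope says that the lift is
locally a geodesic of constant speed; in a tree it then is one globally. -/
theorem hasSlope_iff (hG' : G'.NoIsolated) {φ : C(G.Realization, G'.Realization)} {e : E}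
    {γ : unitInterval → G'.Cover} (hγ : Continuous γ) (hφ : ∀ t, G'.proj (γ t) = φ (G.edge e t))
    {s : ℝ} : HasSlope φ e s ↔
      ∀ t t', G'.treeDist (γ t) (γ t') = s * (G.len e * |(t : ℝ) - t'|) := by
  have hloc : ∀ t₀, ∀ᶠ p : unitInterval × unitInterval in 𝓝 (t₀, t₀),
      G'.pathDist (φ (G.edge e p.1)) (φ (G.edge e p.2)) = G'.treeDist (γ p.1) (γ p.2) := by
    intro t₀
    have hc : Continuous fun p : unitInterval × unitInterval => (γ p.1, γ p.2) :=
      (hγ.comp continuous_fst).prodMk (hγ.comp continuous_snd)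
    filter_upwards [hc.continuousAt.eventually (eventually_pathDist_proj hG' (γ t₀))] with p hp
    rw [← hφ, ← hφ, hp]
  constructor
  · intro h t t'
    have hT := G'.isTreeDist
    have hs : 0 ≤ s := by
      have h1 : Filter.Tendsto (fun n : ℕ => ((⟨1 / ((n : ℝ) + 1), by positivity, by
          rw [div_le_one (by positivity)]; linarith [Nat.cast_nonneg (α := ℝ) n]⟩ : unitInterval),
          (0 : unitInterval))) Filter.atTop (𝓝 (0, 0)) :=
        Filter.Tendsto.prodMk_nhds (by
          rw [tendsto_subtype_rng]
          exact tendsto_one_div_add_atTop_nhds_zero_nat) tendsto_const_nhds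
      obtain ⟨n, h2, h3⟩ := (h1.eventually ((hloc 0).and (h 0))).exists
      rw [h2] at h3
      have h4 := hT.nonneg (γ (⟨1 / ((n : ℝ) + 1), by positivity, by
          rw [div_le_one (by positivity)]; linarith [Nat.cast_nonneg (α := ℝ) n]⟩)) (γ 0)
      rw [h3] at h4
      refine nonneg_of_mul_nonneg_left h4 (mul_pos (G.len_pos e) (abs_pos.2 ?_))
      simp only [Set.Icc.coe_zero, sub_zero]
      positivity
    have := hT.geodesic_of_local (γ := γ) (c := s * G.len e) (mul_nonneg hs (G.len_pos e).le)
      (fun t₀ => by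
        filter_upwards [hloc t₀, h t₀] with p h1 h2
        rw [← h1, h2, mul_assoc]) t t'
    rw [this, mul_assoc]
  · intro h t₀
    filter_upwards [hloc t₀] with p hp
    rw [hp, h]

end MetricGraph

namespace Multigraph

variable {V : Type u} {E : Type v} {Γ : Multigraph V E}

/-! ### Lifts of loops to the covering forest -/

theorem isCoveringMap_proj (hΓ : Γ.NoIsolated) : IsCoveringMap Γ.proj :=
  (Γ.isQuotientCoveringMap_proj hΓ).isCoveringMap

theorem smul_left_cancel (hΓ : Γ.NoIsolated) {g g' : FreeGroup E} {x : Γ.Cover}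
    (h : g • x = g' • x) : g = g' := by
  have := (Γ.isQuotientCoveringMap_proj hΓ).isCancelSMul
  exact IsCancelSMul.right_cancel _ _ x h

theorem lift_unique (hΓ : Γ.NoIsolated) {A : Type*} [TopologicalSpace A] [PreconnectedSpace A]
    {f f' : A → Γ.Cover} (hf : Continuous f) (hf' : Continuous f')
    (h : ∀ a, Γ.proj (f a) = Γ.proj (f' a)) (a : A) (ha : f a = f' a) : f = f' :=
  (isCoveringMap_proj hΓ).eq_of_comp_eq hf hf' (funext h) a ha

/-- `a` is a lift of the loop `α` to the universal cover `ℝ` of the circle and the forest, and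
`g` is the element of the free group by which it is equivariant. -/
structure IsLift (α : Γ.Loop) (a : ℝ → Γ.Cover) (g : FreeGroup E) : Prop where
  continuous : Continuous a
  proj_eq : ∀ t : ℝ, Γ.proj (a t) = α (t : UnitAddCircle)
  add_one : ∀ t, a (t + 1) = g • a t

theorem IsLift.of_apply_one (hΓ : Γ.NoIsolated) {α : Γ.Loop} {a : ℝ → Γ.Cover} (ha : Continuous a)
    (hp : ∀ t : ℝ, Γ.proj (a t) = α (t : UnitAddCircle)) {g : FreeGroup E} (hg : a 1 = g • a 0) :
    IsLift α a g := by
  refine ⟨ha, hp, fun t => ?_⟩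
  refine congrFun (lift_unique hΓ (f := fun t => a (t + 1)) (f' := fun t => g • a t)
    (ha.comp (continuous_id.add continuous_const)) (ha.const_smul g) (fun t => ?_) 0
    (by simpa using hg)) t
  rw [hp, proj_smul, hp]
  simp

theorem exists_isLift (hΓ : Γ.NoIsolated) (α : Γ.Loop) {x : Γ.Cover} (hx : Γ.proj x = α 0) :
    ∃ a g, IsLift α a g ∧ a 0 = x := by
  obtain ⟨F, ⟨h0, hF⟩, -⟩ := (isCoveringMap_proj hΓ).existsUnique_continuousMap_lifts
    (α.comp ⟨fun t : ℝ => (t : UnitAddCircle), AddCircle.continuous_mk' 1⟩) 0 x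
    (by rw [hx]; rfl)
  have hF' : ∀ t : ℝ, Γ.proj (F t) = α (t : UnitAddCircle) := fun t => congrFun hF t
  obtain ⟨g, hg⟩ := exists_smul_eq_of_proj_eq hΓ (x := F 1) (y := F 0)
    (by rw [hF', hF']; exact congrArg α (AddCircle.coe_period 1))
  exact ⟨F, g, IsLift.of_apply_one hΓ F.continuous hF' hg, h0⟩

theorem exists_isLift' (hΓ : Γ.NoIsolated) (α : Γ.Loop) : ∃ a g, IsLift α a g := by
  obtain ⟨x, hx⟩ := (Γ.isQuotientCoveringMap_proj hΓ).surjective (α 0)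
  obtain ⟨a, g, h, -⟩ := exists_isLift hΓ α hx
  exact ⟨a, g, h⟩

theorem IsLift.smul {α : Γ.Loop} {a : ℝ → Γ.Cover} {g : FreeGroup E} (h : IsLift α a g)
    (k : FreeGroup E) : IsLift α (fun t => k • a t) (k * g * k⁻¹) :=
  ⟨h.continuous.const_smul k, fun t => by rw [proj_smul, h.proj_eq], fun t => by
    rw [h.add_one, mul_smul, mul_smul, inv_smul_smul]⟩

theorem IsLift.joined {α : Γ.Loop} {a : ℝ → Γ.Cover} {g : FreeGroup E} (h : IsLift α a g)
    (s t : ℝ) : Joined (a s) (a t) := (PathConnectedSpace.joined s t).map h.continuous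

theorem IsLift.exists_conj (hΓ : Γ.NoIsolated) {α : Γ.Loop} {a b : ℝ → Γ.Cover}
    {g k : FreeGroup E} (ha : IsLift α a g) (hb : IsLift α b k) :
    ∃ c : FreeGroup E, a = (fun t => c • b t) ∧ g = c * k * c⁻¹ := by
  obtain ⟨c, hc⟩ := exists_smul_eq_of_proj_eq hΓ (x := a 0) (y := b 0)
    (by rw [ha.proj_eq, hb.proj_eq])
  have heq := lift_unique hΓ ha.continuous (hb.smul c).continuous
    (fun t => by rw [ha.proj_eq, (hb.smul c).proj_eq]) 0 hc
  refine ⟨c, heq, smul_left_cancel hΓ (x := a 0) ?_⟩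
  rw [← ha.add_one, heq]
  exact (hb.smul c).add_one 0

theorem IsLift.of_homotopic (hΓ : Γ.NoIsolated) {α β : Γ.Loop} (hαβ : α.Homotopic β)
    {a : ℝ → Γ.Cover} {g : FreeGroup E} (h : IsLift α a g) :
    ∃ b, IsLift β b g ∧ Joined (a 0) (b 0) := by
  obtain ⟨H⟩ := hαβ
  have hp : Continuous fun t : ℝ => (t : UnitAddCircle) := AddCircle.continuous_mk' 1
  let H' : C(unitInterval × ℝ, Γ.Realization) :=
    ⟨fun p => H (p.1, (p.2 : UnitAddCircle)),
      H.continuous.comp (continuous_fst.prodMk (hp.comp continuous_snd))⟩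
  have hH0 : ∀ t, H' (0, t) = Γ.proj (a t) := fun t => by
    rw [h.proj_eq]
    exact H.apply_zero _
  set L := (isCoveringMap_proj hΓ).liftHomotopy H' ⟨a, h.continuous⟩ hH0 with hL
  have hL1 : ∀ p, Γ.proj (L p) = H' p := fun p =>
    congrFun ((isCoveringMap_proj hΓ).liftHomotopy_lifts H' ⟨a, h.continuous⟩ hH0) p
  have hL0 : ∀ t, L (0, t) = a t := (isCoveringMap_proj hΓ).liftHomotopy_zero H' _ hH0
  -- Both sides lift the same homotopy on a connected space and agree at one point, so the
  -- equivariance by `g` persists through the homotopy.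
  have hLg : (fun p : unitInterval × ℝ => L (p.1, p.2 + 1)) = fun p => g • L p := by
    refine lift_unique hΓ (by fun_prop) (L.continuous.const_smul g) (fun p => ?_) (0, 0) ?_
    · rw [proj_smul, hL1, hL1]
      exact congrArg (fun z => H (p.1, z)) (by simp)
    · rw [hL0, hL0, h.add_one]
  refine ⟨fun t => L (1, t), ⟨by fun_prop, fun t => ?_, fun t => congrFun hLg (1, t)⟩, ?_⟩
  · rw [hL1]
    exact H.apply_one _
  · rw [← hL0]
    exact (PathConnectedSpace.joined (0 : unitInterval) 1).map (f := fun s => L (s, 0))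
      (by fun_prop)

/-- As a map into a path space, a homotopy can be checked on the pieces of the quotient `X`, without
describing the topology of `X × [0,1]`. -/
theorem homotopic_of_continuous_curry {X Y : Type*} [TopologicalSpace X] [TopologicalSpace Y]
    {K : X → C(unitInterval, Y)} (hK : Continuous K) {f f' : C(X, Y)} (h0 : ∀ x, K x 0 = f x)
    (h1 : ∀ x, K x 1 = f' x) : f.Homotopic f' :=
  ⟨{ toFun := fun p => K p.2 p.1
     continuous_toFun := (ContinuousMap.continuous_uncurry_of_continuous ⟨K, hK⟩).comp
       continuous_swap
     map_zero_left := h0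
     map_one_left := h1 }⟩

end Multigraph

/-! ### Free homotopy of loops in terms of the deck group. -/

namespace MetricGraph

open Multigraph

variable {V : Type u} {E : Type v} [Fintype E] {G : MetricGraph V E}

/-- Moving along the geodesics from `a t` to `b t` is equivariant under `g`, so it descends to a
homotopy on the circle. -/
theorem homotopic_of_isLift (hG : G.NoIsolated) {α β : G.Loop} {a b : ℝ → G.Cover}
    {g : FreeGroup E} (ha : IsLift α a g) (hb : IsLift β b g) (hab : Joined (a 0) (b 0)) :
    α.Homotopic β := by
  have hj : ∀ t, Joined (a t) (b t) := fun t =>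
    (ha.joined t 0).trans (hab.trans (hb.joined 0 t))
  let F : C(ℝ × unitInterval, G.Realization) :=
    ⟨fun p => G.proj (G.geodesicPoint (a p.1) (b p.1) p.2), G.continuous_proj.comp
      (continuous_geodesicPoint hG (ha.continuous.comp continuous_fst)
        (hb.continuous.comp continuous_fst) continuous_snd fun p => hj p.1)⟩
  have hF : Function.Periodic F.curry 1 := fun t => by
    ext s
    change G.proj (G.geodesicPoint (a (t + 1)) (b (t + 1)) s) = G.proj (G.geodesicPoint (a t) (b t) s)
    rw [ha.add_one, hb.add_one, smul_geodesicPoint hG g (hj t), proj_smul]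
  have hK : Continuous hF.lift := continuous_quot_lift _ F.curry.continuous
  refine homotopic_of_continuous_curry hK (fun x => ?_) fun x => ?_
  · induction x using QuotientAddGroup.induction_on with | H t
    change G.proj (G.geodesicPoint (a t) (b t) 0) = _
    rw [geodesicPoint_zero hG (hj t), ha.proj_eq]
  · induction x using QuotientAddGroup.induction_on with | H t
    change G.proj (G.geodesicPoint (a t) (b t) 1) = _
    rw [geodesicPoint_one hG (hj t), hb.proj_eq]

theorem nullhomotopic_iff (hG : G.NoIsolated) {α : G.Loop} {a : ℝ → G.Cover} {g : FreeGroup E}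
    (ha : IsLift α a g) : α.Nullhomotopic ↔ g = 1 := by
  constructor
  · rintro ⟨y, hy⟩
    obtain ⟨b, hb, -⟩ := ha.of_homotopic hG hy
    have hc := lift_unique hG hb.continuous (continuous_const (y := b 0)) (fun t => by
      rw [hb.proj_eq, hb.proj_eq]
      rfl) 0 rfl
    refine smul_left_cancel hG (x := b 0) ?_
    rw [← hb.add_one, one_smul, congrFun hc (0 + 1)]
  · rintro rfl
    refine ⟨G.proj (a 0), homotopic_of_isLift hG ha (b := fun _ => a 0)
      ⟨continuous_const, fun _ => rfl, fun t => (one_smul _ _).symm⟩ (.refl _)⟩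

end MetricGraph

namespace Multigraph

variable {V : Type u} {E : Type v} {Γ : Multigraph V E}

/-! ### Loops running through a closed edge path -/

theorem exists_traverses {m : ℕ} {w : Fin (m + 1) → Dart E} (hw : Γ.IsClosedEdgePath w) :
    ∃ α, Γ.Traverses α w := by
  have hm : ((m : ℤ) + 1) ≠ 0 := by positivity
  let c : ℤ → Fin (m + 1) := fun k => ⟨(k % (m + 1)).toNat, by
    have := Int.emod_nonneg k hm
    have := Int.emod_lt_of_pos k (show (0 : ℤ) < m + 1 by positivity)
    omega⟩
  have hc : ∀ k, c (k + 1) = c k + 1 := by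
    intro k
    have h1 : (k + 1) % (m + 1) = (((c k : ℕ) + 1) % (m + 1) : ℕ) := by
      rw [← Int.emod_add_emod]
      have : k % (m + 1) = (c k : ℕ) := (Int.toNat_of_nonneg (Int.emod_nonneg k hm)).symm
      rw [this]
      push_cast
      rfl
    ext
    change ((k + 1) % (m + 1)).toNat = _
    rw [h1, Int.toNat_natCast, Fin.val_add, Fin.val_one', Nat.add_mod_mod]
  have hcp : ∀ k, c (k + (m + 1)) = c k := fun k => by simp [c]
  let f : ℝ → Γ.Realization := fun s => Γ.dart (w (c ⌊s⌋)) (Set.projIcc 0 1 zero_le_one (s - ⌊s⌋))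
  -- The formula for one edge stays valid at the right end of the closed interval because
  -- consecutive edges share a vertex; continuity then follows from the locally finite closed cover.
  have hf : ∀ (k : ℤ) (s : ℝ), s ∈ Set.Icc (k : ℝ) (k + 1) →
      f s = Γ.dart (w (c k)) (Set.projIcc 0 1 zero_le_one (s - k)) := by
    intro k s hs
    rcases hs.2.eq_or_lt with rfl | hlt
    · have h1 : ⌊(k : ℝ) + 1⌋ = k + 1 := by
        rw [← Int.cast_one, ← Int.cast_add, Int.floor_intCast]
      simp only [f, h1, hc]
      push_cast
      rw [sub_self, add_sub_cancel_left, Set.projIcc_left, Set.projIcc_right]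
      change Γ.dart _ 0 = Γ.dart _ 1
      rw [dart_zero, dart_one, hw]
    · have h1 : ⌊s⌋ = k := Int.floor_eq_iff.2 ⟨hs.1, hlt⟩
      simp only [f, h1]
  have hcont : Continuous f := by
    have hlf : LocallyFinite fun k : ℤ => Set.Icc (k : ℝ) (k + 1) := by
      intro x
      refine ⟨Set.Ioo (x - 1) (x + 1), Ioo_mem_nhds (by linarith) (by linarith),
        (Set.finite_Icc ⌊x - 2⌋ ⌈x + 1⌉).subset ?_⟩
      rintro k ⟨y, ⟨h1, h2⟩, h3, h4⟩
      exact ⟨Int.cast_le.1 ((Int.floor_le (x - 2)).trans (by linarith)),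
        Int.cast_le.1 (le_trans (by linarith) (Int.le_ceil (x + 1)))⟩
    refine hlf.continuous (Set.eq_univ_of_forall fun s => Set.mem_iUnion.2
      ⟨⌊s⌋, Int.floor_le s, (Int.lt_floor_add_one s).le⟩) (fun k => isClosed_Icc) fun k => ?_
    refine ContinuousOn.congr (f := fun s : ℝ => Γ.dart (w (c k))
      (Set.projIcc 0 1 zero_le_one (s - k))) ?_ fun s hs => hf k s hs
    exact ((Γ.continuous_dart _).comp (continuous_projIcc.comp (by fun_prop))).continuousOn
  have hfp : ∀ s : ℝ, f (s + ((m + 1 : ℤ) : ℝ)) = f s := by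
    intro s
    have h1 : ⌊s + ((m + 1 : ℤ) : ℝ)⌋ = ⌊s⌋ + (m + 1) := Int.floor_add_intCast _ _
    have h2 : s + ((m + 1 : ℤ) : ℝ) - ((⌊s⌋ + (m + 1) : ℤ) : ℝ) = s - ⌊s⌋ := by push_cast; ring
    simp only [f]
    rw [h1, h2, hcp]
  have hper : Function.Periodic (fun t : ℝ => f ((m + 1) * t)) 1 := by
    intro t
    have : ((m : ℝ) + 1) * (t + 1) = (m + 1) * t + ((m + 1 : ℤ) : ℝ) := by push_cast; ring
    simp only [this]
    exact hfp _
  refine ⟨⟨hper.lift, continuous_quot_lift _ (by fun_prop)⟩, fun i t => ?_⟩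
  change f ((m + 1) * (((i : ℕ) + (t : ℝ)) / (m + 1))) = _
  rw [mul_div_cancel₀ _ (by positivity), hf (i : ℕ) _ ⟨by simp [t.2.1], by simp [t.2.2]⟩]
  have hci : c (i : ℕ) = i := by
    ext
    simp only [c]
    rw [Int.emod_eq_of_lt (by positivity) (by have := i.2; omega)]
    simp
  rw [hci]
  simp

end Multigraph

namespace Multigraph

variable {V : Type u} {E : Type v} {Γ : Multigraph V E}
  {V' : Type*} {E' : Type*} {Γ' : Multigraph V' E'}

/-! ### Lifting a map between graphs to the covering forests -/

/-- Lifts `x v` of the images of the vertices and `γ e` of the images of the edges under `φ`; the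
path `γ e` runs from `x (src e)` to `k e • x (tgt e)`. -/
structure LiftData (φ : C(Γ.Realization, Γ'.Realization)) (x : V → Γ'.Cover)
    (k : E → FreeGroup E') (γ : E → unitInterval → Γ'.Cover) : Prop where
  continuous : ∀ e, Continuous (γ e)
  proj_eq : ∀ e t, Γ'.proj (γ e t) = φ (Γ.edge e t)
  zero : ∀ e, γ e 0 = x (Γ.src e)
  one : ∀ e, γ e 1 = k e • x (Γ.tgt e)

/-- The label of an oriented edge. -/
def dartLabel (k : E → FreeGroup E') (d : Dart E) : FreeGroup E' :=
  if d.2 then k d.1 else (k d.1)⁻¹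

theorem dartLabel_rev (k : E → FreeGroup E') (d : Dart E) :
    dartLabel k (rev d) = (dartLabel k d)⁻¹ := by
  rcases d with ⟨e, _ | _⟩ <;> simp [dartLabel, rev]

theorem dartLabel_of (d : Dart E) : dartLabel FreeGroup.of d = letter d := by
  rcases d with ⟨e, _ | _⟩ <;> rfl

/-- The lift of an oriented edge. -/
def dartLift (k : E → FreeGroup E') (γ : E → unitInterval → Γ'.Cover) (d : Dart E)
    (t : unitInterval) : Γ'.Cover :=
  if d.2 then γ d.1 t else (k d.1)⁻¹ • γ d.1 (unitInterval.symm t)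

variable (Γ) in
/-- The end of the lift of an oriented edge. -/
def tip (x : V → Γ'.Cover) (k : E → FreeGroup E') (d : Dart E) : Γ'.Cover :=
  dartLabel k d • x (Γ.term d)

namespace LiftData

variable {φ : C(Γ.Realization, Γ'.Realization)} {x : V → Γ'.Cover} {k : E → FreeGroup E'}
  {γ : E → unitInterval → Γ'.Cover} (h : LiftData φ x k γ)

include h

theorem continuous_dartLift (d : Dart E) : Continuous (dartLift k γ d) := by
  rcases d with ⟨e, _ | _⟩
  · exact ((h.continuous e).comp unitInterval.continuous_symm).const_smul (k e)⁻¹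
  · exact h.continuous e

theorem proj_dartLift (d : Dart E) (t : unitInterval) :
    Γ'.proj (dartLift k γ d t) = φ (Γ.dart d t) := by
  rcases d with ⟨e, _ | _⟩
  · simp [dartLift, dart, h.proj_eq]
  · simp [dartLift, dart, h.proj_eq]

theorem dartLift_zero (d : Dart E) : dartLift k γ d 0 = x (Γ.init d) := by
  rcases d with ⟨e, _ | _⟩
  · simp [dartLift, init, h.one]
  · simp [dartLift, init, h.zero]

theorem dartLift_one (d : Dart E) : dartLift k γ d 1 = Γ.tip x k d := by
  rcases d with ⟨e, _ | _⟩
  · simp [dartLift, init, h.zero, tip, dartLabel, term, rev]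
  · simp [dartLift, init, h.one, tip, dartLabel, term, rev]

end LiftData

/-- The product of the labels of the first `i` edges of the periodic extension of `w`. -/
def prefixLabel (k : E → FreeGroup E') {m : ℕ} (w : Fin (m + 1) → Dart E) : ℕ → FreeGroup E'
  | 0 => 1
  | i + 1 => prefixLabel k w i * dartLabel k (w (Fin.ofNat (m + 1) i))

theorem ofNat_succ (m i : ℕ) : Fin.ofNat (m + 1) (i + 1) = Fin.ofNat (m + 1) i + 1 := by
  ext
  simp [Fin.val_add]

theorem ofNat_add (m i : ℕ) : Fin.ofNat (m + 1) (i + (m + 1)) = Fin.ofNat (m + 1) i := by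
  ext
  simp

theorem ofNat_val {m : ℕ} (i : Fin (m + 1)) : Fin.ofNat (m + 1) i = i := by
  ext
  simp

theorem prefixLabel_add (k : E → FreeGroup E') {m : ℕ} (w : Fin (m + 1) → Dart E) (i : ℕ) :
    prefixLabel k w (i + (m + 1)) = prefixLabel k w (m + 1) * prefixLabel k w i := by
  induction i with
  | zero => simp [prefixLabel]
  | succ i ih =>
    rw [add_right_comm, prefixLabel, ih, ofNat_add, mul_assoc]
    rfl

variable (Γ) in
/-- The lifts of the images of the vertices along the periodic extension of `w`. -/
def vertexSeq (x : V → Γ'.Cover) (k : E → FreeGroup E') {m : ℕ} (w : Fin (m + 1) → Dart E)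
    (i : ℕ) : Γ'.Cover :=
  prefixLabel k w i • x (Γ.init (w (Fin.ofNat (m + 1) i)))

variable {m : ℕ} {w : Fin (m + 1) → Dart E} (x : V → Γ'.Cover) (k : E → FreeGroup E')

theorem vertexSeq_add (i : ℕ) :
    Γ.vertexSeq x k w (i + (m + 1)) = prefixLabel k w (m + 1) • Γ.vertexSeq x k w i := by
  rw [vertexSeq, prefixLabel_add, ofNat_add, mul_smul]
  rfl

theorem vertexSeq_period :
    Γ.vertexSeq x k w (m + 1) = prefixLabel k w (m + 1) • Γ.vertexSeq x k w 0 := by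
  have := vertexSeq_add (Γ := Γ) (w := w) x k 0
  rwa [zero_add] at this

theorem vertexSeq_succ (hw : Γ.IsClosedEdgePath w) (i : ℕ) : Γ.vertexSeq x k w (i + 1) =
    prefixLabel k w i • Γ.tip x k (w (Fin.ofNat (m + 1) i)) := by
  rw [vertexSeq, tip, ofNat_succ, ← hw, ← mul_smul]
  rfl

/-- Together with `vertexSeq_succ` this exhibits the points `i` and `i + 2` as one translate of the
two tips seen from the vertex between them, so the turn there depends only on `rev (w i)` and `w (i
+ 1)`. -/
theorem vertexSeq_eq_tip_rev (i : ℕ) : Γ.vertexSeq x k w i =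
    prefixLabel k w (i + 1) • Γ.tip x k (rev (w (Fin.ofNat (m + 1) i))) := by
  rw [vertexSeq, tip, dartLabel_rev, term_rev, ← mul_smul, prefixLabel, mul_inv_cancel_right]

variable {x k}

theorem LiftData.exists_isLift (hΓ' : Γ'.NoIsolated) {φ : C(Γ.Realization, Γ'.Realization)}
    {γ : E → unitInterval → Γ'.Cover} (h : LiftData φ x k γ) (hw : Γ.IsClosedEdgePath w)
    {α : Γ.Loop} (hα : Γ.Traverses α w) :
    ∃ a, IsLift (φ.comp α) a (prefixLabel k w (m + 1)) ∧ a 0 = Γ.vertexSeq x k w 0 := by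
  have hm : (0 : ℝ) < m + 1 := by positivity
  have hstart : Γ'.proj (Γ.vertexSeq x k w 0) = (φ.comp α) 0 := by
    have h1 := hα 0 0
    have h2 := h.proj_dartLift (w 0) 0
    rw [h.dartLift_zero] at h2
    rw [vertexSeq, proj_smul, show Fin.ofNat (m + 1) 0 = 0 from rfl, h2, ← h1]
    simp
  obtain ⟨a, g, ha, ha0⟩ := Multigraph.exists_isLift hΓ' (φ.comp α) hstart
  refine ⟨a, ?_, ha0⟩
  -- The lift passes through the `i`-th point of `vertexSeq` at time `i / (m + 1)`, by uniqueness of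
  -- lifts along one edge at a time.
  have key : ∀ i : ℕ, i ≤ m + 1 → a (i / (m + 1)) = Γ.vertexSeq x k w i := by
    intro i
    induction i with
    | zero => simp [ha0]
    | succ i ih =>
      intro hi
      have hi' : Fin.ofNat (m + 1) i = ⟨i, hi⟩ := by
        ext
        exact Nat.mod_eq_of_lt hi
      have heq := lift_unique hΓ' (A := unitInterval)
        (f := fun t => a ((i + (t : ℝ)) / (m + 1)))
        (f' := fun t => prefixLabel k w i • dartLift k γ (w (Fin.ofNat (m + 1) i)) t)
        (ha.continuous.comp (by fun_prop)) ((h.continuous_dartLift (w (Fin.ofNat (m + 1) i))).const_smul (prefixLabel k w i))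
        (fun t => by
          rw [ha.proj_eq, proj_smul, h.proj_dartLift, hi', ← hα]
          rfl) 0 (by
          simp only [Set.Icc.coe_zero, add_zero]
          rw [ih (by omega), h.dartLift_zero]
          rfl)
      have := congrFun heq 1
      simp only [Set.Icc.coe_one] at this
      rw [h.dartLift_one, ← vertexSeq_succ x k hw] at this
      push_cast
      exact this
  have h1 := key (m + 1) le_rfl
  push_cast at h1
  rw [div_self hm.ne'] at h1
  have h2 := vertexSeq_period (Γ := Γ) (w := w) x k
  exact IsLift.of_apply_one hΓ' ha.continuous ha.proj_eq (by rw [h1, h2, ha0])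

end Multigraph

/-! ### Lengths and turns along the image of a closed edge path. -/

namespace MetricGraph

open Multigraph

variable {V : Type u} {E : Type v} {Γ : Multigraph V E}
  {V' : Type*} {E' : Type*} [Fintype E'] {G' : MetricGraph V' E'} {x : V → G'.Cover}
  {k : E → FreeGroup E'} {m : ℕ} {w : Fin (m + 1) → Dart E}

variable (Γ) in
/-- The length of the image of an edge after straightening. -/
def imageLength (x : V → G'.Cover) (k : E → FreeGroup E') (e : E) : ℝ :=
  G'.treeDist (x (Γ.src e)) (k e • x (Γ.tgt e))

variable (Γ) in
/-- The images of two oriented edges with the same initial vertex leave it in different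
directions. -/
def LegalTurn (x : V → G'.Cover) (k : E → FreeGroup E') (d d' : Dart E) : Prop :=
  G'.treeDist (Γ.tip x k d) (Γ.tip x k d') = imageLength Γ x k d.1 + imageLength Γ x k d'.1

theorem treeDist_init_tip (d : Dart E) :
    G'.treeDist (x (Γ.init d)) (Γ.tip x k d) = imageLength Γ x k d.1 := by
  rcases d with ⟨e, _ | _⟩
  · rw [tip, ← G'.treeDist_smul (k e), G'.isTreeDist.comm]
    simp [dartLabel, term, rev, init, imageLength]
  · rfl

theorem treeDist_vertexSeq_succ (hw : Γ.IsClosedEdgePath w) (i : ℕ) :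
    G'.treeDist (Γ.vertexSeq x k w i) (Γ.vertexSeq x k w (i + 1)) =
      imageLength Γ x k (w (Fin.ofNat (m + 1) i)).1 := by
  rw [vertexSeq_succ x k hw, vertexSeq, treeDist_smul, treeDist_init_tip]

theorem treeDist_vertexSeq_add_two (hw : Γ.IsClosedEdgePath w) (i : ℕ) :
    G'.treeDist (Γ.vertexSeq x k w i) (Γ.vertexSeq x k w (i + 2)) =
      G'.treeDist (Γ.tip x k (rev (w (Fin.ofNat (m + 1) i))))
        (Γ.tip x k (w (Fin.ofNat (m + 1) i + 1))) := by
  rw [show i + 2 = i + 1 + 1 from rfl, vertexSeq_succ x k hw, vertexSeq_eq_tip_rev, treeDist_smul,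
    ofNat_succ]

theorem sum_imageLength_eq (hw : Γ.IsClosedEdgePath w) :
    ∑ j ∈ Finset.range (m + 1),
      G'.treeDist (Γ.vertexSeq x k w j) (Γ.vertexSeq x k w (j + 1)) =
        ∑ i, imageLength Γ x k (w i).1 := by
  rw [Finset.sum_range]
  refine Finset.sum_congr rfl fun i _ => ?_
  rw [treeDist_vertexSeq_succ hw, ofNat_val]

theorem sum_imageLength_eq_two (hw : Γ.IsClosedEdgePath w) :
    ∑ j ∈ Finset.range ((m + 1) + (m + 1)),
      G'.treeDist (Γ.vertexSeq x k w j) (Γ.vertexSeq x k w (j + 1)) =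
        2 * ∑ i, imageLength Γ x k (w i).1 := by
  rw [Finset.sum_range_add, two_mul, ← sum_imageLength_eq hw]
  congr 1
  refine Finset.sum_congr rfl fun j _ => ?_
  rw [treeDist_vertexSeq_succ hw, treeDist_vertexSeq_succ hw, Nat.add_comm _ j, ofNat_add]

theorem treeDist_vertexSeq_le (hw : Γ.IsClosedEdgePath w) :
    G'.treeDist (Γ.vertexSeq x k w 0) (prefixLabel k w (m + 1) • Γ.vertexSeq x k w 0) ≤
      ∑ i, imageLength Γ x k (w i).1 := by
  have := G'.isTreeDist.le_sum (Γ.vertexSeq x k w) 0 (m + 1)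
  simp only [zero_add] at this
  rw [vertexSeq_period] at this
  rwa [sum_imageLength_eq hw] at this

/-- Legal turns make the broken geodesic through `vertexSeq` a geodesic. It covers two periods in
particular, so the deck transformation translates along it and moves no point by less. -/
theorem treeDist_vertexSeq_eq (hw : Γ.IsClosedEdgePath w)
    (hpos : ∀ i, 0 < imageLength Γ x k (w i).1)
    (hturn : ∀ i, LegalTurn Γ x k (rev (w i)) (w (i + 1))) :
    G'.treeDist (Γ.vertexSeq x k w 0) (prefixLabel k w (m + 1) • Γ.vertexSeq x k w 0) =
      ∑ i, imageLength Γ x k (w i).1 ∧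
    ∀ y, ∑ i, imageLength Γ x k (w i).1 ≤ G'.treeDist y (prefixLabel k w (m + 1) • y) := by
  have hs := G'.isTreeDist.sum_of_turns (x := Γ.vertexSeq x k w)
    (fun i => by rw [treeDist_vertexSeq_succ hw]; exact hpos _)
    (fun i => by
      rw [treeDist_vertexSeq_add_two hw, treeDist_vertexSeq_succ hw, treeDist_vertexSeq_succ hw,
        hturn, ofNat_succ]
      rfl)
  have h1 := hs (m + 1)
  rw [sum_imageLength_eq hw, vertexSeq_period] at h1
  have h2 := hs ((m + 1) + (m + 1))
  rw [sum_imageLength_eq_two hw, vertexSeq_add, vertexSeq_period] at h2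
  refine ⟨h1, fun y => ?_⟩
  rw [← h1]
  exact G'.isTreeDist.le_displacement (T := fun z => prefixLabel k w (m + 1) • z)
    (G'.treeDist_smul _) (by rw [h2, h1]) y

theorem legalTurn_of_le_displacement (hw : Γ.IsClosedEdgePath w)
    (hj : Joined (Γ.vertexSeq x k w 0) (prefixLabel k w (m + 1) • Γ.vertexSeq x k w 0))
    (hmin : ∀ y, ∑ i, imageLength Γ x k (w i).1 ≤ G'.treeDist y (prefixLabel k w (m + 1) • y))
    (i : Fin (m + 1)) : LegalTurn Γ x k (rev (w i)) (w (i + 1)) := by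
  have h1 := le_antisymm (treeDist_vertexSeq_le hw) (hmin (Γ.vertexSeq x k w 0))
  have h2 := G'.isTreeDist.axis_of_le_displacement (T := fun z => prefixLabel k w (m + 1) • z)
    (G'.treeDist_smul _) (x := Γ.vertexSeq x k w 0) (fun y => by rw [h1]; exact hmin y)
    (fun s h0 hs => by
      obtain ⟨z, -, hz⟩ := G'.exists_between hj h0 hs
      exact ⟨z, hz⟩)
  -- Two periods are taken so that the turn at the base point, where `i = m`, is an interior turn as
  -- well.
  have h3 : G'.treeDist (Γ.vertexSeq x k w 0) (Γ.vertexSeq x k w ((m + 1) + (m + 1))) =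
      ∑ j ∈ Finset.range ((m + 1) + (m + 1)),
        G'.treeDist (Γ.vertexSeq x k w j) (Γ.vertexSeq x k w (j + 1)) := by
    rw [sum_imageLength_eq_two hw, vertexSeq_add, vertexSeq_period, h2, h1]
  have h4 := G'.isTreeDist.turn_of_eq_sum h3 (i := i) (by have := i.2; omega)
  rw [treeDist_vertexSeq_add_two hw, treeDist_vertexSeq_succ hw, treeDist_vertexSeq_succ hw,
    ofNat_succ, ofNat_val] at h4
  exact h4

end MetricGraph

/-! ### The identity map, and edge paths as words. -/

namespace Multigraph

variable {V : Type u} {E : Type v} {Γ : Multigraph V E}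

/-- With the vertices lifted to sheet `1` and each edge labelled by its generator, the results on
images of closed paths apply to closed paths in the graph itself. -/
theorem liftData_id : LiftData (Γ' := Γ) (ContinuousMap.id Γ.Realization)
    (fun v => Γ.cover.vertex (v, 1)) FreeGroup.of (fun e t => Γ.cover.edge (e, 1) t) where
  continuous e := Γ.cover.continuous_edge (e, 1)
  proj_eq _ _ := rfl
  zero e := Γ.cover.edge_zero (e, 1)
  one e := by simp [edge_one, cover_tgt]

theorem joined_vertex_term (d : Dart E) (g : FreeGroup E) :
    Joined (Γ.cover.vertex (Γ.init d, g)) (Γ.cover.vertex (Γ.term d, g * letter d)) := by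
  have key : ∀ e (g : FreeGroup E), Joined (Γ.cover.vertex (Γ.src e, g))
      (Γ.cover.vertex (Γ.tgt e, g * FreeGroup.of e)) := fun e g => by
    have := joined_edge (Γ := Γ.cover) (e, g) 0 1
    rwa [edge_zero, edge_one, cover_src, cover_tgt] at this
  rcases d with ⟨e, _ | _⟩
  · have := (key e (g * (FreeGroup.of e)⁻¹)).symm
    rwa [inv_mul_cancel_right] at this
  · exact key e g

theorem foxIndex_one_injective {d d' : Dart E} (h : foxIndex 1 d = foxIndex 1 d') : d = d' := by
  rcases d with ⟨e, _ | _⟩ <;> rcases d' with ⟨e', _ | _⟩ <;>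
    simp only [foxIndex, if_true, Bool.false_eq_true, if_false, one_mul, Prod.mk.injEq,
      letter_false] at h
  · rw [h.1]
  · obtain ⟨rfl, h⟩ := h
    exact (FreeGroup.of_ne_one e (inv_eq_one.1 h)).elim
  · obtain ⟨rfl, h⟩ := h
    exact (FreeGroup.of_ne_one e (inv_eq_one.1 h.symm)).elim
  · rw [h.1]

theorem IsWalk.init_head {x y : V} {d : Dart E} {L : List (Dart E)} (h : Γ.IsWalk x (d :: L) y) :
    Γ.init d = x := h.1

theorem IsWalk.term_getElem {x y : V} {L : List (Dart E)} (h : Γ.IsWalk x L y) {i : ℕ}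
    (hi : i + 1 < L.length) : Γ.term L[i] = Γ.init L[i + 1] := by
  induction L generalizing x i with
  | nil => simp at hi
  | cons d L ih =>
    cases i with
    | zero =>
      cases L with
      | nil => simp at hi
      | cons d' L => exact h.2.1.symm
    | succ i => exact ih h.2 (by simpa using hi)

theorem IsWalk.term_getLast {x y : V} {L : List (Dart E)} (h : Γ.IsWalk x L y) (hL : L ≠ []) :
    Γ.term (L.getLast hL) = y := by
  induction L generalizing x with
  | nil => exact (hL rfl).elim
  | cons d L ih =>
    cases L with
    | nil => exact h.2
    | cons d' L => exact ih h.2 (by simp)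

theorem prefixLabel_of {m : ℕ} {w : Fin (m + 1) → Dart E} {i : ℕ} (hi : i ≤ m + 1) :
    prefixLabel FreeGroup.of w i = FreeGroup.mk ((List.ofFn w).take i) := by
  induction i with
  | zero => rfl
  | succ i ih =>
    have hi' : Fin.ofNat (m + 1) i = ⟨i, hi⟩ := by
      ext
      exact Nat.mod_eq_of_lt hi
    rw [prefixLabel, ih (by omega), dartLabel_of, hi', FreeGroup.mul_mk,
      List.take_add_one, List.getElem?_ofFn]
    simp [Nat.lt_of_succ_le hi]

end Multigraph

namespace MetricGraph

open Multigraph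

variable {V : Type u} {E : Type v} [Fintype E] {G : MetricGraph V E}

/-! ### The length of a loop -/

theorem tip_id (d : Dart E) :
    G.tip (fun v => G.cover.vertex (v, 1)) FreeGroup.of d =
      G.cover.vertex (G.term d, letter d) := by
  rw [tip, dartLabel_of, smul_vertex, mul_one]

theorem dev_tip_id (d : Dart E) : G.dev (G.tip (fun v => G.cover.vertex (v, 1)) FreeGroup.of d) =
    Finsupp.single (foxIndex 1 d) (dartSign d) := by
  rw [tip_id, dev_vertex, fox_mk, foxWord, foxWord, add_zero]

theorem abs_dartSign (d : Dart E) : |dartSign d| = 1 := by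
  rcases dartSign_eq_or d with h | h <;> simp [h]

theorem foxIndex_fst (g : FreeGroup E) (d : Dart E) : (foxIndex g d).1 = d.1 := by
  rcases d with ⟨e, _ | _⟩ <;> rfl

theorem imageLength_id (e : E) :
    imageLength G.toMultigraph (G' := G) (fun v => G.cover.vertex (v, 1)) FreeGroup.of e =
      G.len e := by
  have : FreeGroup.of e • G.cover.vertex (G.tgt e, 1) =
    G.tip (fun v => G.cover.vertex (v, 1)) FreeGroup.of (e, true) := rfl
  rw [imageLength, this, treeDist, dev_tip_id, dev_vertex, fox_one, zero_sub, weightedNorm_neg,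
    weightedNorm_single, abs_dartSign, mul_one]
  rfl

/-- Different oriented edges issuing from the base vertex of the Cayley tree have different
coordinates, so for the identity map only backtracking is illegal. -/
theorem legalTurn_id {d d' : Dart E} (h : d ≠ d') :
    LegalTurn G.toMultigraph (G' := G) (fun v => G.cover.vertex (v, 1)) FreeGroup.of d d' := by
  rw [LegalTurn, treeDist, dev_tip_id, dev_tip_id,
    weightedNorm_single_sub_single (fun he => h (foxIndex_one_injective he)), imageLength_id,
    imageLength_id, abs_dartSign, abs_dartSign, foxIndex_fst, foxIndex_fst, mul_one, mul_one]

theorem traverses_isLift (hG : G.NoIsolated) {β : G.Loop} {m : ℕ} {w : Fin (m + 1) → Dart E}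
    (hw : G.IsClosedEdgePath w) (hβ : G.Traverses β w) :
    ∃ b, IsLift β b (FreeGroup.mk (List.ofFn w)) ∧ b 0 = G.cover.vertex (G.init (w 0), 1) := by
  obtain ⟨b, hb, hb0⟩ := liftData_id.exists_isLift hG hw hβ
  rw [prefixLabel_of le_rfl, List.take_of_length_le (by simp)] at hb
  refine ⟨b, hb, hb0.trans ?_⟩
  rw [vertexSeq, prefixLabel, one_smul]
  rfl

theorem traverses_displacement {m : ℕ} {w : Fin (m + 1) → Dart E}
    (hw : G.IsClosedEdgePath w) (hturn : ∀ i, w (i + 1) ≠ rev (w i)) :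
    G.treeDist (G.cover.vertex (G.init (w 0), 1))
      (FreeGroup.mk (List.ofFn w) • G.cover.vertex (G.init (w 0), 1)) = ∑ i, G.len (w i).1 ∧
    ∀ y, ∑ i, G.len (w i).1 ≤ G.treeDist y (FreeGroup.mk (List.ofFn w) • y) := by
  have := treeDist_vertexSeq_eq (G' := G) (x := fun v => G.cover.vertex (v, 1))
    (k := FreeGroup.of) hw (fun i => by rw [imageLength_id]; exact G.len_pos _)
    (fun i => legalTurn_id (hturn i).symm)
  rw [prefixLabel_of le_rfl, List.take_of_length_le (by simp), vertexSeq, prefixLabel,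
    one_smul] at this
  simp only [imageLength_id] at this
  exact this

theorem IsImmersedOfLength.pos {β : G.Loop} {L : ℝ} (h : G.IsImmersedOfLength β L) : 0 < L := by
  obtain ⟨m, w, -, -, -, rfl⟩ := h
  exact Finset.sum_pos (fun i _ => G.len_pos _) ⟨0, Finset.mem_univ _⟩

/-- The length of an immersed loop is a translation length, an invariant of the conjugacy class; so
it is the same for all immersed loops in a free homotopy class. -/
theorem IsImmersedOfLength.isLeast (hG : G.NoIsolated) {α β : G.Loop} {L : ℝ}
    (h : G.IsImmersedOfLength β L) (hαβ : α.Homotopic β) {a : ℝ → G.Cover} {g : FreeGroup E}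
    (ha : IsLift α a g) : IsLeast (Set.range fun y => G.treeDist y (g • y)) L := by
  obtain ⟨m, w, hw, hturn, hβ, rfl⟩ := h
  obtain ⟨b, hb, hb0⟩ := traverses_isLift hG hw hβ
  obtain ⟨b', hb', -⟩ := ha.of_homotopic hG hαβ
  obtain ⟨c, -, rfl⟩ := hb'.exists_conj hG hb
  obtain ⟨h1, h2⟩ := traverses_displacement hw hturn
  constructor
  · refine ⟨c • G.cover.vertex (G.init (w 0), 1), ?_⟩
    simp only [mul_smul, inv_smul_smul, treeDist_smul]
    exact h1
  · rintro _ ⟨y, rfl⟩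
    have h3 := h2 (c⁻¹ • y)
    rwa [← G.treeDist_smul c, smul_inv_smul, ← mul_smul, ← mul_smul] at h3

/-- Among the vertices of the component that contains the lift, choose one at which the conjugate of
`g` has the shortest reduced word. That word is a closed walk, and minimality makes it cyclically
reduced. -/
theorem exists_isImmersedOfLength (hG : G.NoIsolated) {α : G.Loop} (hα : ¬ α.Nullhomotopic) :
    ∃ β L, α.Homotopic β ∧ G.IsImmersedOfLength β L := by
  classical
  obtain ⟨a, g, ha⟩ := exists_isLift' hG α
  have hg : g ≠ 1 := fun h => hα ((nullhomotopic_iff hG ha).2 h)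
  obtain ⟨v₀, hv₀⟩ : ∃ v, Joined (G.cover.vertex v) (a 0) := by
    obtain ⟨e, t, he⟩ := hG.cover.exists_edge_eq (a 0)
    rw [← he]
    exact ⟨_, by rw [← edge_zero]; exact joined_edge e 0 t⟩
  let P : ℕ → Prop := fun n => ∃ v : V × FreeGroup E, Joined (G.cover.vertex v) (a 0) ∧
    (v.2⁻¹ * g * v.2).toWord.length = n
  have hP : ∃ n, P n := ⟨_, v₀, hv₀, rfl⟩
  obtain ⟨⟨v, h⟩, hv, hlen⟩ := Nat.find_spec hP
  dsimp only at hlen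
  have hmin : ∀ d : Dart E, G.init d = v →
      (h⁻¹ * g * h).toWord.length ≤ ((h * letter d)⁻¹ * g * (h * letter d)).toWord.length := by
    intro d hd
    rw [hlen]
    refine Nat.find_min' hP ⟨(G.term d, h * letter d), ?_, rfl⟩
    have := joined_vertex_term (Γ := G.toMultigraph) d h
    rw [hd] at this
    exact this.symm.trans hv
  have hwalk : G.IsWalk v (h⁻¹ * g * h).toWord v := by
    have h1 : Joined (G.cover.vertex (v, h)) (g • G.cover.vertex (v, h)) :=
      hv.trans ((by
        have := ha.joined 0 (0 + 1)
        rwa [ha.add_one] at this : Joined (a 0) (g • a 0)).trans (joined_smul g hv).symm)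
    have := isWalk_of_joined_vertex h1
    rwa [← mul_assoc] at this
  set W := (h⁻¹ * g * h).toWord with hW
  have hWred : FreeGroup.IsReduced W := FreeGroup.isReduced_toWord
  have hWmk : FreeGroup.mk W = h⁻¹ * g * h := FreeGroup.mk_toWord
  have hWne : W ≠ [] := by
    rw [Ne, hW, FreeGroup.toWord_eq_nil_iff]
    intro h1
    exact hg (by simpa [mul_assoc, inv_mul_eq_one, eq_comm] using h1)
  -- If the first letter were inverse to the last, moving the vertex along the first edge would
  -- conjugate the word to `K`, shorter by two letters.
  have hcyc : ∀ d K d', W = d :: K ++ [d'] → d ≠ rev d' := by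
    rintro d K d' hWd rfl
    have hd := hwalk
    rw [hWd] at hd
    have h1 := hmin (rev d') hd.init_head
    have h2 : (h * letter (rev d'))⁻¹ * g * (h * letter (rev d')) = FreeGroup.mk K := by
      have h3 : FreeGroup.mk W = letter (rev d') * FreeGroup.mk K * letter d' := by
        rw [hWd, FreeGroup.mul_mk, FreeGroup.mul_mk]
        rfl
      rw [mul_inv_rev, mul_assoc, mul_assoc, ← mul_assoc g, ← mul_assoc h⁻¹, ← mul_assoc h⁻¹,
        ← hWmk, h3, letter_rev]
      group
    rw [h2, hWd] at h1
    have h4 := (FreeGroup.norm_mk_le (L₁ := K))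
    rw [FreeGroup.norm] at h4
    simp only [List.length_append, List.length_cons, List.length_nil] at h1
    omega
  obtain ⟨m, hm⟩ : ∃ m, W.length = m + 1 :=
    Nat.exists_eq_succ_of_ne_zero (by simpa using hWne)
  let w : Fin (m + 1) → Dart E := fun i => W[(i : ℕ)]
  have hwW : List.ofFn w = W := by
    refine List.ext_getElem (by simp [hm]) fun i h1 h2 => ?_
    rw [List.getElem_ofFn]
  have hlast : W.getLast hWne = w (Fin.last m) := by
    simp [w, List.getLast_eq_getElem, hm]
  have hval : ∀ i : Fin (m + 1), i ≠ Fin.last m → ((i + 1 : Fin (m + 1)) : ℕ) = i + 1 := fun i hi =>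
    Fin.val_add_one_of_lt (Fin.lt_last_iff_ne_last.2 hi)
  have hwclosed : G.IsClosedEdgePath w := by
    intro i
    by_cases hi : i = Fin.last m
    · subst hi
      rw [Fin.last_add_one, ← hlast, hwalk.term_getLast hWne]
      obtain ⟨d, K, hWd⟩ := List.exists_cons_of_ne_nil hWne
      rw [hWd] at hwalk
      rw [← hwalk.init_head]
      simp [w, hWd]
    · simp only [w, hval i hi]
      exact hwalk.term_getElem _
  have hturn : ∀ i, w (i + 1) ≠ rev (w i) := by
    intro i
    by_cases hi : i = Fin.last m
    · subst hi
      rw [Fin.last_add_one, ← hlast]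
      obtain ⟨d, K, hWd⟩ := List.exists_cons_of_ne_nil hWne
      have h0 : w 0 = d := by simp [w, hWd]
      rw [h0]
      rcases K.eq_nil_or_concat with rfl | ⟨K, d', rfl⟩
      · simp only [hWd, List.getLast_singleton]
        exact (rev_ne d).symm
      · rw [List.concat_eq_append] at hWd
        simp only [hWd]
        rw [List.getLast_cons (by simp), List.getLast_append_singleton]
        exact hcyc d K d' (by rw [hWd]; rfl)
    · rw [← isReduced_pair_iff]
      simp only [w, hval i hi]
      have := List.isChain_iff_getElem.1 hWred i (by
        have := Fin.lt_last_iff_ne_last.2 hi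
        rw [Fin.lt_def, Fin.val_last] at this
        omega)
      exact this
  obtain ⟨β, hβ⟩ := exists_traverses hwclosed
  refine ⟨β, _, ?_, m, w, hwclosed, hturn, hβ, rfl⟩
  obtain ⟨b, hb, hb0⟩ := traverses_isLift hG hwclosed hβ
  rw [hwW, hWmk] at hb
  have hb' := hb.smul h
  rw [show h * (h⁻¹ * g * h) * h⁻¹ = g by group] at hb'
  refine homotopic_of_isLift hG ha hb' ?_
  have h0 : G.init (w 0) = v := by
    obtain ⟨d, K, hWd⟩ := List.exists_cons_of_ne_nil hWne
    rw [hWd] at hwalk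
    rw [← hwalk.init_head]
    simp [w, hWd]
  rw [hb0, h0, smul_vertex, mul_one]
  exact hv.symm

theorem exists_isImmersedOfLength_loopLength (hG : G.NoIsolated) {α : G.Loop}
    (hα : ¬ α.Nullhomotopic) :
    ∃ β, α.Homotopic β ∧ G.IsImmersedOfLength β (G.loopLength α) := by
  obtain ⟨a, g, ha⟩ := exists_isLift' hG α
  obtain ⟨β, L, hβ, hL⟩ := exists_isImmersedOfLength hG hα
  refine ⟨β, hβ, ?_⟩
  have : {L | ∃ β : G.Loop, α.Homotopic β ∧ G.IsImmersedOfLength β L} = {L} := by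
    ext L'
    refine ⟨fun ⟨β', h1, h2⟩ => ?_, ?_⟩
    · exact (h2.isLeast hG h1 ha).unique (hL.isLeast hG hβ ha)
    · rintro rfl
      exact ⟨β, hβ, hL⟩
  rwa [loopLength, if_neg hα, this, csInf_singleton]

theorem isLeast_loopLength (hG : G.NoIsolated) {α : G.Loop} (hα : ¬ α.Nullhomotopic)
    {a : ℝ → G.Cover} {g : FreeGroup E} (ha : IsLift α a g) :
    IsLeast (Set.range fun y => G.treeDist y (g • y)) (G.loopLength α) := by
  obtain ⟨β, h1, h2⟩ := exists_isImmersedOfLength_loopLength hG hα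
  exact h2.isLeast hG h1 ha

theorem loopLength_pos (hG : G.NoIsolated) {α : G.Loop} (hα : ¬ α.Nullhomotopic) :
    0 < G.loopLength α := by
  obtain ⟨β, -, h2⟩ := exists_isImmersedOfLength_loopLength hG hα
  exact h2.pos

theorem IsImmersedOfLength.not_nullhomotopic (hG : G.NoIsolated) {β : G.Loop} {L : ℝ}
    (h : G.IsImmersedOfLength β L) : ¬ β.Nullhomotopic := by
  intro hβ
  obtain ⟨b, g, hb⟩ := exists_isLift' hG β
  have hg := (nullhomotopic_iff hG hb).1 hβ
  have := (h.isLeast hG (.refl β) hb).2 ⟨b 0, rfl⟩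
  simp only [hg, one_smul, G.isTreeDist.self] at this
  exact this.not_gt h.pos

theorem IsImmersedOfLength.loopLength_eq (hG : G.NoIsolated) {β : G.Loop} {L : ℝ}
    (h : G.IsImmersedOfLength β L) : G.loopLength β = L := by
  obtain ⟨b, g, hb⟩ := exists_isLift' hG β
  exact (isLeast_loopLength hG (h.not_nullhomotopic hG) hb).unique (h.isLeast hG (.refl β) hb)

end MetricGraph

namespace Multigraph

variable {V : Type u} {E : Type v} {Γ : Multigraph V E}
  {V' : Type*} {E' : Type*} {Γ' : Multigraph V' E'}

/-! ### Existence of lifts and straightening of maps -/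

theorem exists_liftData (hΓ' : Γ'.NoIsolated) (φ : C(Γ.Realization, Γ'.Realization)) :
    ∃ x k γ, LiftData (Γ' := Γ') φ x k γ := by
  have hc := isCoveringMap_proj hΓ'
  choose x hx using fun v => (Γ'.isQuotientCoveringMap_proj hΓ').surjective (φ (Γ.vertex v))
  have hz : ∀ e, (φ.comp ⟨Γ.edge e, Γ.continuous_edge e⟩) 0 = Γ'.proj (x (Γ.src e)) := fun e => by
    rw [hx, ← edge_zero]
    rfl
  let γ : E → C(unitInterval, Γ'.Cover) := fun e => hc.liftPath _ _ (hz e)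
  have hγ : ∀ e t, Γ'.proj (γ e t) = φ (Γ.edge e t) := fun e t =>
    congrFun (hc.liftPath_lifts _ _ (hz e)) t
  have h1 : ∀ e, Γ'.proj (γ e 1) = Γ'.proj (x (Γ.tgt e)) := fun e => by
    rw [hγ, hx, edge_one]
  choose k hk using fun e => exists_smul_eq_of_proj_eq hΓ' (h1 e)
  exact ⟨x, k, fun e => γ e, fun e => (γ e).continuous, hγ, fun e => hc.liftPath_zero _ _ (hz e), hk⟩

theorem LiftData.joined {φ : C(Γ.Realization, Γ'.Realization)}
    {x : V → Γ'.Cover} {k : E → FreeGroup E'} {γ : E → unitInterval → Γ'.Cover}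
    (h : LiftData φ x k γ) (e : E) (t : unitInterval) : Joined (x (Γ.src e)) (γ e t) := by
  rw [← h.zero]
  exact (PathConnectedSpace.joined 0 t).map (h.continuous e)

theorem LiftData.joined_smul {φ : C(Γ.Realization, Γ'.Realization)}
    {x : V → Γ'.Cover} {k : E → FreeGroup E'} {γ : E → unitInterval → Γ'.Cover}
    (h : LiftData φ x k γ) (e : E) : Joined (x (Γ.src e)) (k e • x (Γ.tgt e)) := by
  rw [← h.one]
  exact h.joined e 1

end Multigraph

namespace MetricGraph

open Multigraph

section

variable {V : Type u} {E : Type v} {Γ : Multigraph V E}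
  {V' : Type*} {E' : Type*} [Fintype E'] {G' : MetricGraph V' E'} {x : V → G'.Cover}
  {k : E → FreeGroup E'}

/-- The geodesic homotopies of the lifted edges fit together at the vertices because geodesics
commute with the labels `k e`. So the class depends only on `k` and on the components of the points
`x v`. -/
theorem homotopic_of_liftData (hΓ : Γ.NoIsolated) (hG' : G'.NoIsolated)
    {φ ψ : C(Γ.Realization, G'.Realization)}
    {y : V → G'.Cover} {γ δ : E → unitInterval → G'.Cover} (h : LiftData φ x k γ)
    (h' : LiftData ψ y k δ) (hxy : ∀ v, Joined (x v) (y v)) : φ.Homotopic ψ := by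
  have hj : ∀ e t, Joined (γ e t) (δ e t) := fun e t =>
    (h.joined e t).symm.trans ((hxy _).trans (h'.joined e t))
  let fv : V → C(unitInterval, G'.Realization) := fun v =>
    ⟨fun s => G'.proj (G'.geodesicPoint (x v) (y v) s), G'.continuous_proj.comp
      (continuous_geodesicPoint hG' continuous_const continuous_const continuous_id fun _ => hxy v)⟩
  let Fe : E → C(unitInterval × unitInterval, G'.Realization) := fun e =>
    ⟨fun p => G'.proj (G'.geodesicPoint (γ e p.1) (δ e p.1) p.2), G'.continuous_proj.comp
      (continuous_geodesicPoint hG' ((h.continuous e).comp continuous_fst)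
        ((h'.continuous e).comp continuous_fst) continuous_snd fun p => hj e p.1)⟩
  have h0 : ∀ e, fv (Γ.src e) = (Fe e).curry 0 := fun e => by
    ext s
    simp only [fv, Fe, ContinuousMap.curry_apply, ContinuousMap.coe_mk, h.zero, h'.zero]
  have h1 : ∀ e, fv (Γ.tgt e) = (Fe e).curry 1 := fun e => by
    ext s
    simp only [fv, Fe, ContinuousMap.curry_apply, ContinuousMap.coe_mk, h.one, h'.one]
    rw [smul_geodesicPoint hG' _ (hxy _), proj_smul]
  let K := lift (Γ := Γ) fv (fun e => (Fe e).curry) h0 h1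
  have hK : Continuous K := continuous_iff.2 fun e => (Fe e).curry.continuous
  refine homotopic_of_continuous_curry hK (fun z => ?_) fun z => ?_
  · obtain ⟨e, t, rfl⟩ := hΓ.exists_edge_eq z
    change G'.proj (G'.geodesicPoint (γ e t) (δ e t) 0) = _
    rw [geodesicPoint_zero hG' (hj e t), h.proj_eq]
  · obtain ⟨e, t, rfl⟩ := hΓ.exists_edge_eq z
    change G'.proj (G'.geodesicPoint (γ e t) (δ e t) 1) = _
    rw [geodesicPoint_one hG' (hj e t), h'.proj_eq]

end

variable {V : Type u} {E : Type v} [Fintype E] {G : MetricGraph V E}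
  {V' : Type*} {E' : Type*} [Fintype E'] {G' : MetricGraph V' E'} {x : V → G'.Cover}
  {k : E → FreeGroup E'}

/-- The slope of a straightened map. -/
def imageSlope (G : MetricGraph V E) (x : V → G'.Cover) (k : E → FreeGroup E') (e : E) : ℝ :=
  imageLength G.toMultigraph x k e / G.len e

theorem imageSlope_mul_len (e : E) :
    imageSlope G x k e * G.len e = imageLength G.toMultigraph x k e :=
  div_mul_cancel₀ _ (G.len_pos e).ne'

theorem exists_straight (hG' : G'.NoIsolated)
    (hj : ∀ e, Joined (x (G.src e)) (k e • x (G.tgt e))) :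
    ∃ (φ : C(G.Realization, G'.Realization)) (γ : E → unitInterval → G'.Cover),
      LiftData φ x k γ ∧ ∀ e, HasSlope φ e (imageSlope G x k e) := by
  let γ : E → unitInterval → G'.Cover := fun e =>
    G'.geodesicPoint (x (G.src e)) (k e • x (G.tgt e))
  have hγ : ∀ e, Continuous (γ e) := fun e =>
    continuous_geodesicPoint hG' continuous_const continuous_const continuous_id fun _ => hj e
  let φ : C(G.Realization, G'.Realization) :=
    ⟨lift (fun v => G'.proj (x v)) (fun e t => G'.proj (γ e t))
      (fun e => by simp only [γ, geodesicPoint_zero hG' (hj e)])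
      (fun e => by simp only [γ, geodesicPoint_one hG' (hj e), proj_smul]),
      continuous_iff.2 fun e => G'.continuous_proj.comp (hγ e)⟩
  have hφ : LiftData φ x k γ := ⟨hγ, fun _ _ => rfl, fun e => geodesicPoint_zero hG' (hj e),
    fun e => geodesicPoint_one hG' (hj e)⟩
  refine ⟨φ, γ, hφ, fun e => (hasSlope_iff hG' (hγ e) (hφ.proj_eq e)).2 fun t t' => ?_⟩
  rw [treeDist_geodesicPoint (hj e), ← mul_assoc, imageSlope_mul_len, mul_comm]
  rfl

section

variable {φ : C(G.Realization, G'.Realization)} {γ : E → unitInterval → G'.Cover}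
  (hG' : G'.NoIsolated) (h : LiftData φ x k γ)

include hG' h

/-- A map that is linear on an edge is already straight there, so its slope can be read from the end
points of the lift. -/
theorem hasSlope_imageSlope {e : E} (he : ∃ s, HasSlope φ e s) :
    HasSlope φ e (imageSlope G x k e) := by
  obtain ⟨s, hs⟩ := he
  have := (hasSlope_iff hG' (h.continuous e) (h.proj_eq e)).1 hs 0 1
  rw [h.zero, h.one] at this
  have h2 : imageSlope G x k e = s := by
    rw [imageSlope, div_eq_iff (G.len_pos e).ne', imageLength, this]
    simp
  rwa [h2]

theorem slope_eq_imageSlope {e : E} (he : ∃ s, HasSlope φ e s) :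
    slope φ e = imageSlope G x k e :=
  (hasSlope_imageSlope hG' h he).slope_eq

theorem treeDist_edgeLift {e : E} (he : ∃ s, HasSlope φ e s) (t t' : unitInterval) :
    G'.treeDist (γ e t) (γ e t') = imageLength G.toMultigraph x k e * |(t : ℝ) - t'| := by
  rw [(hasSlope_iff hG' (h.continuous e) (h.proj_eq e)).1 (hasSlope_imageSlope hG' h he) t t',
    ← mul_assoc, imageSlope_mul_len]

theorem treeDist_dartLift {d : Dart E} (he : ∃ s, HasSlope φ d.1 s) (t t' : unitInterval) :
    G'.treeDist (dartLift k γ d t) (dartLift k γ d t') =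
      imageLength G.toMultigraph x k d.1 * |(t : ℝ) - t'| := by
  rcases d with ⟨e, _ | _⟩
  · simp only [dartLift, Bool.false_eq_true, if_false, treeDist_smul]
    rw [treeDist_edgeLift hG' h he, ← abs_neg]
    simp only [unitInterval.coe_symm_eq]
    congr 2
    ring
  · exact treeDist_edgeLift hG' h he t t'

end

end MetricGraph

namespace MetricGraph

open Multigraph

/-! ### Existence of an optimal straightened map -/

section

variable {V : Type u} {E : Type v} [Fintype E] (G : MetricGraph V E)

theorem len_le_one (e : E) : G.len e ≤ 1 := by
  rw [← G.sum_len]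
  exact Finset.single_le_sum (f := G.len) (fun e _ => (G.len_pos e).le) (Finset.mem_univ e)

variable {G}

theorem mul_length_le_weightedNorm_fox [DecidableEq E] {m : ℝ} (hm : ∀ e, m ≤ G.len e)
    (g : FreeGroup E) : m * g.toWord.length ≤ G.weightedNorm (fox g) := by
  classical
  set W := g.toWord with hW
  have hred : FreeGroup.IsReduced W := FreeGroup.isReduced_toWord
  have hsplit : ∀ i : Fin W.length, W = W.take i ++ W[i] :: W.drop (i + 1) := fun i => by simp
  let f : Fin W.length → E × FreeGroup E := fun i => foxIndex (FreeGroup.mk (W.take i)) W[i]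
  have hf : Function.Injective f := by
    intro i j hij
    have hi := hred
    rw [hsplit i] at hi
    have hj := hred
    rw [hsplit j] at hj
    have := congrArg List.length (foxIndex_inj (isReduced_prefix hi) (isReduced_prefix hj) hij).1
    simp only [List.length_take] at this
    ext
    omega
  have hval : ∀ i, |fox g (f i)| = 1 := fun i => by
    have hi := hred
    rw [hsplit i] at hi
    have := foxWord_apply_foxIndex hi
    rw [← hsplit i] at this
    rw [fox_eq_foxWord, this, abs_dartSign]
  rw [G.weightedNorm_eq_sum (Finset.subset_union_left (s₂ := Finset.univ.image f))]
  calc m * W.length = ∑ i : Fin W.length, m := by simp [mul_comm]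
    _ ≤ ∑ i, G.len (f i).1 * |fox g (f i)| :=
        Finset.sum_le_sum fun i _ => by rw [hval, mul_one]; exact hm _
    _ = ∑ j ∈ Finset.univ.image f, G.len j.1 * |fox g j| :=
        (Finset.sum_image (f := fun j => G.len j.1 * |fox g j|) hf.injOn).symm
    _ ≤ _ := Finset.sum_le_sum_of_subset_of_nonneg Finset.subset_union_right
        fun j _ _ => mul_nonneg (G.len_pos _).le (abs_nonneg _)

theorem finite_setOf_treeDist_smul_le (C : ℝ) : {g : FreeGroup E | ∃ (e e' : E)
    (t t' : unitInterval), G.treeDist (G.cover.edge (e, 1) t) (g • G.cover.edge (e', 1) t') ≤ C}.Finite := by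
  classical
  obtain ⟨m, hm, hlen⟩ := G.exists_len_lower_bound
  -- The summand `2` accounts for moving both points to the starts of their edges, which have length
  -- at most `1`; what remains is bounded below by `m` times the word length of `g`.
  refine Set.Finite.subset ((List.finite_length_le (Dart E) ⌊(C + 2) / m⌋₊).preimage
    (f := FreeGroup.toWord) FreeGroup.toWord_injective.injOn) ?_
  rintro g ⟨e, e', t, t', h⟩
  have hT := G.isTreeDist
  have h1 : G.treeDist (G.cover.edge (e, 1) 0) (G.cover.edge (e, 1) t) ≤ 1 := by
    rw [treeDist_edge, Set.Icc.coe_zero, zero_sub, abs_neg, abs_of_nonneg t.2.1]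
    exact mul_le_one₀ (G.len_le_one e) t.2.1 t.2.2
  have h2 : G.treeDist (g • G.cover.edge (e', 1) t') (g • G.cover.edge (e', 1) 0) ≤ 1 := by
    rw [treeDist_smul, treeDist_edge, Set.Icc.coe_zero, sub_zero, abs_of_nonneg t'.2.1]
    exact mul_le_one₀ (G.len_le_one e') t'.2.1 t'.2.2
  have h3 : G.treeDist (G.cover.edge (e, 1) 0) (g • G.cover.edge (e', 1) 0) =
      G.weightedNorm (fox g) := by
    rw [treeDist, smul_edge, dev_edge, dev_edge, ← G.weightedNorm_neg]
    simp [fox_one]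
  have h4 := hT.triangle (G.cover.edge (e, 1) 0) (G.cover.edge (e, 1) t)
    (g • G.cover.edge (e', 1) 0)
  have h5 := hT.triangle (G.cover.edge (e, 1) t) (g • G.cover.edge (e', 1) t')
    (g • G.cover.edge (e', 1) 0)
  have h6 := mul_length_le_weightedNorm_fox hlen g
  refine Nat.le_floor ?_
  rw [le_div_iff₀ hm]
  linarith

end

variable {V : Type u} {E : Type v} [Fintype E] {G : MetricGraph V E}
  {V' : Type*} {E' : Type*} [Fintype E'] {G' : MetricGraph V' E'}
  {k : E → FreeGroup E'}

theorem imageSlope_nonneg (x : V → G'.Cover) (e : E) : 0 ≤ imageSlope G x k e :=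
  div_nonneg (G'.treeDist_nonneg _ _) (G.len_pos e).le

theorem norm_imageSlope_le_iff {x : V → G'.Cover} {C : ℝ} (hC : 0 ≤ C) :
    ‖imageSlope G x k‖ ≤ C ↔ ∀ e, imageSlope G x k e ≤ C := by
  rw [pi_norm_le_iff_of_nonneg hC]
  exact forall_congr' fun e => by rw [Real.norm_of_nonneg (imageSlope_nonneg x e)]

/-- Up to the action of the deck group, a vertex is sent to the point `t v` of an edge `a v`, and
a bound on the slopes leaves finitely many possibilities for the labels of the edges. -/
theorem exists_isMin_norm_imageSlope [Finite V] (hG' : G'.NoIsolated) (x₀ : V → G'.Cover) :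
    ∃ x, (∀ v, Joined (x₀ v) (x v)) ∧ ∀ y, (∀ v, Joined (x₀ v) (y v)) →
      ‖imageSlope G x k‖ ≤ ‖imageSlope G y k‖ := by
  let P : (V → E') → (V → unitInterval) → V → G'.Cover := fun a t v => G'.cover.edge (a v, 1) (t v)
  let F : (V → E') × (E → FreeGroup E') → (V → unitInterval) → ℝ := fun p t =>
    ‖imageSlope G (P p.1 t) p.2‖
  have hF : ∀ p, Continuous (F p) := fun p => by
    refine continuous_norm.comp (continuous_pi fun e => (G'.continuous_treeDist.comp
      (Continuous.prodMk ?_ ?_)).div_const _)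
    · exact (G'.cover.continuous_edge _).comp (continuous_apply _)
    · exact (continuous_const_smul (p.2 e)).comp
        ((G'.cover.continuous_edge _).comp (continuous_apply _))
  have hmin : ∀ p, ∃ t, ∀ t', F p t ≤ F p t' := fun p => by
    obtain ⟨t, -, ht⟩ := isCompact_univ.exists_isMinOn Set.univ_nonempty (hF p).continuousOn
    exact ⟨t, fun t' => ht (Set.mem_univ t')⟩
  choose τ hτ using hmin
  -- Moving every vertex image to an edge in sheet `1` replaces the label of an edge by this one and
  -- keeps all image lengths.
  let lab : (V → FreeGroup E') → E → FreeGroup E' := fun g e =>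
    (g (G.src e))⁻¹ * k e * g (G.tgt e)
  have hlab : ∀ a g t, imageSlope G (fun v => g v • P a t v) k = imageSlope G (P a t) (lab g) := by
    intro a g t
    ext e
    rw [imageSlope, imageSlope, imageLength, imageLength, ← G'.treeDist_smul (g (G.src e))⁻¹,
      inv_smul_smul, smul_smul, smul_smul]
  have hex : ∀ y : V → G'.Cover, ∃ (a : V → E') (g : V → FreeGroup E') (t : V → unitInterval),
      y = fun v => g v • P a t v := by
    intro y
    choose e t h using fun v => hG'.cover.exists_edge_eq (y v)
    refine ⟨fun v => (e v).1, fun v => (e v).2, t, funext fun v => ?_⟩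
    rw [smul_edge, mul_one, ← h]
  -- These are the choices of edges and labels that come from vertex images in the prescribed
  -- components; the position on the edges is free because an edge is connected.
  let A : Set ((V → E') × (E → FreeGroup E')) := {p | ∃ g, p.2 = lab g ∧
    ∀ t v, Joined (x₀ v) (g v • P p.1 t v)}
  have hA : ∀ a g t, (∀ v, Joined (x₀ v) (g v • P a t v)) → (a, lab g) ∈ A := fun a g t h =>
    ⟨g, rfl, fun t' v => (h v).trans (joined_edge (Γ := G'.cover) (a v, g v * 1) (t v) (t' v))⟩
  obtain ⟨a₀, g₀, t₀, h₀⟩ := hex x₀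
  have hA₀ : (a₀, lab g₀) ∈ A := hA a₀ g₀ t₀ fun v => by
    have := congrFun h₀ v
    rw [← this]
  set C := ‖imageSlope G x₀ k‖ with hC
  have hC₀ : F (a₀, lab g₀) t₀ = C := by
    rw [hC, h₀, hlab]
  let B : Set ((V → E') × (E → FreeGroup E')) := A ∩ {p | ∃ t, F p t ≤ C}
  -- A choice whose minimum exceeds the value `C` at `x₀` is irrelevant. For the others each label
  -- moves some point of an edge in sheet `1` to within `C` of another such edge.
  have hB : B.Finite := by
    refine Set.Finite.subset (Set.finite_univ.prod (Set.Finite.pi' fun _ : E =>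
      finite_setOf_treeDist_smul_le (G := G') C)) ?_
    rintro ⟨a, κ⟩ ⟨-, t, ht⟩
    refine ⟨Set.mem_univ _, fun e => ⟨a (G.src e), a (G.tgt e), t (G.src e), t (G.tgt e), ?_⟩⟩
    have h1 := (norm_imageSlope_le_iff (norm_nonneg _)).1 ht e
    rw [imageSlope, div_le_iff₀ (G.len_pos e)] at h1
    exact h1.trans (mul_le_of_le_one_right (norm_nonneg _) (G.len_le_one e))
  obtain ⟨⟨a, κ⟩, ⟨⟨g, hg, hj⟩, -⟩, hmin⟩ := hB.exists_minimalFor (fun p => F p (τ p)) B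
    ⟨_, hA₀, t₀, hC₀.le⟩
  dsimp only at hg hj
  subst hg
  have hmin' : ∀ p ∈ B, F (a, lab g) (τ (a, lab g)) ≤ F p (τ p) := fun p hp =>
    (le_total _ _).elim id (hmin hp)
  refine ⟨fun v => g v • P a (τ (a, lab g)) v, hj _, fun y hy => ?_⟩
  rw [hlab]
  change F (a, lab g) (τ (a, lab g)) ≤ _
  obtain ⟨b, h, t, rfl⟩ := hex y
  rw [hlab]
  change _ ≤ F (b, lab h) t
  rcases le_total (F (b, lab h) t) C with hle | hle
  · exact (hmin' _ ⟨hA b h t hy, t, hle⟩).trans (hτ _ _)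
  · exact ((hmin' _ ⟨hA₀, t₀, hC₀.le⟩).trans (hτ _ t₀)).trans (hC₀.le.trans hle)

end MetricGraph

/-! ### Cycles in finite dynamical systems -/

theorem exists_cycle {X : Type*} [Finite X] [Nonempty X] (s : X → X) :
    ∃ (m : ℕ) (w : Fin (m + 1) → X), ∀ i, w (i + 1) = s (w i) := by
  obtain ⟨a⟩ := ‹Nonempty X›
  obtain ⟨i, j, hij, h⟩ := Finite.exists_ne_map_eq_of_infinite fun n : ℕ => s^[n] a
  wlog hlt : i < j generalizing i j
  · exact this j i hij.symm h.symm (lt_of_le_of_ne (not_lt.1 hlt) hij.symm)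
  obtain ⟨m, rfl⟩ : ∃ m, j = i + (m + 1) := ⟨j - i - 1, by omega⟩
  refine ⟨m, fun l => s^[i + l] a, fun l => ?_⟩
  dsimp only
  rw [← Function.iterate_succ_apply' s]
  by_cases hl : l = Fin.last m
  · subst hl
    rw [Fin.last_add_one, Fin.val_zero, Fin.val_last]
    exact h
  · rw [Fin.val_add_one_of_lt (Fin.lt_last_iff_ne_last.2 hl)]
    rfl

namespace MetricGraph

open Multigraph

variable {V : Type u} {E : Type v} [Fintype E] {G : MetricGraph V E}

theorem nonempty_edges (G : MetricGraph V E) : Nonempty E := by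
  by_contra hE
  rw [not_nonempty_iff] at hE
  have := G.sum_len
  simp at this

/-- Valence at least two allows every oriented edge to be continued without backtracking, and a
continuation map on a finite set has a cycle. -/
theorem exists_isImmersedOfLength_of_two_le_valence (hG : ∀ x, 2 ≤ G.valence x) :
    ∃ β L, G.IsImmersedOfLength β L := by
  have hs : ∀ d : Dart E, ∃ d', G.init d' = G.term d ∧ d' ≠ rev d := by
    intro d
    have : 1 < Nat.card {d' : Dart E // G.init d' = G.term d} := hG (G.term d)
    rw [Finite.one_lt_card_iff_nontrivial] at this
    obtain ⟨⟨d', h1⟩, h2⟩ := exists_ne (⟨rev d, rfl⟩ : {d' : Dart E // G.init d' = G.term d})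
    exact ⟨d', h1, fun h => h2 (Subtype.ext h)⟩
  choose s hs hs' using hs
  have := G.nonempty_edges
  obtain ⟨m, w, hw⟩ := exists_cycle s
  have hc : G.IsClosedEdgePath w := fun i => by rw [hw, hs]
  obtain ⟨β, hβ⟩ := exists_traverses hc
  exact ⟨β, _, m, w, hc, fun i => by rw [hw]; exact hs' _, hβ, rfl⟩

/-! ### Legal turns of optimal straightened maps -/

variable {V' : Type*} {E' : Type*} [Fintype E'] {G' : MetricGraph V' E'} {x : V → G'.Cover}
  {k : E → FreeGroup E'}

theorem imageSlope_le_iff {σ : ℝ} {e : E} :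
    imageSlope G x k e ≤ σ ↔ imageLength G.toMultigraph x k e ≤ σ * G.len e :=
  div_le_iff₀ (G.len_pos e)

theorem imageSlope_eq_iff {σ : ℝ} {e : E} :
    imageSlope G x k e = σ ↔ imageLength G.toMultigraph x k e = σ * G.len e :=
  div_eq_iff (G.len_pos e).ne'

theorem joined_tip (hj : ∀ e, Joined (x (G.src e)) (k e • x (G.tgt e))) (d : Dart E) :
    Joined (x (G.init d)) (G.tip x k d) := by
  rcases d with ⟨e, _ | _⟩
  · have := joined_smul (k e)⁻¹ (hj e).symm
    rwa [inv_smul_smul] at this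
  · exact hj e

theorem eventually_mul_lt {r : ℝ} (hr : 0 < r) : ∀ᶠ ε in 𝓝[>] (0 : ℝ), 2 * ε < r := by
  filter_upwards [Ioo_mem_nhdsGT (half_pos hr)] with ε hε
  linarith [hε.2]

/-- If no legal turn continues the tension dart `d`, then moving its end slightly along `d` yields
a map with fewer tension edges. -/
theorem exists_legalTurn {σ : ℝ} (hσ : 0 < σ)
    (hj : ∀ e, Joined (x (G.src e)) (k e • x (G.tgt e))) (hle : ∀ e, imageSlope G x k e ≤ σ)
    (hmin : ∀ y, (∀ v, Joined (x v) (y v)) → (∀ e, imageSlope G y k e ≤ σ) →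
      {e | imageSlope G x k e = σ}.ncard ≤ {e | imageSlope G y k e = σ}.ncard)
    {d : Dart E} (hd : imageSlope G x k d.1 = σ) :
    ∃ d', G.init d' = G.term d ∧ imageSlope G x k d'.1 = σ ∧
      LegalTurn G.toMultigraph x k (rev d) d' := by
  classical
  by_contra! hcon
  have hT := G'.isTreeDist
  set D := imageLength G.toMultigraph x k with hD
  set v := G.term d with hv
  have hD₀ : G'.treeDist (x v) (G.tip x k (rev d)) = D d.1 := treeDist_init_tip (rev d)
  have hpos : ∀ e, imageSlope G x k e = σ → 0 < D e := fun e he => by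
    rw [imageSlope_eq_iff] at he
    rw [hD, he]
    exact mul_pos hσ (G.len_pos e)
  have hgap : ∀ c : Dart E, G.init c = v → imageSlope G x k c.1 = σ →
      0 < D c.1 + D d.1 - G'.treeDist (G.tip x k c) (G.tip x k (rev d)) := by
    intro c h1 h2
    have h3 := hcon c h1 h2
    have h4 := hT.triangle (G.tip x k (rev d)) (x v) (G.tip x k c)
    rw [hT.comm _ (x v), hD₀, ← h1, treeDist_init_tip] at h4
    have := lt_of_le_of_ne h4 h3
    rw [hT.comm (G.tip x k c)]
    simp only [hD] at this ⊢
    linarith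
  -- Here `ε` is below half of three finite families of gaps: twice the overlap with the reversed
  -- `d` of each tension edge at `v`, the image length of each tension edge, and the slack of each
  -- other edge, both ends of which may move by `ε`.
  obtain ⟨ε, h1, h2, h3, hε⟩ := ((Filter.eventually_all.2 fun c : {c : Dart E // G.init c = v ∧
      imageSlope G x k c.1 = σ} => eventually_mul_lt (hgap c.1 c.2.1 c.2.2)).and
    ((Filter.eventually_all.2 fun e : {e // imageSlope G x k e = σ} =>
      eventually_mul_lt (hpos e.1 e.2)).and
    ((Filter.eventually_all.2 fun e : {e // D e < σ * G.len e} =>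
      eventually_mul_lt (sub_pos.2 e.2)).and self_mem_nhdsWithin))).exists
  obtain ⟨z, hz, hz1, hz2⟩ := G'.exists_between (joined_tip hj (rev d)) hε.le
    (by
      have := h2 ⟨_, hd⟩
      dsimp only at this
      change ε ≤ G'.treeDist (x v) _
      rw [hD₀]
      linarith)
  change Joined (x v) z at hz
  change G'.treeDist (x v) z = ε at hz1
  change _ = G'.treeDist (x v) _ - ε at hz2
  have hclose : ∀ c : Dart E, G.init c = v → imageSlope G x k c.1 = σ →
      G'.treeDist z (G.tip x k c) ≤ D c.1 - ε := by
    intro c hc hcσ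
    have := hT.le_sub_of_gromov (b := G.tip x k c) hz1 hz2 (by
      rw [hD₀, ← hc, treeDist_init_tip]
      exact (h1 ⟨c, hc, hcσ⟩).le)
    rwa [← hc, treeDist_init_tip] at this
  set y := Function.update x v z with hy
  have hyv : y v = z := Function.update_self ..
  have hyne : ∀ u, u ≠ v → y u = x u := fun u hu => Function.update_of_ne hu ..
  have hyj : ∀ u, Joined (x u) (y u) := fun u => by
    by_cases hu : u = v
    · rw [hu, hyv]
      exact hz
    · rw [hyne u hu]
  have hyd : ∀ u, G'.treeDist (x u) (y u) ≤ ε := fun u => by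
    by_cases hu : u = v
    · rw [hu, hyv, hz1]
    · rw [hyne u hu, hT.self]
      exact hε.le
  have hlt : ∀ e, imageSlope G x k e = σ → G.src e = v ∨ G.tgt e = v →
      imageLength G.toMultigraph y k e < σ * G.len e := by
    intro e he hev
    have hDe : D e = σ * G.len e := imageSlope_eq_iff.1 he
    rw [← hDe, imageLength]
    by_cases hs : G.src e = v
    · have hs1 := hclose (e, true) hs he
      rw [show G.tip x k (e, true) = k e • x (G.tgt e) from rfl] at hs1
      rw [hs, hyv]
      by_cases ht : G.tgt e = v
      · have ht1 := hclose (e, false) ht he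
        rw [show G.tip x k (e, false) = (k e)⁻¹ • x (G.src e) from rfl, hs,
          ← G'.treeDist_smul (k e), smul_inv_smul] at ht1
        rw [ht] at hs1 ⊢
        rw [hyv]
        -- For a tension loop at `v` both ends move. Each move alone gains `ε`, and the four point
        -- condition shows that the gains do not cancel.
        have h4 := hT.four_point (x v) (k e • x v) z (k e • z)
        have h5 : G'.treeDist (x v) (k e • x v) = D e := by
          simp only [hD, imageLength, hs, ht]
        have h6 := h2 ⟨e, he⟩
        dsimp only at h6
        rw [h5, hz1, treeDist_smul, hz1, hT.comm (x v), hT.comm _ z] at h4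
        rcases le_max_iff.1 h4 with h | h <;> linarith
      · rw [hyne _ ht]
        linarith
    · have ht : G.tgt e = v := hev.resolve_left hs
      have ht1 := hclose (e, false) ht he
      rw [show G.tip x k (e, false) = (k e)⁻¹ • x (G.src e) from rfl,
        ← G'.treeDist_smul (k e), smul_inv_smul, hT.comm] at ht1
      rw [ht, hyv, hyne _ hs]
      linarith
  have hlt' : ∀ e, imageSlope G x k e ≠ σ →
      imageLength G.toMultigraph y k e < σ * G.len e := by
    intro e he
    have h4 : D e < σ * G.len e := lt_of_le_of_ne (imageSlope_le_iff.1 (hle e))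
      fun h => he (imageSlope_eq_iff.2 h)
    have h5 := h3 ⟨e, h4⟩
    dsimp only at h5
    have h6 := hT.triangle (y (G.src e)) (x (G.src e)) (k e • y (G.tgt e))
    have h7 := hT.triangle (x (G.src e)) (k e • x (G.tgt e)) (k e • y (G.tgt e))
    rw [treeDist_smul] at h7
    rw [hT.comm (y (G.src e)) (x _)] at h6
    have h8 := hyd (G.src e)
    have h9 := hyd (G.tgt e)
    simp only [hD, imageLength] at h5 ⊢
    linarith
  have heq : ∀ e, G.src e ≠ v → G.tgt e ≠ v → imageSlope G y k e = imageSlope G x k e := by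
    intro e hs ht
    rw [imageSlope, imageSlope, imageLength, imageLength, hyne _ hs, hyne _ ht]
  have hyle : ∀ e, imageSlope G y k e ≤ σ := by
    intro e
    by_cases he : imageSlope G x k e = σ
    · by_cases hev : G.src e = v ∨ G.tgt e = v
      · exact imageSlope_le_iff.2 (hlt e he hev).le
      · push Not at hev
        rw [heq e hev.1 hev.2, he]
    · exact imageSlope_le_iff.2 (hlt' e he).le
  refine (hmin y hyj hyle).not_gt (Set.ncard_lt_ncard ?_ (Set.toFinite _))
  have hsub : ∀ e, imageSlope G y k e = σ →
      imageSlope G x k e = σ ∧ ¬ (G.src e = v ∨ G.tgt e = v) := by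
    intro e he
    rw [imageSlope_eq_iff] at he
    by_cases he' : imageSlope G x k e = σ
    · exact ⟨he', fun h => (hlt e he' h).ne he⟩
    · exact ((hlt' e he').ne he).elim
  refine (Set.ssubset_iff_of_subset fun e he => (hsub e he).1).2 ⟨d.1, hd, fun h => (hsub _ h).2 ?_⟩
  rcases d with ⟨e, _ | _⟩
  · exact .inl rfl
  · exact .inr rfl

theorem exists_legal_cycle {σ : ℝ} (hσ : 0 < σ) (hj : ∀ e, Joined (x (G.src e)) (k e • x (G.tgt e)))
    (hnorm : ‖imageSlope G x k‖ = σ)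
    (hmin : ∀ y, (∀ v, Joined (x v) (y v)) → σ ≤ ‖imageSlope G y k‖) :
    ∃ (y : V → G'.Cover) (m : ℕ) (w : Fin (m + 1) → Dart E), (∀ v, Joined (x v) (y v)) ∧
      (∀ e, imageSlope G y k e ≤ σ) ∧ G.IsClosedEdgePath w ∧
      (∀ i, imageSlope G y k (w i).1 = σ) ∧
      ∀ i, LegalTurn G.toMultigraph y k (rev (w i)) (w (i + 1)) := by
  let S : Set (V → G'.Cover) := {y | (∀ v, Joined (x v) (y v)) ∧ ∀ e, imageSlope G y k e ≤ σ}
  have hS : S.Nonempty := ⟨x, fun v => .refl _, (norm_imageSlope_le_iff hσ.le).1 hnorm.le⟩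
  -- Optimality alone does not provide legal continuations; the number of tension edges has to be
  -- minimal too.
  obtain ⟨y, ⟨hy1, hy2⟩, hy3⟩ :=
    exists_minimalFor_of_wellFoundedLT (· ∈ S) (fun y => {e | imageSlope G y k e = σ}.ncard) hS
  have hjy : ∀ e, Joined (y (G.src e)) (k e • y (G.tgt e)) := fun e =>
    (hy1 _).symm.trans ((hj e).trans (joined_smul _ (hy1 _)))
  have hleg : ∀ d : {d : Dart E // imageSlope G y k d.1 = σ},
      ∃ d' : {d : Dart E // imageSlope G y k d.1 = σ}, G.init d'.1 = G.term d.1 ∧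
        LegalTurn G.toMultigraph y k (rev d.1) d'.1 := by
    rintro ⟨d, hd⟩
    obtain ⟨d', h1, h2, h3⟩ := exists_legalTurn hσ hjy hy2 (fun z hz1 hz2 =>
      (le_total _ _).elim id (hy3 (j := z) ⟨fun v => (hy1 v).trans (hz1 v), hz2⟩)) hd
    exact ⟨⟨d', h2⟩, h1, h3⟩
  choose s hs hs' using hleg
  have : Nonempty {d : Dart E // imageSlope G y k d.1 = σ} := by
    by_contra hne
    rw [not_nonempty_iff, isEmpty_subtype] at hne
    -- Without tension edges the finitely many slopes would all be smaller than `σ`, against its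
    -- minimality.
    have hlt : ‖imageSlope G y k‖ < σ := (pi_norm_lt_iff hσ).2 fun e => by
      rw [Real.norm_of_nonneg (imageSlope_nonneg y e)]
      exact lt_of_le_of_ne (hy2 e) (hne (e, true))
    exact hlt.not_ge (hmin y hy1)
  obtain ⟨m, w, hw⟩ := exists_cycle s
  exact ⟨y, m, fun i => (w i).1, hy1, hy2, fun i => by dsimp only; rw [hw, hs], fun i => (w i).2,
    fun i => by dsimp only; rw [hw]; exact hs' _⟩

end MetricGraph

/-! ### Stretching of loops, legality, and optimal maps. -/

namespace MetricGraph

open Multigraph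

section

variable {V : Type u} {E : Type v} [Fintype E] {G : MetricGraph V E}

theorem noIsolated_of_two_le_valence (hG : ∀ x, 2 ≤ G.valence x) : G.NoIsolated := by
  intro x
  have : Nat.card {d : Dart E // G.init d = x} ≠ 0 := by
    have := hG x
    rw [valence] at this
    omega
  obtain ⟨⟨d, hd⟩⟩ := (Nat.card_ne_zero.1 this).1
  exact ⟨d, hd⟩

theorem loopLength_congr {α β : G.Loop} (h : α.Homotopic β) : G.loopLength α = G.loopLength β := by
  have h1 : α.Nullhomotopic ↔ β.Nullhomotopic :=
    exists_congr fun y => ⟨h.symm.trans, h.trans⟩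
  have h2 : ∀ δ : G.Loop, α.Homotopic δ ↔ β.Homotopic δ := fun δ => ⟨h.symm.trans, h.trans⟩
  simp only [loopLength, h2]
  by_cases hβ : β.Nullhomotopic
  · rw [if_pos hβ, if_pos (h1.2 hβ)]
  · rw [if_neg hβ, if_neg fun hα => hβ (h1.1 hα)]

end

variable {V : Type u} {E : Type v} [Fintype E] {G : MetricGraph V E}
  {V' : Type*} {E' : Type*} [Fintype E'] {G' : MetricGraph V' E'} {x : V → G'.Cover}
  {k : E → FreeGroup E'} {φ : C(G.Realization, G'.Realization)}
  {γ : E → unitInterval → G'.Cover}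

theorem maxSlope_eq_norm (hG' : G'.NoIsolated) (h : LiftData φ x k γ) (hφ : IsLinearOnEdges φ) :
    maxSlope φ = ‖imageSlope G x k‖ := by
  have := G.nonempty_edges
  have hs : ∀ e, slope φ e = imageSlope G x k e := fun e => slope_eq_imageSlope hG' h (hφ e)
  refine le_antisymm (ciSup_le fun e => ?_) ?_
  · rw [hs]
    exact (norm_imageSlope_le_iff (norm_nonneg _)).1 le_rfl e
  · have hle : ∀ e, imageSlope G x k e ≤ maxSlope φ := fun e => by
      rw [← hs]
      exact le_ciSup (f := slope φ) (Set.finite_range _).bddAbove e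
    exact (norm_imageSlope_le_iff ((imageSlope_nonneg x this.some).trans (hle _))).2 hle

theorem loopLength_comp_le (hG : G.NoIsolated) (hG' : G'.NoIsolated) (h : LiftData φ x k γ)
    {α : G.Loop} (hα : ¬ α.Nullhomotopic) (hφα : ¬ (φ.comp α).Nullhomotopic) :
    G'.loopLength (φ.comp α) ≤ ‖imageSlope G x k‖ * G.loopLength α := by
  obtain ⟨β, hαβ, m, w, hw, -, hβ, hL⟩ := exists_isImmersedOfLength_loopLength hG hα
  obtain ⟨a, ha, -⟩ := h.exists_isLift hG' hw hβ
  obtain ⟨b, hb, -⟩ := ha.of_homotopic hG' (β := φ.comp α)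
    (ContinuousMap.Homotopic.comp (.refl φ) hαβ.symm)
  refine ((isLeast_loopLength hG' hφα hb).2 ⟨G.vertexSeq x k w 0, rfl⟩).trans
    ((treeDist_vertexSeq_le hw).trans ?_)
  rw [hL, Finset.mul_sum]
  exact Finset.sum_le_sum fun i _ =>
    imageSlope_le_iff.1 ((norm_imageSlope_le_iff (norm_nonneg _)).1 le_rfl _)

theorem exists_loop_of_legal_cycle (hG' : G'.NoIsolated) (h : LiftData φ x k γ)
    {σ : ℝ} (hσ : 0 < σ) {m : ℕ} {w : Fin (m + 1) → Dart E} (hw : G.IsClosedEdgePath w)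
    (hwσ : ∀ i, imageSlope G x k (w i).1 = σ)
    (hturn : ∀ i, LegalTurn G.toMultigraph x k (rev (w i)) (w (i + 1))) :
    ∃ α L, G.IsImmersedOfLength α L ∧ G'.loopLength (φ.comp α) = σ * L := by
  obtain ⟨α, hα⟩ := exists_traverses hw
  have hwl : ∀ i, imageLength G.toMultigraph x k (w i).1 = σ * G.len (w i).1 := fun i =>
    imageSlope_eq_iff.1 (hwσ i)
  have hpos : ∀ i, 0 < imageLength G.toMultigraph x k (w i).1 := fun i => by
    rw [hwl]
    exact mul_pos hσ (G.len_pos _)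
  have hsum : ∑ i, imageLength G.toMultigraph x k (w i).1 = σ * ∑ i, G.len (w i).1 := by
    rw [Finset.mul_sum]
    exact Finset.sum_congr rfl fun i _ => hwl i
  refine ⟨α, _, ⟨m, w, hw, fun i hi => ?_, hα, rfl⟩, ?_⟩
  -- A backtracking turn has equal tips, at distance zero, while legality makes this distance a sum
  -- of two positive lengths.
  · have := hturn i
    rw [LegalTurn, hi, G'.isTreeDist.self] at this
    have h1 := hpos i
    simp only [rev] at this
    linarith
  · obtain ⟨a, ha, -⟩ := h.exists_isLift hG' hw hα
    obtain ⟨h1, h2⟩ := treeDist_vertexSeq_eq hw hpos hturn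
    rw [hsum] at h1 h2
    have hL : 0 < σ * ∑ i, G.len (w i).1 := by
      rw [← hsum]
      exact Finset.sum_pos (fun i _ => hpos i) ⟨0, Finset.mem_univ _⟩
    have hess : ¬ (φ.comp α).Nullhomotopic := by
      rw [nullhomotopic_iff hG' ha]
      intro h3
      rw [h3, one_smul, G'.isTreeDist.self] at h1
      exact hL.ne h1
    refine (isLeast_loopLength hG' hess ha).unique ⟨⟨_, h1⟩, ?_⟩
    rintro _ ⟨y, rfl⟩
    exact h2 y

/-- Equal germs would make the lifts of the two image rays, which start at the same point, agree up
to some time `t > 0`. The tips would then be closer by `2 * t` than legality allows. The common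
slope `σ` makes both lifts unit speed after the same rescaling. -/
theorem pushDirection_ne (hG' : G'.NoIsolated) (h : LiftData φ x k γ) (hφ : IsLinearOnEdges φ)
    {d d' : Dart E} (hdd' : G.init d = G.init d') {σ : ℝ} (hσ : 0 < σ)
    (hd : slope φ d.1 = σ) (hd' : slope φ d'.1 = σ)
    (hturn : LegalTurn G.toMultigraph x k d d') : pushDirection φ d ≠ pushDirection φ d' := by
  intro heq
  have hT := G'.isTreeDist
  obtain ⟨δ, hδ, hsub⟩ := mem_nhdsGE_iff_exists_Ico_subset.1 (Filter.Germ.coe_eq.1 heq)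
  rw [Set.mem_Ioi] at hδ
  rw [slope_eq_imageSlope hG' h (hφ _)] at hd hd'
  have hD : imageLength G.toMultigraph x k d.1 = σ * G.len d.1 := imageSlope_eq_iff.1 hd
  have hD' : imageLength G.toMultigraph x k d'.1 = σ * G.len d'.1 := imageSlope_eq_iff.1 hd'
  let A : Dart E → ℝ → G'.Cover := fun c t =>
    dartLift k γ c (Set.projIcc 0 1 zero_le_one (t / σ / G.len c.1))
  have hA : ∀ c, Continuous (A c) := fun c =>
    (h.continuous_dartLift c).comp (continuous_projIcc.comp (by fun_prop))
  have hA0 : ∀ c, A c 0 = x (G.init c) := fun c => by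
    simp only [A, zero_div, Set.projIcc_left]
    exact h.dartLift_zero c
  have hAtip : ∀ c : Dart E, imageLength G.toMultigraph x k c.1 = σ * G.len c.1 → ∀ t, 0 ≤ t →
      t ≤ σ * G.len c.1 → G'.treeDist (A c t) (G.tip x k c) = σ * G.len c.1 - t := by
    intro c hc t h0 h1
    have hpos := mul_pos hσ (G.len_pos c.1)
    have h2 : t / σ / G.len c.1 ∈ Set.Icc (0 : ℝ) 1 := by
      rw [div_div]
      exact ⟨div_nonneg h0 hpos.le, (div_le_one hpos).2 h1⟩
    rw [← h.dartLift_one]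
    simp only [A]
    rw [treeDist_dartLift hG' h (hφ _), hc, Set.projIcc_of_mem _ h2]
    simp only [Set.Icc.coe_one, div_div]
    rw [abs_sub_comm, abs_of_nonneg (sub_nonneg.2 ((div_le_one hpos).2 h1)), mul_sub, mul_one,
      mul_div_cancel₀ _ hpos.ne']
  have hcomp : Set.EqOn (G'.proj ∘ A d) (G'.proj ∘ A d') (Set.Ico 0 δ) := fun t ht => by
    have h1 := hsub ht
    change φ _ = φ _ at h1
    rw [slope_eq_imageSlope hG' h (hφ _), slope_eq_imageSlope hG' h (hφ _), hd, hd', ray, ray,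
      ← h.proj_dartLift, ← h.proj_dartLift] at h1
    exact h1
  have heqOn := (isCoveringMap_proj hG').eqOn_of_comp_eqOn isPreconnected_Ico (hA d).continuousOn
    (hA d').continuousOn hcomp (a := 0) ⟨le_rfl, hδ⟩ (by rw [hA0, hA0, hdd'])
  have hpos := mul_pos hσ (G.len_pos d.1)
  have hpos' := mul_pos hσ (G.len_pos d'.1)
  set t := min (δ / 2) (min (σ * G.len d.1) (σ * G.len d'.1)) with ht
  have ht0 : 0 < t := lt_min (half_pos hδ) (lt_min hpos hpos')
  have ht1 : A d t = A d' t :=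
    heqOn ⟨ht0.le, (min_le_left _ _).trans_lt (half_lt_self hδ)⟩
  have h1 := hAtip d hD t ht0.le ((min_le_right _ _).trans (min_le_left _ _))
  have h2 := hAtip d' hD' t ht0.le ((min_le_right _ _).trans (min_le_right _ _))
  have h3 := hT.triangle (G.tip x k d) (A d t) (G.tip x k d')
  rw [hT.comm _ (A d t), h1, ht1, h2, hturn, hD, hD'] at h3
  linarith

/-- The displacement of the base point is at most the sum of the image lengths, which is at most
`maxSlope φ * L`. Since even the least displacement equals this bound, every edge has maximal slope
and the vertex images lie on an axis. -/
theorem isLegalLoop_of_loopLength_eq (hG' : G'.NoIsolated) (h : LiftData φ x k γ)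
    (hφ : IsLinearOnEdges φ) (hσ : 0 < maxSlope φ) {α : G.Loop} {L : ℝ}
    (hα : G.IsImmersedOfLength α L) (hL : G'.loopLength (φ.comp α) = maxSlope φ * L) :
    IsLegalLoop φ α := by
  have hLpos := mul_pos hσ hα.pos
  obtain ⟨m, w, hw, -, hwα, rfl⟩ := hα
  have hess : ¬ (φ.comp α).Nullhomotopic := fun hn => by
    rw [loopLength, if_pos hn] at hL
    exact hLpos.ne hL
  obtain ⟨a, ha, ha0⟩ := h.exists_isLift hG' hw hwα
  have hleast := isLeast_loopLength hG' hess ha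
  have hle : ∀ e, imageLength G.toMultigraph x k e ≤ maxSlope φ * G.len e := fun e => by
    rw [← imageSlope_le_iff, maxSlope_eq_norm hG' h hφ]
    exact (norm_imageSlope_le_iff (norm_nonneg _)).1 le_rfl e
  have h1 : G'.loopLength (φ.comp α) ≤ ∑ i, imageLength G.toMultigraph x k (w i).1 :=
    (hleast.2 ⟨G.vertexSeq x k w 0, rfl⟩).trans (treeDist_vertexSeq_le hw)
  have h2 : ∑ i, imageLength G.toMultigraph x k (w i).1 ≤ ∑ i, maxSlope φ * G.len (w i).1 :=
    Finset.sum_le_sum fun i _ => hle _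
  have h3 : ∑ i, imageLength G.toMultigraph x k (w i).1 = ∑ i, maxSlope φ * G.len (w i).1 :=
    le_antisymm h2 (by rwa [← Finset.mul_sum, ← hL])
  have h4 : ∀ i, slope φ (w i).1 = maxSlope φ := fun i => by
    rw [slope_eq_imageSlope hG' h (hφ _), imageSlope_eq_iff]
    exact (Finset.sum_eq_sum_iff_of_le fun i _ => hle (w i).1).1 h3 i (Finset.mem_univ i)
  have h5 : ∀ i, LegalTurn G.toMultigraph x k (rev (w i)) (w (i + 1)) :=
    legalTurn_of_le_displacement hw (by
      have := ha.joined 0 (0 + 1)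
      rwa [ha.add_one, ha0] at this) fun y => by
      rw [h3, ← Finset.mul_sum, ← hL]
      exact hleast.2 ⟨y, rfl⟩
  exact ⟨m, w, hw, h4, fun i => pushDirection_ne hG' h hφ (hw i) hσ (h4 i) (h4 _) (h5 i), hwα⟩

/-- There is an optimal map in every homotopy class of maps that kills no essential loop. -/
theorem exists_optimal [Finite V] (hG : ∀ x, 2 ≤ G.valence x) (hG' : G'.NoIsolated)
    (φ₀ : C(G.Realization, G'.Realization))
    (hess : ∀ α : G.Loop, ¬ α.Nullhomotopic → ¬ (φ₀.comp α).Nullhomotopic) :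
    ∃ φ : C(G.Realization, G'.Realization), φ.Homotopic φ₀ ∧ IsLinearOnEdges φ ∧ 0 < maxSlope φ ∧
      ∃ α L, G.IsImmersedOfLength α L ∧ G'.loopLength (φ₀.comp α) = maxSlope φ * L := by
  have hGi := noIsolated_of_two_le_valence hG
  obtain ⟨x₀, k, γ₀, h₀⟩ := exists_liftData hG' φ₀
  have hst : ∀ x, (∀ v, Joined (x₀ v) (x v)) → ∃ (φ : C(G.Realization, G'.Realization))
      (γ : E → unitInterval → G'.Cover), LiftData φ x k γ ∧ IsLinearOnEdges φ ∧ φ.Homotopic φ₀ := by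
    intro x hx
    obtain ⟨φ, γ, h1, h2⟩ := exists_straight (G := G) (k := k) hG' fun e =>
      (hx _).symm.trans ((h₀.joined_smul e).trans (joined_smul _ (hx _)))
    exact ⟨φ, γ, h1, fun e => ⟨_, h2 e⟩,
      (homotopic_of_liftData hGi hG' h₀ h1 hx).symm⟩
  have hlen : ∀ {φ : C(G.Realization, G'.Realization)}, φ.Homotopic φ₀ → ∀ α : G.Loop,
      (φ₀.comp α).Homotopic (φ.comp α) := fun hφ α =>
    ContinuousMap.Homotopic.comp hφ.symm (.refl α)
  obtain ⟨x, hx, hmin⟩ := exists_isMin_norm_imageSlope (G := G) (k := k) hG' x₀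
  -- Some loop is essential, by the valence condition, and its image is essential too; so its
  -- positive length bounds the maximal slope from below.
  have hσ : 0 < ‖imageSlope G x k‖ := by
    obtain ⟨β, L, hβ⟩ := exists_isImmersedOfLength_of_two_le_valence hG
    have hβ' := hβ.not_nullhomotopic hGi
    obtain ⟨φ, γ, h1, -, h3⟩ := hst x hx
    have h4 : ¬ (φ.comp β).Nullhomotopic := fun ⟨y, hy⟩ => hess β hβ' ⟨y, (hlen h3 β).trans hy⟩
    exact pos_of_mul_pos_left ((loopLength_pos hG' h4).trans_le
      (loopLength_comp_le hGi hG' h1 hβ' h4)) (loopLength_pos hGi hβ').le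
  obtain ⟨y, m, w, hy, hyle, hw, hwσ, hturn⟩ := exists_legal_cycle hσ
    (fun e => (hx _).symm.trans ((h₀.joined_smul e).trans (joined_smul _ (hx _)))) rfl
    fun y hy => hmin y fun v => (hx v).trans (hy v)
  obtain ⟨φ, γ, h1, h2, h3⟩ := hst y fun v => (hx v).trans (hy v)
  have hmax : maxSlope φ = ‖imageSlope G x k‖ := by
    rw [maxSlope_eq_norm hG' h1 h2]
    exact le_antisymm ((norm_imageSlope_le_iff hσ.le).2 hyle)
      (hmin y fun v => (hx v).trans (hy v))
  obtain ⟨α, L, hα, hL⟩ := exists_loop_of_legal_cycle hG' h1 hσ hw hwσ hturn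
  refine ⟨φ, h3, h2, hmax ▸ hσ, α, L, hα, ?_⟩
  rw [loopLength_congr (hlen h3 α), hL, hmax]

end MetricGraph

/-! ### Differences of markings. -/

namespace MarkedGraph

open Multigraph MetricGraph

variable {n : ℕ} {V E V' E' : Type*} [Fintype E] [Fintype E'] {G : MarkedGraph n V E}
  {G' : MarkedGraph n V' E'} {φ : C(G.Realization, G'.Realization)}

theorem noIsolated (G : MarkedGraph n V E) : G.NoIsolated :=
  noIsolated_of_two_le_valence G.core

/-- The markings supply a homotopy inverse `ψ` on the left, so an essential loop cannot become null
after applying `φ`. -/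
theorem IsDifferenceOfMarkings.not_nullhomotopic_comp (h : G.IsDifferenceOfMarkings G' φ)
    {α : G.Loop} (hα : ¬ α.Nullhomotopic) : ¬ (φ.comp α).Nullhomotopic := by
  intro hn
  let ψ : C(G'.Realization, G.Realization) := G.marking.toFun.comp G'.marking.invFun
  have h1 : φ.Homotopic (G'.marking.toFun.comp G.marking.invFun) := by
    have h2 := ContinuousMap.Homotopic.comp (.refl φ) G.marking.right_inv
    have h3 := ContinuousMap.Homotopic.comp h.1 (.refl G.marking.invFun)
    exact h2.symm.trans h3
  have h4 : (ψ.comp φ).Homotopic (ContinuousMap.id _) := by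
    refine (ContinuousMap.Homotopic.comp (.refl ψ) h1).trans ?_
    have h5 := ContinuousMap.Homotopic.comp (ContinuousMap.Homotopic.comp (.refl G.marking.toFun)
      G'.marking.left_inv) (.refl G.marking.invFun)
    exact h5.trans G.marking.right_inv
  obtain ⟨y, hy⟩ := hn
  exact hα ⟨ψ y, (ContinuousMap.Homotopic.comp h4 (.refl α)).symm.trans
    (ContinuousMap.Homotopic.comp (.refl ψ) hy)⟩

theorem IsDifferenceOfMarkings.loopLength_comp_le {φ₀ : C(G.Realization, G'.Realization)}
    (h : G.IsDifferenceOfMarkings G' φ) (hφ : φ.Homotopic φ₀) {α : G.Loop}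
    (hα : ¬ α.Nullhomotopic) :
    G'.loopLength (φ₀.comp α) ≤
      maxSlope (G := G.toMetricGraph) (G' := G'.toMetricGraph) φ * G.loopLength α := by
  obtain ⟨x, k, γ, hx⟩ := exists_liftData (Γ := G.toMultigraph) G'.noIsolated φ
  rw [loopLength_congr (ContinuousMap.Homotopic.comp hφ.symm (.refl α)),
    maxSlope_eq_norm G'.noIsolated hx h.2]
  exact MetricGraph.loopLength_comp_le G.noIsolated G'.noIsolated hx hα (h.not_nullhomotopic_comp hα)

end MarkedGraph

end OuterSpace

end

theorem proposition2p1 {n : ℕ} {V E V' E' : Type*} [Finite V] [Fintype E] [Finite V'] [Fintype E']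
    (G : OuterSpace.MarkedGraph n V E) (G' : OuterSpace.MarkedGraph n V' E')
    (φ₀ : C(G.Realization, G'.Realization)) (h₀ : G.IsDifferenceOfMarkings G' φ₀) :
    -- the infimum equals the supremum
    sInf (G.slopeSet G' φ₀) = sSup (G.stretchSet G' φ₀) ∧
    -- both are realized
    IsLeast (G.slopeSet G' φ₀) (sInf (G.slopeSet G' φ₀)) ∧
    IsGreatest (G.stretchSet G' φ₀) (sSup (G.stretchSet G' φ₀)) ∧
    -- the tension graph of any optimal map contains a legal loop that realizes the supremum
    ∀ φ : C(G.Realization, G'.Realization), φ.Homotopic φ₀ → G.IsDifferenceOfMarkings G' φ →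
      OuterSpace.MetricGraph.maxSlope (G := G.toMetricGraph) (G' := G'.toMetricGraph) φ =
        sInf (G.slopeSet G' φ₀) →
      ∃ α : G.Loop, OuterSpace.MetricGraph.IsLegalLoop
          (G := G.toMetricGraph) (G' := G'.toMetricGraph) φ α ∧
        ¬ α.Nullhomotopic ∧
        G'.loopLength (φ₀.comp α) / G.loopLength α = sSup (G.stretchSet G' φ₀) := by
  obtain ⟨φ₁, hφ₁, hlin₁, hσ, α₁, L, hα₁, hL⟩ := OuterSpace.MetricGraph.exists_optimal
    (G := G.toMetricGraph) (G' := G'.toMetricGraph) G.core G'.noIsolated φ₀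
    fun α hα => h₀.not_nullhomotopic_comp hα
  set σ := OuterSpace.MetricGraph.maxSlope (G := G.toMetricGraph) (G' := G'.toMetricGraph) φ₁
    with hσ_def
  have hα₁' := hα₁.not_nullhomotopic G.noIsolated
  have hlen := hα₁.loopLength_eq G.noIsolated
  have hratio : G'.loopLength (φ₀.comp α₁) / G.loopLength α₁ = σ := by
    rw [hlen, hL, mul_div_cancel_right₀ _ hα₁.pos.ne']
  have hupper : ∀ φ : C(G.Realization, G'.Realization), φ.Homotopic φ₀ →
      G.IsDifferenceOfMarkings G' φ → ∀ α : G.Loop, ¬ α.Nullhomotopic →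
      G'.loopLength (φ₀.comp α) / G.loopLength α ≤
        OuterSpace.MetricGraph.maxSlope (G := G.toMetricGraph) (G' := G'.toMetricGraph) φ :=
    fun φ hφ hd α hα => (div_le_iff₀ (OuterSpace.MetricGraph.loopLength_pos G.noIsolated hα)).2
      (hd.loopLength_comp_le hφ hα)
  have hd₁ : G.IsDifferenceOfMarkings G' φ₁ :=
    ⟨(ContinuousMap.Homotopic.comp hφ₁ (.refl _)).trans h₀.1, hlin₁⟩
  have hleast : IsLeast (G.slopeSet G' φ₀) σ := by
    refine ⟨⟨φ₁, hφ₁, hd₁, rfl⟩, ?_⟩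
    rintro _ ⟨φ, hφ, hd, rfl⟩
    exact hratio ▸ hupper φ hφ hd α₁ hα₁'
  have hgreatest : IsGreatest (G.stretchSet G' φ₀) σ := by
    refine ⟨⟨α₁, hα₁', hratio.symm⟩, ?_⟩
    rintro _ ⟨α, hα, rfl⟩
    exact hupper φ₁ hφ₁ hd₁ α hα
  rw [hleast.csInf_eq, hgreatest.csSup_eq]
  -- The same loop `α₁` works for every optimal `φ`: being stretched by the optimal factor already
  -- forces it to be legal in the tension graph of `φ`.
  refine ⟨rfl, hleast, hgreatest, fun φ hφ hd hopt => ⟨α₁, ?_, hα₁', hratio⟩⟩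
  obtain ⟨x, k, γ, hx⟩ := OuterSpace.Multigraph.exists_liftData (Γ := G.toMultigraph) G'.noIsolated φ
  refine OuterSpace.MetricGraph.isLegalLoop_of_loopLength_eq G'.noIsolated hx hd.2 (hopt ▸ hσ)
    hα₁ ?_
  rw [← OuterSpace.MetricGraph.loopLength_congr
    (ContinuousMap.Homotopic.comp hφ.symm (.refl α₁)), hL, hopt]
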